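/- Let $N\ge 0$ be an integer, let $Q,B$ be real constant $N\times N$ matrices with $Q=Q^\star\ge 0$, and suppose that $$K(t)=\frac1t\int_0^t e^{\sigma B}Qe^{\sigma B^\star}\,d\sigma$$ is positive definite for every $t>0$. Let $\mathscr A f=\operatorname{tr}(Q\nabla^2 f)+\langle BX,\nabla f\rangle$, $\mathscr K=\mathscr A-\partial_t$ on $\mathbb R^{N+1}=\mathbb R^N_X\times\mathbb R_t$, and for $X,Y\in\mathbb R^N$, $t>0$ let $$p(X,Y,t)=(4\pi)^{-N/2}\bigl(\det(tK(t))\bigr)^{-1/2}\exp\Bigl(-\frac{\langle K(t)^{-1}(Y-e^{tB}X),Y-e^{tB}X\rangle}{4t}\Bigr).$$ For $u\in\mathscr S(\mathbb R^{N+1})$ (real- or complex-valued) and $\tau>0$ put $P^{\mathscr K}_\tau u(X,t)=\int_{\mathbb R^N}p(X,Y,\tau)\,u(Y,t-\tau)\,dY$ and, for $0<s<1$, $$(-\mathscr K)^su(X,t)=-\frac{s}{\Gamma(1-s)}\int_0^\infty\tau^{-1-s}\bigl[P^{\mathscr K}_\tau u(X,t)-u(X,t)\bigr]\,d\tau .$$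 Fix $0<s<1$, let $a=1-2s$, and let $$P^{(a)}_z(X,Y,t)=\frac{1}{2^{1-a}\Gamma(\frac{1-a}2)}\,\frac{z^{1-a}}{t^{\frac{3-a}2}}\,e^{-\frac{z^2}{4t}}\,p(X,Y,t),\qquad z,t>0.$$ Assume in addition that $\operatorname{tr}B\ge 0$. Let $u\in\mathscr S(\mathbb R^{N+1})$ and define, for $(X,t)\in\mathbb R^{N+1}$, $z>0$, $$U(X,t,z)=\int_{-\infty}^t\int_{\mathbb R^N}P^{(a)}_z(X,Y,t-\tau)\,u(Y,\tau)\,dY\,d\tau=\int_0^\infty\int_{\mathbb R^N}P^{(a)}_z(X,Y,\tau)\,u(Y,t-\tau)\,dY\,d\tau .$$ Then the integrals defining $U$ and $(-\mathscr K)^su$ converge absolutely, the two expressions for $U$ agree, $U\in C^\infty(\mathbb R^{N+1}\times(0,\infty))$, and $$z^a\Bigl(\mathscr A U+\partial_z^2U+\frac az\,\partial_zU-\partial_tU\Bigr)=0\quad\text{in }\mathbb R^{N+1}\times(0,\infty).$$ Moreover, for every $1\le p<\infty$, the functions $U(\cdot,\cdot,z)$ and $z^a\partial_zU(\cdot,\cdot,z)$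 ($z>0$) and $(-\mathscr K)^su$ belong to $L^p(\mathbb R^{N+1})$, and $$\lim_{z\to0^+}\|U(\cdot,\cdot,z)-u\|_{L^p(\mathbb R^{N+1})}=0,$$ $$\lim_{z\to0^+}\Bigl\|-\frac{2^{-a}\Gamma(\frac{1-a}2)}{\Gamma(\frac{1+a}2)}\,z^a\partial_zU(\cdot,\cdot,z)-(-\mathscr K)^su\Bigr\|_{L^p(\mathbb R^{N+1})}=0 .$$ -/

import Mathlib

open MeasureTheory Filter Topology Set
open scoped Matrix ENNReal ContDiff SchwartzMap

noncomputable section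

namespace Hormander

/-- The space `ℝ^N` of the variable `X`. The space `ℝ^{N+1}` of the variables `(X, t)` is
`Sp N × ℝ`, with the product (Lebesgue) measure. -/
abbrev Sp (N : ℕ) : Type := EuclideanSpace ℝ (Fin N)

/-- The covariance matrix `K(t) = (1/t) ∫_0^t e^{σB} Q e^{σB^⋆} dσ` (integrated entrywise). -/
def covMatrix {N : ℕ} (Q B : Matrix (Fin N) (Fin N) ℝ) (t : ℝ) : Matrix (Fin N) (Fin N) ℝ :=
  t⁻¹ • Matrix.of fun i j =>
    ∫ σ in (0 : ℝ)..t, (NormedSpace.exp (σ • B) * Q * NormedSpace.exp (σ • Bᵀ)) i j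

/-- Hörmander's transition kernel
`p(X,Y,t) = (4π)^{-N/2} det(t K(t))^{-1/2} exp(-⟨K(t)⁻¹ (Y - e^{tB}X), Y - e^{tB}X⟩ / (4t))`. -/
def kernel {N : ℕ} (Q B : Matrix (Fin N) (Fin N) ℝ) (X Y : Sp N) (t : ℝ) : ℝ :=
  let v : Fin N → ℝ := Y.ofLp - NormedSpace.exp (t • B) *ᵥ X.ofLp
  (4 * Real.pi) ^ (-(N : ℝ) / 2) * (t • covMatrix Q B t).det ^ (-(1 : ℝ) / 2) *
    Real.exp (-(((covMatrix Q B t)⁻¹ *ᵥ v) ⬝ᵥ v) / (4 * t))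

/-- The Poisson kernel
`P_z^{(a)}(X,Y,t) = (2^{1-a} Γ((1-a)/2))⁻¹ z^{1-a} t^{-(3-a)/2} e^{-z²/(4t)} p(X,Y,t)`. -/
def poissonKernel {N : ℕ} (Q B : Matrix (Fin N) (Fin N) ℝ) (a z : ℝ) (X Y : Sp N) (t : ℝ) : ℝ :=
  1 / (2 ^ (1 - a) * Real.Gamma ((1 - a) / 2)) * (z ^ (1 - a) / t ^ ((3 - a) / 2)) *
    Real.exp (-z ^ 2 / (4 * t)) * kernel Q B X Y t

variable {𝕜 : Type*} [RCLike 𝕜]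

/-- The evolutive semigroup `P^𝒦_τ u(X,t) = ∫ p(X,Y,τ) u(Y,t-τ) dY`. -/
def evolSemigroup {N : ℕ} (Q B : Matrix (Fin N) (Fin N) ℝ) (τ : ℝ) (u : Sp N × ℝ → 𝕜)
    (P : Sp N × ℝ) : 𝕜 :=
  ∫ Y : Sp N, kernel Q B P.1 Y τ • u (Y, P.2 - τ)

/-- `(-𝒦)^s u(X,t) = -s/Γ(1-s) ∫_0^∞ τ^{-1-s} [P^𝒦_τ u(X,t) - u(X,t)] dτ`. -/
def fracPow {N : ℕ} (Q B : Matrix (Fin N) (Fin N) ℝ) (s : ℝ) (u : Sp N × ℝ → 𝕜)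
    (P : Sp N × ℝ) : 𝕜 :=
  (-(s / Real.Gamma (1 - s))) •
    ∫ τ in Ioi (0 : ℝ), τ ^ (-1 - s) • (evolSemigroup Q B τ u P - u P)

/-- `U(X,t,z) = ∫_0^∞ ∫ P_z^{(a)}(X,Y,τ) u(Y,t-τ) dY dτ`. -/
def extension {N : ℕ} (Q B : Matrix (Fin N) (Fin N) ℝ) (a : ℝ) (u : Sp N × ℝ → 𝕜)
    (P : Sp N × ℝ) (z : ℝ) : 𝕜 :=
  ∫ τ in Ioi (0 : ℝ), ∫ Y : Sp N, poissonKernel Q B a z P.1 Y τ • u (Y, P.2 - τ)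

/-- The partial derivative `∂f/∂X_i`. -/
def partialX {N : ℕ} (i : Fin N) (f : Sp N → 𝕜) (X : Sp N) : 𝕜 :=
  fderiv ℝ f X (EuclideanSpace.single i 1)

/-- `𝒜f(X) = tr(Q ∇²f(X)) + ⟨BX, ∇f(X)⟩`. -/
def opA {N : ℕ} (Q B : Matrix (Fin N) (Fin N) ℝ) (f : Sp N → 𝕜) (X : Sp N) : 𝕜 :=
  (∑ i, ∑ j, Q i j • partialX j (partialX i f) X) + ∑ i, (B *ᵥ X.ofLp) i • partialX i f X

/-- `𝒦_a U = z^a (𝒜U + ∂_z²U + (a/z) ∂_zU - ∂_tU)` at the point `(X,t,z)`. -/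
def opKa {N : ℕ} (Q B : Matrix (Fin N) (Fin N) ℝ) (a : ℝ) (U : Sp N × ℝ → ℝ → 𝕜)
    (P : Sp N × ℝ) (z : ℝ) : 𝕜 :=
  z ^ a • (opA Q B (fun X => U (X, P.2) z) P.1 + deriv (deriv (U P)) z
    + (a / z) • deriv (U P) z - deriv (fun t => U (P.1, t) z) P.2)

/-- The constant `2^{-a} Γ((1-a)/2) / Γ((1+a)/2)`. -/
def neumannConst (a : ℝ) : ℝ :=
  2 ^ (-a) * Real.Gamma ((1 - a) / 2) / Real.Gamma ((1 + a) / 2)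

end Hormander

end

/-! The extension is subordinate to the semigroup: `U(·,z) = ∫ w_z(τ) P_τ u dτ`, where `w_z(τ)`, a
multiple of `z^{2s} τ^{-1-s} e^{-z²/(4τ)}`, is a probability density on `τ > 0` (`extension_eq`,
`integral_poissonWeight`). The semigroup is a Gaussian average: `P_τ u(X,t)` is the mean of
`u(e^{τB}X + 2C(τ)^{1/2}V, t-τ)` over a Gaussian vector `V`, with `C(τ) = τK(τ)`
(`evolSemigroup_eq`).

Boundary values. As `w_z` has mass one and `∂_z w_z` has mass zero, both `U - u` and `∂_z U` are
integrals of `P_τ u - u` against explicit weights. This difference is at most `M min(1,τ)`,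
uniformly and in `L¹` (`exists_evolSemigroup_sub_bound`): for small times the linear Taylor term
averages to zero and the noise has variance `O(τ)`; for large times `P_τ` contracts `L^∞`, and it
contracts `L¹` because `tr B ≥ 0` forces `det e^{τB} ≥ 1`. Interpolation gives every `L^p`
(`eLpNorm_weight_integral_le`). It remains to study scalar weights against `min(1,τ)`: `w_z ≤ c
z^{2s} τ^{-1-s}` gives the Dirichlet limit. With `x = z²/(4τ)`, the weight of the Neumann error is a
multiple of `τ^{-1-s} (1 - (1 - x/s) e^{-x})`, which tends to zero dominatedly.

Smoothness and equation. By Fourier inversion `u` is a superposition of plane waves, and `P_τ` maps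
a plane wave to another one, of frequency `e^{τB^⋆}ξ`, damped by `e^{-4π²⟨C(τ)ξ,ξ⟩}`. With `y =
z²/4` this gives `U = c z^{2s} V(X,t,y)`, where `V` superposes exponentials of linear forms in
`(X,t,y)`. Derivatives bring down values of these forms, and all moments are finite: the frequency
may grow exponentially in `τ`, but the damping compensates for it (`exists_coflow_pow_mul_exp_le`).
The Bessel operator becomes `(1+s)∂_y + y∂_y²`, and the symbol of the full operator times a wave is
exactly the `τ`-derivative of that wave (`hasDerivAt_wave`). The wave vanishes at `τ = 0` and `τ =
∞`, so its integral against the symbol is zero. -/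

namespace Hormander

/-! ### Linear flows and the covariance form -/

section Flow

variable {E : Type*} [NormedAddCommGroup E] [InnerProductSpace ℝ E]

/-- The one-parameter group `e^{τb}` generated by a linear map `b`. -/
noncomputable def flow (b : E →L[ℝ] E) (τ : ℝ) : E →L[ℝ] E := NormedSpace.exp (τ • b)

theorem flow_zero (b : E →L[ℝ] E) : flow b 0 = ContinuousLinearMap.id ℝ E := by
  rw [flow, zero_smul]
  exact NormedSpace.exp_zero

variable [FiniteDimensional ℝ E]

theorem flow_add (b : E →L[ℝ] E) (σ τ : ℝ) : flow b (σ + τ) = flow b σ ∘L flow b τ := by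
  let _ : NormedAlgebra ℚ (E →L[ℝ] E) := NormedAlgebra.restrictScalars ℚ ℝ _
  rw [flow, add_smul]
  exact NormedSpace.exp_add_of_commute (((Commute.refl b).smul_left σ).smul_right τ)

theorem hasDerivAt_flow (b : E →L[ℝ] E) (τ : ℝ) : HasDerivAt (flow b) (flow b τ ∘L b) τ :=
  hasDerivAt_exp_smul_const b τ

theorem continuous_flow (b : E →L[ℝ] E) : Continuous (flow b) :=
  continuous_iff_continuousAt.2 fun τ => (hasDerivAt_flow b τ).continuousAt

theorem flow_neg_flow (b : E →L[ℝ] E) (τ : ℝ) (x : E) : flow b (-τ) (flow b τ x) = x := by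
  rw [← ContinuousLinearMap.comp_apply, ← flow_add, neg_add_cancel, flow_zero]
  rfl

theorem hasDerivAt_flow_apply (b : E →L[ℝ] E) (τ : ℝ) (x : E) :
    HasDerivAt (fun τ => flow b τ x) (flow b τ (b x)) τ := by
  simpa using (hasDerivAt_flow b τ).clm_apply (hasDerivAt_const τ x)

/-- The adjoint flow `e^{τb^⋆}`. -/
noncomputable def coflow (b : E →L[ℝ] E) (τ : ℝ) : E →L[ℝ] E :=
  ContinuousLinearMap.adjoint (flow b τ)

theorem continuous_coflow (b : E →L[ℝ] E) : Continuous (coflow b) :=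
  ContinuousLinearMap.adjoint.continuous.comp (continuous_flow b)

theorem coflow_add (b : E →L[ℝ] E) (σ τ : ℝ) : coflow b (σ + τ) = coflow b σ ∘L coflow b τ := by
  rw [add_comm, coflow, flow_add, ContinuousLinearMap.adjoint_comp, coflow, coflow]

theorem inner_coflow (b : E →L[ℝ] E) (τ : ℝ) (x y : E) :
    inner ℝ (coflow b τ x) y = inner ℝ x (flow b τ y) :=
  ContinuousLinearMap.adjoint_inner_left _ _ _

/-- The quadratic form `⟨C(τ)ξ, ξ⟩` of the covariance `C(τ) = ∫_0^τ e^{σb} q e^{σb^⋆} dσ`. -/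
noncomputable def covForm (q b : E →L[ℝ] E) (τ : ℝ) (ξ : E) : ℝ :=
  ∫ σ in (0 : ℝ)..τ, inner ℝ (coflow b σ ξ) (q (coflow b σ ξ))

theorem continuous_covForm_integrand (q b : E →L[ℝ] E) (ξ : E) :
    Continuous fun σ => inner ℝ (coflow b σ ξ) (q (coflow b σ ξ)) := by
  have := continuous_coflow b
  fun_prop

theorem hasDerivAt_covForm (q b : E →L[ℝ] E) (τ : ℝ) (ξ : E) :
    HasDerivAt (fun τ => covForm q b τ ξ) (inner ℝ (coflow b τ ξ) (q (coflow b τ ξ))) τ :=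
  ((continuous_covForm_integrand q b ξ).integral_hasStrictDerivAt 0 τ).hasDerivAt

theorem covForm_nonneg {q : E →L[ℝ] E} (hq : ∀ x, 0 ≤ inner ℝ x (q x)) (b : E →L[ℝ] E) {τ : ℝ}
    (hτ : 0 ≤ τ) (ξ : E) : 0 ≤ covForm q b τ ξ :=
  intervalIntegral.integral_nonneg hτ fun _ _ => hq _

/-- Only the last unit of time is kept: the group law turns the integral over `[τ-1, τ]` into the
form at time one on the transported covector, and the rest is nonnegative. The lower bound thus
follows the adjoint flow however fast it grows. -/
theorem covForm_one_le {q : E →L[ℝ] E} (hq : ∀ x, 0 ≤ inner ℝ x (q x)) (b : E →L[ℝ] E) {τ : ℝ}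
    (hτ : 1 ≤ τ) (ξ : E) : covForm q b 1 (coflow b (τ - 1) ξ) ≤ covForm q b τ ξ := by
  have hc := continuous_covForm_integrand q b ξ
  have h1 : covForm q b 1 (coflow b (τ - 1) ξ) =
      ∫ σ in (τ - 1)..τ, inner ℝ (coflow b σ ξ) (q (coflow b σ ξ)) := by
    have := intervalIntegral.integral_comp_add_right (a := 0) (b := 1)
      (fun σ => inner ℝ (coflow b σ ξ) (q (coflow b σ ξ))) (τ - 1)
    rw [zero_add, add_sub_cancel] at this
    rw [← this, covForm]
    simp only [coflow_add, ContinuousLinearMap.comp_apply]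
  have h2 := intervalIntegral.integral_add_adjacent_intervals
    (hc.intervalIntegrable 0 (τ - 1)) (hc.intervalIntegrable (μ := volume) (τ - 1) τ)
  have h3 : 0 ≤ ∫ σ in (0 : ℝ)..(τ - 1), inner ℝ (coflow b σ ξ) (q (coflow b σ ξ)) :=
    intervalIntegral.integral_nonneg (by linarith) fun _ _ => hq _
  rw [h1, covForm, ← h2]
  linarith

theorem continuous_covForm (q b : E →L[ℝ] E) :
    Continuous fun p : ℝ × E => covForm q b p.1 p.2 := by
  have h := continuous_coflow b
  have h1 : Continuous fun p : (ℝ × E) × ℝ =>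
      inner ℝ (coflow b p.2 p.1.2) (q (coflow b p.2 p.1.2)) := by fun_prop
  have := intervalIntegral.continuous_parametric_intervalIntegral_of_continuous
    (f := fun (p : ℝ × E) (σ : ℝ) => inner ℝ (coflow b σ p.2) (q (coflow b σ p.2)))
    (μ := volume) (a₀ := 0) h1 (s := fun p => p.1) continuous_fst
  exact this

/-- Bound of the flows on `[0, 1]`. -/
theorem exists_flow_bound (b : E →L[ℝ] E) :
    ∃ M : ℝ, 1 ≤ M ∧ ∀ τ ∈ Icc (-1 : ℝ) 1, ‖flow b τ‖ ≤ M ∧ ‖coflow b τ‖ ≤ M := by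
  obtain ⟨M, hM⟩ := isCompact_Icc.exists_bound_of_continuousOn (s := Icc (-1 : ℝ) 1)
    (continuous_flow b).continuousOn
  refine ⟨max M 1, le_max_right _ _, fun τ hτ => ⟨(hM τ hτ).trans (le_max_left _ _), ?_⟩⟩
  rw [coflow, LinearIsometryEquiv.norm_map]
  exact (hM τ hτ).trans (le_max_left _ _)

/-- Source of the variance bound `O(τ)` for the noise at small times. -/
theorem exists_covForm_le (q b : E →L[ℝ] E) :
    ∃ M : ℝ, 0 ≤ M ∧ ∀ τ ∈ Icc (0 : ℝ) 1, ∀ ξ, covForm q b τ ξ ≤ M * τ * ‖ξ‖ ^ 2 := by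
  obtain ⟨M, hM1, hM⟩ := exists_flow_bound b
  refine ⟨‖q‖ * M ^ 2, by positivity, fun τ hτ ξ => ?_⟩
  have h : ∀ σ ∈ Icc (0 : ℝ) τ,
      inner ℝ (coflow b σ ξ) (q (coflow b σ ξ)) ≤ ‖q‖ * M ^ 2 * ‖ξ‖ ^ 2 := by
    intro σ hσ
    have h1 : ‖coflow b σ ξ‖ ≤ M * ‖ξ‖ :=
      ((coflow b σ).le_opNorm ξ).trans (by
        gcongr
        exact (hM σ ⟨by linarith [hσ.1], hσ.2.trans hτ.2⟩).2)
    calc inner ℝ (coflow b σ ξ) (q (coflow b σ ξ))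
        ≤ ‖coflow b σ ξ‖ * ‖q (coflow b σ ξ)‖ := real_inner_le_norm _ _
      _ ≤ ‖coflow b σ ξ‖ * (‖q‖ * ‖coflow b σ ξ‖) := by gcongr; exact q.le_opNorm _
      _ = ‖q‖ * ‖coflow b σ ξ‖ ^ 2 := by ring
      _ ≤ ‖q‖ * (M * ‖ξ‖) ^ 2 := by gcongr
      _ = _ := by ring
  calc covForm q b τ ξ ≤ ∫ _ in (0 : ℝ)..τ, ‖q‖ * M ^ 2 * ‖ξ‖ ^ 2 :=
        intervalIntegral.integral_mono_on hτ.1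
          ((continuous_covForm_integrand q b ξ).intervalIntegrable _ _)
          (intervalIntegrable_const) h
    _ = _ := by simp; ring

/-- Gaussian damping controls the powers of the adjoint flow:
`|e^{τb^⋆}ξ|^k e^{-c⟨C(τ)ξ, ξ⟩}` grows at most polynomially in `ξ`, uniformly in `τ ≥ 0`. -/
theorem exists_coflow_pow_mul_exp_le {q : E →L[ℝ] E} (hq : ∀ x, 0 ≤ inner ℝ x (q x))
    (b : E →L[ℝ] E) (hpos : ∀ ξ, ξ ≠ 0 → 0 < covForm q b 1 ξ) {c : ℝ} (hc : 0 < c) (k : ℕ) :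
    ∃ M : ℝ, 0 ≤ M ∧ ∀ τ, 0 ≤ τ → ∀ ξ,
      ‖coflow b τ ξ‖ ^ k * Real.exp (-c * covForm q b τ ξ) ≤ M * (1 + ‖ξ‖) ^ k := by
  obtain ⟨M, hM1, hM⟩ := exists_flow_bound b
  -- coercivity of the form at time one
  obtain ⟨δ, hδ, hcoer⟩ : ∃ δ : ℝ, 0 < δ ∧ ∀ ξ, δ * ‖ξ‖ ^ 2 ≤ covForm q b 1 ξ := by
    have hhom : ∀ (r : ℝ) (ξ : E), covForm q b 1 (r • ξ) = r ^ 2 * covForm q b 1 ξ := by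
      intro r ξ
      rw [covForm, covForm, ← intervalIntegral.integral_const_mul]
      congr 1
      funext σ
      simp only [map_smul, inner_smul_left, inner_smul_right]
      simp
      ring
    by_cases hne : (Metric.sphere (0 : E) 1).Nonempty
    · have hcont : Continuous fun ξ : E => covForm q b 1 ξ :=
        (continuous_covForm q b).comp (by fun_prop : Continuous fun ξ : E => ((1 : ℝ), ξ))
      obtain ⟨ξ₀, h0, hmin⟩ := (isCompact_sphere (0 : E) 1).exists_isMinOn hne hcont.continuousOn
      refine ⟨covForm q b 1 ξ₀, hpos _ (by rintro rfl; simp at h0), fun ξ => ?_⟩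
      by_cases hξ : ξ = 0
      · subst hξ
        simpa using covForm_nonneg hq b zero_le_one 0
      · have h1 : ‖ξ‖⁻¹ • ξ ∈ Metric.sphere (0 : E) 1 := by
          simp [norm_smul, norm_ne_zero_iff.2 hξ]
        have h2 : covForm q b 1 ξ₀ ≤ covForm q b 1 (‖ξ‖⁻¹ • ξ) := hmin h1
        rw [hhom] at h2
        have h3 : 0 < ‖ξ‖ := norm_pos_iff.2 hξ
        calc covForm q b 1 ξ₀ * ‖ξ‖ ^ 2
            ≤ (‖ξ‖⁻¹ ^ 2 * covForm q b 1 ξ) * ‖ξ‖ ^ 2 := by gcongr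
          _ = covForm q b 1 ξ := by field_simp
    -- An empty unit sphere means that the space is trivial, so any constant serves.
    · refine ⟨1, one_pos, fun ξ => ?_⟩
      have hξ : ξ = 0 := by
        by_contra hξ
        exact hne ⟨‖ξ‖⁻¹ • ξ, by simp [norm_smul, norm_ne_zero_iff.2 hξ]⟩
      subst hξ
      simpa using covForm_nonneg hq b zero_le_one 0
  -- `x^k e^{-cδx²}` is bounded
  obtain ⟨A, hA0, hA⟩ : ∃ A : ℝ, 0 ≤ A ∧ ∀ x : ℝ, 0 ≤ x →
      x ^ k * Real.exp (-c * (δ * x ^ 2)) ≤ A := by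
    have hd : 0 < c * δ := mul_pos hc hδ
    -- For `x ≥ 1`, `x^k ≤ x^{2k}` and one term of the exponential series gives `x^{2k} (cδ)^k / k!
    -- ≤ e^{cδx²}`. The added `1` covers `x ≤ 1`.
    refine ⟨(Nat.factorial k : ℝ) * ((c * δ) ^ k)⁻¹ + 1, by positivity, fun x hx => ?_⟩
    rcases le_total x 1 with h1 | h1
    · have : x ^ k * Real.exp (-c * (δ * x ^ 2)) ≤ 1 * 1 := by
        gcongr
        · exact pow_le_one₀ hx h1
        · rw [Real.exp_le_one_iff]
          have : 0 ≤ c * (δ * x ^ 2) := by positivity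
          linarith
      have h' : 0 ≤ (Nat.factorial k : ℝ) * ((c * δ) ^ k)⁻¹ := by positivity
      linarith
    · have h2 := Real.pow_div_factorial_le_exp (c * δ * x ^ 2) (by positivity) k
      have h3 : x ^ k ≤ (x ^ 2) ^ k := by
        gcongr
        nlinarith
      rw [div_le_iff₀ (by positivity), mul_pow] at h2
      have h4 : x ^ k ≤ Nat.factorial k * ((c * δ) ^ k)⁻¹ * Real.exp (c * δ * x ^ 2) := by
        refine h3.trans ?_
        rw [mul_right_comm, ← div_eq_mul_inv, le_div_iff₀ (by positivity)]
        linarith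
      have h5 : x ^ k * Real.exp (-c * (δ * x ^ 2)) ≤ Nat.factorial k * ((c * δ) ^ k)⁻¹ := by
        calc x ^ k * Real.exp (-c * (δ * x ^ 2))
            ≤ Nat.factorial k * ((c * δ) ^ k)⁻¹ * Real.exp (c * δ * x ^ 2) *
                Real.exp (-c * (δ * x ^ 2)) := by gcongr
          _ = _ := by
            rw [mul_assoc, ← Real.exp_add]
            ring_nf
            simp
      linarith
  refine ⟨M ^ k + M ^ k * A, by positivity, fun τ hτ ξ => ?_⟩
  have h1 : (1 : ℝ) ≤ (1 + ‖ξ‖) ^ k := one_le_pow₀ (by linarith [norm_nonneg ξ])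
  rcases le_total τ 1 with hτ1 | hτ1
  · have h2 : ‖coflow b τ ξ‖ ≤ M * (1 + ‖ξ‖) :=
      ((coflow b τ).le_opNorm ξ).trans (by
        have := (hM τ ⟨by linarith, hτ1⟩).2
        gcongr
        linarith)
    have h3 : Real.exp (-c * covForm q b τ ξ) ≤ 1 := by
      rw [Real.exp_le_one_iff]
      have := mul_nonneg hc.le (covForm_nonneg hq b hτ ξ)
      linarith
    calc ‖coflow b τ ξ‖ ^ k * Real.exp (-c * covForm q b τ ξ)
        ≤ (M * (1 + ‖ξ‖)) ^ k * 1 := by gcongr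
      _ = M ^ k * (1 + ‖ξ‖) ^ k := by rw [mul_pow, mul_one]
      _ ≤ _ := by
        have : 0 ≤ M ^ k * A * (1 + ‖ξ‖) ^ k := by positivity
        linarith
  -- Beyond time one both the power and the damping are controlled by the same vector `ζ`, so that
  -- any growth of the flow in `τ` drops out.
  · set ζ := coflow b (τ - 1) ξ with hζ
    have h2 : coflow b τ ξ = coflow b 1 ζ := by
      rw [hζ, ← ContinuousLinearMap.comp_apply, ← coflow_add, add_sub_cancel]
    have h3 : ‖coflow b τ ξ‖ ≤ M * ‖ζ‖ := by
      rw [h2]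
      refine ((coflow b 1).le_opNorm ζ).trans ?_
      gcongr
      exact (hM 1 ⟨by norm_num, le_rfl⟩).2
    have h4 : δ * ‖ζ‖ ^ 2 ≤ covForm q b τ ξ := (hcoer ζ).trans (covForm_one_le hq b hτ1 ξ)
    calc ‖coflow b τ ξ‖ ^ k * Real.exp (-c * covForm q b τ ξ)
        ≤ (M * ‖ζ‖) ^ k * Real.exp (-c * (δ * ‖ζ‖ ^ 2)) := by
          gcongr ?_ ^ k * Real.exp ?_
          nlinarith
      _ = M ^ k * (‖ζ‖ ^ k * Real.exp (-c * (δ * ‖ζ‖ ^ 2))) := by rw [mul_pow]; ring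
      _ ≤ M ^ k * A := by gcongr; exact hA _ (norm_nonneg _)
      _ ≤ M ^ k * A * (1 + ‖ξ‖) ^ k := le_mul_of_one_le_right (by positivity) h1
      _ ≤ _ := by
        have : 0 ≤ M ^ k * (1 + ‖ξ‖) ^ k := by positivity
        linarith

end Flow

/-! ### Volume growth of the flow -/

section Det

theorem hasDerivAt_det_one_add_smul {n : Type*} [Fintype n] [DecidableEq n] (M : Matrix n n ℝ) :
    HasDerivAt (fun t : ℝ => (1 + t • M).det) M.trace 0 := by
  have h : (fun t : ℝ => (1 + t • M).det) = fun t => 1 + M.trace * t +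
      ((Matrix.det (1 + (Polynomial.X : Polynomial ℝ) • M.map Polynomial.C)).divX.divX).eval t
        * t ^ 2 := by
    funext t
    exact Matrix.det_one_add_smul t M
  rw [h]
  have h1 : HasDerivAt (fun t : ℝ => M.trace * t) M.trace 0 := by
    simpa using (hasDerivAt_id (0 : ℝ)).const_mul M.trace
  have h2 := (Polynomial.hasDerivAt ((Matrix.det (1 + (Polynomial.X : Polynomial ℝ) •
    M.map Polynomial.C)).divX.divX) (0 : ℝ)).mul (hasDerivAt_pow 2 (0 : ℝ))
  simpa [Pi.add_def, Pi.mul_def] using! (h1.const_add 1).add h2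

variable {E : Type*} [NormedAddCommGroup E] [InnerProductSpace ℝ E] [FiniteDimensional ℝ E]

/-- The curves `e^{tb}` and `id + tb` have the same value and velocity at `t = 0`. As the
determinant is differentiable (Leibniz formula), its derivative along the first is the one along the
second, where it is a polynomial in `t` with linear coefficient the trace. -/
theorem hasDerivAt_det_flow_zero (b : E →L[ℝ] E) :
    HasDerivAt (fun t : ℝ => (flow b t).det) (LinearMap.trace ℝ E b) 0 := by
  let v := Module.finBasis ℝ E
  let e : (E →L[ℝ] E) →ₗ[ℝ] Matrix (Fin (Module.finrank ℝ E)) (Fin (Module.finrank ℝ E)) ℝ :=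
    (LinearMap.toMatrix v v).toLinearMap ∘ₗ ContinuousLinearMap.coeLM ℝ
  have hdet : ∀ A : E →L[ℝ] E, A.det = (e A).det := fun A =>
    (LinearMap.det_toMatrix v A.toLinearMap).symm
  have hent : ∀ i j, Differentiable ℝ fun A : E →L[ℝ] E => e A i j := fun i j =>
    (LinearMap.toContinuousLinearMap (Matrix.entryLinearMap ℝ ℝ i j ∘ₗ e)).differentiable
  have hd : DifferentiableAt ℝ (fun A : E →L[ℝ] E => A.det) (ContinuousLinearMap.id ℝ E) := by
    simp only [hdet, Matrix.det_apply]
    refine DifferentiableAt.fun_sum fun σ _ => DifferentiableAt.const_smul ?_ _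
    exact (HasFDerivAt.finsetProd fun i _ => (hent (σ i) i _).hasFDerivAt).differentiableAt
  have h1 : HasDerivAt (fun t : ℝ => ContinuousLinearMap.id ℝ E + t • b) b 0 := by
    simpa using ((hasDerivAt_id (0 : ℝ)).smul_const b).const_add (ContinuousLinearMap.id ℝ E)
  have h2 : HasDerivAt (flow b) b 0 := by
    simpa [flow_zero] using hasDerivAt_flow b 0
  have e1 := HasFDerivAt.comp_hasDerivAt_of_eq (0 : ℝ) hd.hasFDerivAt h1 (by simp)
  have e2 := HasFDerivAt.comp_hasDerivAt_of_eq (0 : ℝ) hd.hasFDerivAt h2 (flow_zero b).symm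
  have h3 : ((fun A : E →L[ℝ] E => A.det) ∘ fun t : ℝ => ContinuousLinearMap.id ℝ E + t • b) =
      fun t => (1 + t • e b).det := by
    funext t
    have : e (ContinuousLinearMap.id ℝ E) = 1 := LinearMap.toMatrix_id v
    simp only [Function.comp, hdet, map_add, map_smul, this]
  have h4 : (e b).trace = LinearMap.trace ℝ E b := (LinearMap.trace_eq_matrix_trace ℝ v _).symm
  rw [h3] at e1
  rw [e1.unique (hasDerivAt_det_one_add_smul (e b)), h4] at e2
  exact e2

/-- Liouville's formula: `f(t) = det e^{tb}` is multiplicative, so `f(x) = f(t) f(x-t)` moves the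
derivative at zero to any `t` and yields `f' = (tr b) f`. Also `f(t) = f(t/2)² ≥ 0`, so `f` is
monotone from `f(0) = 1`. The sign of the trace enters the whole proof only through this bound. -/
theorem one_le_det_flow {b : E →L[ℝ] E} (hb : 0 ≤ LinearMap.trace ℝ E b) {τ : ℝ} (hτ : 0 ≤ τ) :
    1 ≤ (flow b τ).det := by
  set f : ℝ → ℝ := fun t => (flow b t).det with hf
  have hadd : ∀ s t, f (s + t) = f s * f t := fun s t => by
    simp only [hf, flow_add]
    exact LinearMap.det_comp _ _
  have h0 : f 0 = 1 := by
    simp only [hf, flow_zero]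
    exact LinearMap.det_id
  have hnn : ∀ t, 0 ≤ f t := fun t => by
    have := hadd (t / 2) (t / 2)
    rw [add_halves] at this
    rw [this]; exact mul_self_nonneg _
  have hder : ∀ t, HasDerivAt f (f t * LinearMap.trace ℝ E b) t := fun t => by
    have h1 : HasDerivAt (fun x => f t * f (x - t)) (f t * LinearMap.trace ℝ E b) t := by
      refine HasDerivAt.const_mul _ ?_
      have : HasDerivAt f (LinearMap.trace ℝ E b) (t - t) := by
        simpa using hasDerivAt_det_flow_zero b
      simpa using HasDerivAt.comp_sub_const t t this
    refine h1.congr_of_eventuallyEq (Eventually.of_forall fun x => ?_)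
    simp [← hadd]
  have hmono : Monotone f := monotone_of_deriv_nonneg (fun t => (hder t).differentiableAt)
    fun t => by rw [(hder t).deriv]; exact mul_nonneg (hnn t) hb
  simpa [h0] using hmono hτ

end Det

/-! ### Affine changes of variables -/

section ChangeOfVariables

variable {E : Type*} [NormedAddCommGroup E] [NormedSpace ℝ E] [FiniteDimensional ℝ E]

theorem image_univ_affine {A : E →L[ℝ] E} (hA : A.det ≠ 0) (c : E) :
    (fun x => c + A x) '' univ = univ ∧ InjOn (fun x => c + A x) univ := by
  have hu : IsUnit (A : E →ₗ[ℝ] E) :=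
    (LinearMap.isUnit_iff_isUnit_det _).2 (isUnit_iff_ne_zero.2 hA)
  have hbij : Function.Bijective A := (Module.End.isUnit_iff _).1 hu
  constructor
  · rw [image_univ]
    refine (Set.range_eq_univ).2 fun y => ?_
    obtain ⟨x, hx⟩ := hbij.2 (y - c)
    exact ⟨x, by simp [hx]⟩
  · intro x _ y _ h
    exact hbij.1 (add_left_cancel h)

variable [MeasurableSpace E] [BorelSpace E] {G : Type*} [NormedAddCommGroup G] [NormedSpace ℝ G]

theorem integral_comp_affine (μ : Measure E) [μ.IsAddHaarMeasure] {A : E →L[ℝ] E}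
    (hA : A.det ≠ 0) (c : E) (f : E → G) :
    ∫ y, f y ∂μ = ∫ x, |A.det| • f (c + A x) ∂μ := by
  obtain ⟨h1, h2⟩ := image_univ_affine hA c
  have := integral_image_eq_integral_abs_det_fderiv_smul μ MeasurableSet.univ
    (f := fun x => c + A x) (f' := fun _ => A)
    (fun x _ => (A.hasFDerivAt.const_add c).hasFDerivWithinAt) h2 f
  simpa [h1] using this

theorem integrable_comp_affine_iff (μ : Measure E) [μ.IsAddHaarMeasure] {A : E →L[ℝ] E}
    (hA : A.det ≠ 0) (c : E) (f : E → G) :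
    Integrable f μ ↔ Integrable (fun x => |A.det| • f (c + A x)) μ := by
  obtain ⟨h1, h2⟩ := image_univ_affine hA c
  have := integrableOn_image_iff_integrableOn_abs_det_fderiv_smul μ MeasurableSet.univ
    (f := fun x => c + A x) (f' := fun _ => A)
    (fun x _ => (A.hasFDerivAt.const_add c).hasFDerivWithinAt) h2 f
  simpa [h1] using this

/-- A volume-expanding substitution can only decrease the integral; this is the `L¹` contraction for
a single value of the noise. -/
theorem lintegral_comp_affine_le (μ : Measure E) [μ.IsAddHaarMeasure] {A : E →L[ℝ] E}
    (hA : 1 ≤ A.det) (c : E) (f : E → ℝ≥0∞) :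
    ∫⁻ x, f (c + A x) ∂μ ≤ ∫⁻ y, f y ∂μ := by
  obtain ⟨h1, h2⟩ := image_univ_affine (by linarith : A.det ≠ 0) c
  have := lintegral_image_eq_lintegral_abs_det_fderiv_mul μ MeasurableSet.univ
    (f := fun x => c + A x) (f' := fun _ => A)
    (fun x _ => (A.hasFDerivAt.const_add c).hasFDerivWithinAt) h2 f
  rw [h1, setLIntegral_univ, setLIntegral_univ] at this
  rw [this]
  refine lintegral_mono fun x => ?_
  refine le_mul_of_one_le_left zero_le ?_
  rw [ENNReal.one_le_ofReal]
  exact hA.trans (le_abs_self _)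

end ChangeOfVariables

/-! ### The transition kernel as an affine image of a Gaussian -/

section Kernel

variable {N : ℕ}

/-- A matrix, as a linear map of `ℝ^N`. -/
noncomputable def matCLM (M : Matrix (Fin N) (Fin N) ℝ) : Sp N →L[ℝ] Sp N :=
  Matrix.toEuclideanCLM (𝕜 := ℝ) M

theorem ofLp_matCLM (M : Matrix (Fin N) (Fin N) ℝ) (X : Sp N) :
    (matCLM M X).ofLp = M *ᵥ X.ofLp := rfl

theorem inner_matCLM (M : Matrix (Fin N) (Fin N) ℝ) (x y : Sp N) :
    inner ℝ x (matCLM M y) = x.ofLp ⬝ᵥ M *ᵥ y.ofLp :=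
  Matrix.inner_toEuclideanCLM M x y

theorem inner_eq_dotProduct (x y : Sp N) : inner ℝ x y = x.ofLp ⬝ᵥ y.ofLp := by
  simp [PiLp.inner_apply, dotProduct, mul_comm]

theorem continuous_matCLM : Continuous (matCLM (N := N)) :=
  LinearMap.continuous_of_finiteDimensional
    (Matrix.toEuclideanCLM (𝕜 := ℝ) (n := Fin N)).toAlgEquiv.toLinearMap

theorem matCLM_exp (B : Matrix (Fin N) (Fin N) ℝ) (τ : ℝ) :
    matCLM (NormedSpace.exp (τ • B)) = flow (matCLM B) τ := by
  -- The exponential depends only on the topology, so any Banach algebra norm on matrices may be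
  -- used.
  let _ : NormedRing (Matrix (Fin N) (Fin N) ℝ) := Matrix.linftyOpNormedRing
  let _ : NormedAlgebra ℝ (Matrix (Fin N) (Fin N) ℝ) := Matrix.linftyOpNormedAlgebra
  let _ : NormedAlgebra ℚ (Matrix (Fin N) (Fin N) ℝ) := NormedAlgebra.restrictScalars ℚ ℝ _
  have h : τ • matCLM B = Matrix.toEuclideanCLM (𝕜 := ℝ) (τ • B) := (map_smul _ _ _).symm
  rw [flow, h]
  exact NormedSpace.map_exp _ continuous_matCLM (τ • B)

theorem adjoint_matCLM (M : Matrix (Fin N) (Fin N) ℝ) :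
    ContinuousLinearMap.adjoint (matCLM M) = matCLM Mᵀ := by
  rw [matCLM, matCLM, ← ContinuousLinearMap.star_eq_adjoint, ← map_star,
    Matrix.star_eq_conjTranspose, Matrix.conjTranspose_eq_transpose_of_trivial]

theorem coflow_matCLM (B : Matrix (Fin N) (Fin N) ℝ) (τ : ℝ) :
    coflow (matCLM B) τ = matCLM (NormedSpace.exp (τ • Bᵀ)) := by
  rw [coflow, ← matCLM_exp, adjoint_matCLM, ← Matrix.exp_transpose, Matrix.transpose_smul]

theorem det_matCLM (M : Matrix (Fin N) (Fin N) ℝ) : (matCLM M).det = M.det := by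
  rw [ContinuousLinearMap.det, matCLM, Matrix.coe_toEuclideanCLM_eq_toEuclideanLin,
    Matrix.toEuclideanLin_eq_toLin_orthonormal, LinearMap.det_toLin]

theorem trace_matCLM (M : Matrix (Fin N) (Fin N) ℝ) :
    LinearMap.trace ℝ (Sp N) (matCLM M) = M.trace := by
  rw [matCLM, Matrix.coe_toEuclideanCLM_eq_toEuclideanLin,
    Matrix.toEuclideanLin_eq_toLin_orthonormal, Matrix.trace_toLin_eq]

theorem continuous_exp_smul (B : Matrix (Fin N) (Fin N) ℝ) :
    Continuous fun σ : ℝ => NormedSpace.exp (σ • B) := by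
  let _ : NormedRing (Matrix (Fin N) (Fin N) ℝ) := Matrix.linftyOpNormedRing
  let _ : NormedAlgebra ℝ (Matrix (Fin N) (Fin N) ℝ) := Matrix.linftyOpNormedAlgebra
  let _ : NormedAlgebra ℚ (Matrix (Fin N) (Fin N) ℝ) := NormedAlgebra.restrictScalars ℚ ℝ _
  have h : Continuous (NormedSpace.exp : Matrix (Fin N) (Fin N) ℝ → Matrix (Fin N) (Fin N) ℝ) :=
    NormedSpace.exp_continuous
  exact h.comp (by fun_prop)

/-- The covariance `C(τ) = ∫_0^τ e^{σB} Q e^{σB^⋆} dσ`. -/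
noncomputable def totalCov (Q B : Matrix (Fin N) (Fin N) ℝ) (τ : ℝ) : Matrix (Fin N) (Fin N) ℝ :=
  Matrix.of fun i j =>
    ∫ σ in (0 : ℝ)..τ, (NormedSpace.exp (σ • B) * Q * NormedSpace.exp (σ • Bᵀ)) i j

theorem covMatrix_eq (Q B : Matrix (Fin N) (Fin N) ℝ) (τ : ℝ) :
    covMatrix Q B τ = τ⁻¹ • totalCov Q B τ := rfl

theorem smul_covMatrix (Q B : Matrix (Fin N) (Fin N) ℝ) {τ : ℝ} (hτ : τ ≠ 0) :
    τ • covMatrix Q B τ = totalCov Q B τ := by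
  rw [covMatrix_eq, smul_smul, mul_inv_cancel₀ hτ, one_smul]

/-- Bridge between the coordinate-free form, which carries the estimates, and the entrywise integral
in the kernel. -/
theorem covForm_matCLM (Q B : Matrix (Fin N) (Fin N) ℝ) (τ : ℝ) (ξ : Sp N) :
    covForm (matCLM Q) (matCLM B) τ ξ = inner ℝ ξ (matCLM (totalCov Q B τ) ξ) := by
  have hcont : ∀ i j, Continuous fun σ : ℝ =>
      (NormedSpace.exp (σ • B) * Q * NormedSpace.exp (σ • Bᵀ)) i j := fun i j =>
    (((continuous_exp_smul B).matrix_mul continuous_const).matrix_mul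
      (continuous_exp_smul Bᵀ)).matrix_elem i j
  have h1 : ∀ σ, inner ℝ (coflow (matCLM B) σ ξ) (matCLM Q (coflow (matCLM B) σ ξ)) =
      ∑ i, ∑ j, ξ.ofLp i * (NormedSpace.exp (σ • B) * Q * NormedSpace.exp (σ • Bᵀ)) i j *
        ξ.ofLp j := by
    intro σ
    have h2 : inner ℝ (coflow (matCLM B) σ ξ) (matCLM Q (coflow (matCLM B) σ ξ)) =
        inner ℝ ξ (matCLM (NormedSpace.exp (σ • B) * Q * NormedSpace.exp (σ • Bᵀ)) ξ) := by
      rw [inner_coflow, ← matCLM_exp, coflow_matCLM, inner_eq_dotProduct, inner_eq_dotProduct]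
      simp only [ofLp_matCLM, Matrix.mulVec_mulVec, Matrix.mul_assoc]
    rw [h2, inner_matCLM]
    simp only [dotProduct, Matrix.mulVec, Finset.mul_sum, mul_assoc]
  rw [covForm, inner_matCLM]
  simp only [h1]
  rw [intervalIntegral.integral_finsetSum fun i _ => by
    refine Continuous.intervalIntegrable ?_ _ _
    refine continuous_finsetSum _ fun j _ => ?_
    exact (continuous_const.mul (hcont i j)).mul continuous_const]
  simp only [dotProduct, Matrix.mulVec, Finset.mul_sum]
  refine Finset.sum_congr rfl fun i _ => ?_
  rw [intervalIntegral.integral_finsetSum fun j _ => by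
    refine Continuous.intervalIntegrable ?_ _ _
    exact (continuous_const.mul (hcont i j)).mul continuous_const]
  refine Finset.sum_congr rfl fun j _ => ?_
  rw [intervalIntegral.integral_mul_const, intervalIntegral.integral_const_mul, totalCov,
    Matrix.of_apply]
  ring

/-- The Gaussian probability density `π^{-n/2} e^{-|x|²}`. -/
noncomputable def gauss {E : Type*} [NormedAddCommGroup E] [InnerProductSpace ℝ E] (x : E) : ℝ :=
  Real.pi ^ (-(Module.finrank ℝ E : ℝ) / 2) * Real.exp (-‖x‖ ^ 2)

open scoped MatrixOrder Matrix.Norms.L2Operator in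
theorem exists_symm_sq_eq {C : Matrix (Fin N) (Fin N) ℝ} (hC : C.PosSemidef) :
    ∃ S : Matrix (Fin N) (Fin N) ℝ, Sᵀ = S ∧ S * S = C := by
  refine ⟨CFC.sqrt C, ?_, CFC.sqrt_mul_sqrt_self _ hC.nonneg⟩
  have := (CFC.sqrt_nonneg C).isSelfAdjoint
  rw [IsSelfAdjoint, Matrix.star_eq_conjTranspose,
    Matrix.conjTranspose_eq_transpose_of_trivial] at this
  exact this

open scoped Classical in
/-- A symmetric square root of a positive matrix. -/
noncomputable def sqrtMatrix (C : Matrix (Fin N) (Fin N) ℝ) : Matrix (Fin N) (Fin N) ℝ :=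
  if h : C.PosSemidef then (exists_symm_sq_eq h).choose else 0

theorem sqrtMatrix_spec {C : Matrix (Fin N) (Fin N) ℝ} (hC : C.PosSemidef) :
    (sqrtMatrix C)ᵀ = sqrtMatrix C ∧ sqrtMatrix C * sqrtMatrix C = C := by
  rw [sqrtMatrix, dif_pos hC]
  exact (exists_symm_sq_eq hC).choose_spec

/-- Write `C(τ) = S²`. The substitution `Y = e^{τB}X + 2SV` turns the exponent `⟨C⁻¹v, v⟩/4` into
`|V|²`, and its Jacobian `2^N |det S|` cancels `det C^{-1/2}` and reduces `(4π)^{-N/2}` to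
`π^{-N/2}`. -/
theorem kernel_eq_gauss (Q B : Matrix (Fin N) (Fin N) ℝ) {τ : ℝ} (hτ : 0 < τ)
    {S : Matrix (Fin N) (Fin N) ℝ} (hS : Sᵀ = S) (hSS : S * S = totalCov Q B τ)
    (hdet : S.det ≠ 0) (X V : Sp N) :
    |(matCLM ((2 : ℝ) • S)).det| *
      kernel Q B X (flow (matCLM B) τ X + matCLM ((2 : ℝ) • S) V) τ = gauss V := by
  have hu : IsUnit S.det := isUnit_iff_ne_zero.2 hdet
  have hv : (flow (matCLM B) τ X + matCLM ((2 : ℝ) • S) V).ofLp -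
      NormedSpace.exp (τ • B) *ᵥ X.ofLp = (2 : ℝ) • S *ᵥ V.ofLp := by
    rw [← matCLM_exp, WithLp.ofLp_add, ofLp_matCLM, ofLp_matCLM, add_sub_cancel_left,
      Matrix.smul_mulVec]
  have hK : covMatrix Q B τ = τ⁻¹ • (S * S) := by rw [covMatrix_eq, hSS]
  have hinv : (covMatrix Q B τ)⁻¹ = τ • (S⁻¹ * S⁻¹) := by
    refine Matrix.inv_eq_right_inv ?_
    rw [hK, Matrix.smul_mul, Matrix.mul_smul, smul_smul, inv_mul_cancel₀ hτ.ne', one_smul,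
      Matrix.mul_assoc, ← Matrix.mul_assoc S S⁻¹, Matrix.mul_nonsing_inv _ hu, Matrix.one_mul,
      Matrix.mul_nonsing_inv _ hu]
  have hquad : ((covMatrix Q B τ)⁻¹ *ᵥ ((2 : ℝ) • S *ᵥ V.ofLp)) ⬝ᵥ ((2 : ℝ) • S *ᵥ V.ofLp) =
      4 * τ * ‖V‖ ^ 2 := by
    rw [hinv, Matrix.mulVec_smul, Matrix.smul_mulVec, Matrix.mulVec_mulVec, Matrix.mul_assoc,
      Matrix.nonsing_inv_mul _ hu, Matrix.mul_one]
    simp only [smul_dotProduct, dotProduct_smul, smul_eq_mul]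
    rw [Matrix.dotProduct_mulVec, ← Matrix.mulVec_transpose, hS, Matrix.mulVec_mulVec,
      Matrix.mul_nonsing_inv _ hu, Matrix.one_mulVec, ← inner_eq_dotProduct,
      real_inner_self_eq_norm_sq]
    ring
  have hexp : -(4 * τ * ‖V‖ ^ 2) / (4 * τ) = -‖V‖ ^ 2 := by field_simp
  have hd : (τ • covMatrix Q B τ).det = |S.det| ^ 2 := by
    rw [smul_covMatrix _ _ hτ.ne', ← hSS, Matrix.det_mul, sq_abs, sq]
  have hpos : 0 < |S.det| := abs_pos.2 hdet
  have h1 : (|S.det| ^ 2) ^ (-(1 : ℝ) / 2) = |S.det|⁻¹ := by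
    rw [← Real.rpow_natCast, ← Real.rpow_mul hpos.le]
    norm_num [Real.rpow_neg_one]
  have h2 : (4 * Real.pi) ^ (-(N : ℝ) / 2) = (2 ^ N)⁻¹ * Real.pi ^ (-(N : ℝ) / 2) := by
    rw [Real.mul_rpow (by norm_num) Real.pi_pos.le]
    congr 1
    rw [show (4 : ℝ) = 2 ^ (2 : ℝ) by norm_num, ← Real.rpow_mul (by norm_num),
      ← Real.rpow_natCast, ← Real.rpow_neg (by norm_num)]
    congr 1
    ring
  simp only [kernel, hv, hquad, hexp, hd, h1, h2, det_matCLM, gauss, Matrix.det_smul,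
    Fintype.card_fin, finrank_euclideanSpace, abs_mul, abs_pow, abs_two]
  field_simp

variable (Q B : Matrix (Fin N) (Fin N) ℝ)

/-- The linear map `2 C(τ)^{1/2}`, which sends the density `gauss` to that of the transition
probability at time `τ` from the origin. -/
noncomputable def noise (τ : ℝ) : Sp N →L[ℝ] Sp N :=
  matCLM ((2 : ℝ) • sqrtMatrix (totalCov Q B τ))

variable {Q B}

theorem posDef_totalCov (hK : ∀ t : ℝ, 0 < t → (covMatrix Q B t).PosDef) {τ : ℝ} (hτ : 0 < τ) :
    (totalCov Q B τ).PosDef := by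
  rw [← smul_covMatrix Q B hτ.ne']
  exact (hK τ hτ).smul hτ

theorem covForm_pos (hK : ∀ t : ℝ, 0 < t → (covMatrix Q B t).PosDef) {τ : ℝ} (hτ : 0 < τ)
    {ξ : Sp N} (hξ : ξ ≠ 0) : 0 < covForm (matCLM Q) (matCLM B) τ ξ := by
  rw [covForm_matCLM, inner_matCLM]
  have := (posDef_totalCov hK hτ).dotProduct_mulVec_pos (x := ξ.ofLp) (by simpa using hξ)
  simpa using this

/-- Apart from invertibility, this is all that is used of the square root: with `R = 2C^{1/2}`, the
operator norm and the characteristic function of the noise depend only on `R R^⋆ = 4C`. -/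
theorem norm_adjoint_noise_sq (hK : ∀ t : ℝ, 0 < t → (covMatrix Q B t).PosDef) {τ : ℝ}
    (hτ : 0 < τ) (ξ : Sp N) :
    ‖ContinuousLinearMap.adjoint (noise Q B τ) ξ‖ ^ 2 =
      4 * covForm (matCLM Q) (matCLM B) τ ξ := by
  obtain ⟨h1, h2⟩ := sqrtMatrix_spec (posDef_totalCov hK hτ).posSemidef
  rw [noise, covForm_matCLM, inner_matCLM]
  generalize sqrtMatrix (totalCov Q B τ) = S at h1 h2
  rw [← h2, adjoint_matCLM, Matrix.transpose_smul, h1, ← real_inner_self_eq_norm_sq,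
    inner_matCLM, ofLp_matCLM]
  simp only [Matrix.smul_mulVec, smul_dotProduct, dotProduct_smul, smul_eq_mul]
  rw [← Matrix.mulVec_mulVec, Matrix.dotProduct_mulVec (ξ.ofLp), ← Matrix.mulVec_transpose, h1]
  ring

theorem det_noise_ne_zero (hK : ∀ t : ℝ, 0 < t → (covMatrix Q B t).PosDef) {τ : ℝ}
    (hτ : 0 < τ) : (sqrtMatrix (totalCov Q B τ)).det ≠ 0 ∧ (noise Q B τ).det ≠ 0 := by
  obtain ⟨h1, h2⟩ := sqrtMatrix_spec (posDef_totalCov hK hτ).posSemidef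
  have h3 : (sqrtMatrix (totalCov Q B τ)).det ≠ 0 := by
    intro h0
    have h4 := (posDef_totalCov hK hτ).det_pos
    rw [← h2, Matrix.det_mul, h0, zero_mul] at h4
    exact lt_irrefl _ h4
  refine ⟨h3, ?_⟩
  rw [noise, det_matCLM, Matrix.det_smul]
  exact mul_ne_zero (by positivity) h3

variable {G : Type*} [NormedAddCommGroup G] [NormedSpace ℝ G]

theorem abs_det_noise_smul_kernel (hK : ∀ t : ℝ, 0 < t → (covMatrix Q B t).PosDef) {τ : ℝ}
    (hτ : 0 < τ) (X V : Sp N) (f : Sp N → G) :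
    |(noise Q B τ).det| • kernel Q B X (flow (matCLM B) τ X + noise Q B τ V) τ •
      f (flow (matCLM B) τ X + noise Q B τ V) =
    gauss V • f (flow (matCLM B) τ X + noise Q B τ V) := by
  obtain ⟨h1, h2⟩ := sqrtMatrix_spec (posDef_totalCov hK hτ).posSemidef
  rw [smul_smul]
  congr 1
  exact kernel_eq_gauss Q B hτ h1 h2 (det_noise_ne_zero hK hτ).1 X V

theorem integral_kernel_smul (hK : ∀ t : ℝ, 0 < t → (covMatrix Q B t).PosDef) {τ : ℝ}
    (hτ : 0 < τ) (X : Sp N) (f : Sp N → G) :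
    ∫ Y, kernel Q B X Y τ • f Y =
      ∫ V, gauss V • f (flow (matCLM B) τ X + noise Q B τ V) := by
  rw [integral_comp_affine volume (det_noise_ne_zero hK hτ).2 (flow (matCLM B) τ X)]
  simp only [abs_det_noise_smul_kernel hK hτ]

theorem integrable_kernel_smul_iff (hK : ∀ t : ℝ, 0 < t → (covMatrix Q B t).PosDef) {τ : ℝ}
    (hτ : 0 < τ) (X : Sp N) (f : Sp N → G) :
    Integrable (fun Y => kernel Q B X Y τ • f Y) ↔
      Integrable fun V => gauss V • f (flow (matCLM B) τ X + noise Q B τ V) := by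
  rw [integrable_comp_affine_iff volume (det_noise_ne_zero hK hτ).2 (flow (matCLM B) τ X)]
  simp only [abs_det_noise_smul_kernel hK hτ]

end Kernel

/-! ### Moments and characteristic function of the standard Gaussian -/

section Gauss

variable {E : Type*} [NormedAddCommGroup E] [InnerProductSpace ℝ E]

theorem gauss_pos (x : E) : 0 < gauss x := by
  rw [gauss]
  positivity

theorem gauss_neg (x : E) : gauss (-x) = gauss x := by
  rw [gauss, gauss, norm_neg]

theorem continuous_gauss : Continuous (gauss : E → ℝ) := by
  unfold gauss
  fun_prop

variable [FiniteDimensional ℝ E] [MeasurableSpace E] [BorelSpace E]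

theorem integral_gauss : ∫ x : E, gauss x = 1 := by
  have h := GaussianFourier.integral_rexp_neg_mul_sq_norm (V := E) one_pos
  simp only [neg_one_mul, div_one] at h
  simp only [gauss]
  rw [integral_const_mul, h, ← Real.rpow_add Real.pi_pos]
  ring_nf
  simp

/-- A non-integrable function would have integral zero by convention, but the Gaussian integral is
known and positive. -/
theorem integrable_exp_neg_mul_sq {b : ℝ} (hb : 0 < b) :
    Integrable fun x : E => Real.exp (-b * ‖x‖ ^ 2) := by
  by_contra h
  have h1 := GaussianFourier.integral_rexp_neg_mul_sq_norm (V := E) hb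
  rw [integral_undef h] at h1
  have : 0 < (Real.pi / b) ^ ((Module.finrank ℝ E : ℝ) / 2) := by positivity
  linarith

theorem integrable_gauss_mul_pow (k : ℕ) :
    Integrable fun x : E => gauss x * (1 + ‖x‖) ^ k := by
  -- Half of the Gaussian absorbs the polynomial: `(1+r)^k ≤ k! e^{1+r}`, and `1 + r - r² ≤ 3/2 -
  -- r²/2` because `(r-1)² ≥ 0`.
  have h := ((integrable_exp_neg_mul_sq (E := E) (b := 1 / 2) (by norm_num)).const_mul
    (Real.pi ^ (-(Module.finrank ℝ E : ℝ) / 2) * (Nat.factorial k * Real.exp (3 / 2))))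
  refine h.mono' (by
    have := continuous_gauss (E := E)
    exact Continuous.aestronglyMeasurable (by fun_prop)) (Eventually.of_forall fun x => ?_)
  rw [Real.norm_of_nonneg (mul_nonneg (gauss_pos x).le (by positivity)), gauss, mul_assoc,
    mul_assoc]
  refine mul_le_mul_of_nonneg_left ?_ (by positivity)
  have h1 := Real.pow_div_factorial_le_exp (1 + ‖x‖) (by positivity) k
  rw [div_le_iff₀ (by positivity)] at h1
  calc Real.exp (-‖x‖ ^ 2) * (1 + ‖x‖) ^ k
      ≤ Real.exp (-‖x‖ ^ 2) * (Real.exp (1 + ‖x‖) * Nat.factorial k) := by gcongr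
    _ = Nat.factorial k * Real.exp (-‖x‖ ^ 2 + (1 + ‖x‖)) := by rw [Real.exp_add (-‖x‖ ^ 2)]; ring
    _ ≤ Nat.factorial k * Real.exp (3 / 2 + -(1 / 2) * ‖x‖ ^ 2) := by
      refine mul_le_mul_of_nonneg_left (Real.exp_le_exp.2 ?_) (by positivity)
      nlinarith [sq_nonneg (‖x‖ - 1)]
    _ = _ := by rw [Real.exp_add]; ring

theorem integrable_gauss : Integrable (gauss : E → ℝ) := by
  simpa using integrable_gauss_mul_pow (E := E) 0

variable {G : Type*} [NormedAddCommGroup G] [NormedSpace ℝ G]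

theorem integrable_gauss_smul {f : E → G} (hf : Continuous f) {C : ℝ} (hC : ∀ x, ‖f x‖ ≤ C) :
    Integrable fun x : E => gauss x • f x := by
  refine (integrable_gauss.mul_const C).mono'
    (continuous_gauss.smul hf).aestronglyMeasurable (Eventually.of_forall fun x => ?_)
  rw [norm_smul, Real.norm_of_nonneg (gauss_pos x).le]
  exact mul_le_mul_of_nonneg_left (hC x) (gauss_pos x).le

theorem norm_integral_gauss_smul_le {f : E → G} {C : ℝ} (hC : ∀ x, ‖f x‖ ≤ C) :
    ‖∫ x : E, gauss x • f x‖ ≤ C := by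
  refine (norm_integral_le_of_norm_le (integrable_gauss.mul_const C)
    (Eventually.of_forall fun x => ?_)).trans_eq ?_
  · rw [norm_smul, Real.norm_of_nonneg (gauss_pos x).le]
    exact mul_le_mul_of_nonneg_left (hC x) (gauss_pos x).le
  · rw [integral_mul_const, integral_gauss, one_mul]

theorem integrable_gauss_smul_clm (A : E →L[ℝ] G) : Integrable fun x : E => gauss x • A x := by
  refine ((integrable_gauss_mul_pow 1).const_mul ‖A‖).mono'
    (continuous_gauss.smul A.continuous).aestronglyMeasurable (Eventually.of_forall fun x => ?_)
  rw [norm_smul, Real.norm_of_nonneg (gauss_pos x).le]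
  have h1 := A.le_opNorm x
  have h2 := (gauss_pos x).le
  calc gauss x * ‖A x‖ ≤ gauss x * (‖A‖ * (1 + ‖x‖)) := by
        gcongr
        exact h1.trans (by gcongr; linarith)
    _ = _ := by ring

/-- An odd function against an even density. This cancellation turns the small-time error from
`O(√τ)` into `O(τ)`. -/
theorem integral_gauss_smul_clm (A : E →L[ℝ] G) : ∫ x : E, gauss x • A x = 0 := by
  have h := integral_neg_eq_self (fun x : E => gauss x • A x) volume
  simp only [gauss_neg, map_neg, smul_neg, integral_neg] at h
  have h2 : (2 : ℝ) • ∫ x : E, gauss x • A x = 0 := by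
    rw [two_smul]
    nth_rewrite 1 [← h]
    simp
  simpa using h2

theorem integral_gauss_mul_cexp (w : E) :
    ∫ x : E, (gauss x : ℂ) * Complex.exp (Complex.I * (inner ℝ w x : ℝ)) =
      Complex.exp (-(‖w‖ : ℂ) ^ 2 / 4) := by
  have h := GaussianFourier.integral_cexp_neg_mul_sq_norm_add (V := E) (b := 1) (by simp)
    Complex.I w
  have h1 : ∀ x : E, (gauss x : ℂ) * Complex.exp (Complex.I * (inner ℝ w x : ℝ)) =
      ((Real.pi ^ (-(Module.finrank ℝ E : ℝ) / 2) : ℝ) : ℂ) *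
        Complex.exp (-1 * (‖x‖ : ℂ) ^ 2 + Complex.I * (inner ℝ w x : ℝ)) := by
    intro x
    rw [gauss, Complex.exp_add]
    push_cast
    ring_nf
  simp only [h1]
  rw [integral_const_mul, h, div_one, ← mul_assoc]
  have h2 : ((Real.pi ^ (-(Module.finrank ℝ E : ℝ) / 2) : ℝ) : ℂ) *
      (Real.pi : ℂ) ^ ((Module.finrank ℝ E : ℂ) / 2) = 1 := by
    rw [Complex.ofReal_cpow Real.pi_pos.le, ← Complex.cpow_add _ _ (by
      simp)]
    push_cast
    ring_nf
    simp
  rw [h2, one_mul, Complex.I_sq]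
  ring_nf

end Gauss

/-! ### Small-time estimate for Gaussian averages of Schwartz functions -/

section SmallTime

variable {E : Type*} [NormedAddCommGroup E] [InnerProductSpace ℝ E] [FiniteDimensional ℝ E]
  {G : Type*} [NormedAddCommGroup G] [NormedSpace ℝ G]

theorem schwartz_decay {D : Type*} [NormedAddCommGroup D] [NormedSpace ℝ D] (f : 𝓢(D, G))
    (m : ℕ) : ∃ C : ℝ, 0 ≤ C ∧ ∀ x, ‖f x‖ * (1 + ‖x‖) ^ m ≤ C := by
  refine ⟨2 ^ m * ((Finset.Iic (m, 0)).sup fun m => SchwartzMap.seminorm ℝ m.1 m.2) f,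
    by positivity, fun x => ?_⟩
  have := SchwartzMap.one_add_le_sup_seminorm_apply (𝕜 := ℝ) (m := (m, 0)) le_rfl le_rfl f x
  simpa only [norm_iteratedFDeriv_zero, mul_comm] using this

/-- A Peetre inequality: polynomial weights at the starting point and at the displaced point are
comparable up to a factor `1 + ‖V‖`, which the Gaussian absorbs. It rests on bounded invertibility
of the flow for `τ ≤ 1`; the parameter `θ` covers the segment in Taylor's formula. -/
theorem flow_peetre (b : E →L[ℝ] E) (A : ℝ) (hA : 0 ≤ A) : ∃ K : ℝ, 1 ≤ K ∧
    ∀ τ ∈ Icc (0 : ℝ) 1, ∀ (R : E →L[ℝ] E), ‖R‖ ≤ A → ∀ (X V : E) (t : ℝ), ∀ θ ∈ Icc (0 : ℝ) 1,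
      1 + ‖(X, t)‖ ≤ K * (1 + ‖(flow b τ X + θ • R V, t - τ)‖) * (1 + ‖V‖) := by
  obtain ⟨M, hM1, hM⟩ := exists_flow_bound b
  refine ⟨2 + M + M * A, by nlinarith, fun τ hτ R hR X V t θ hθ => ?_⟩
  set y := (flow b τ X + θ • R V, t - τ) with hy
  have h1 : ‖flow b τ X + θ • R V‖ ≤ ‖y‖ := norm_fst_le y
  have h2 : ‖t - τ‖ ≤ ‖y‖ := norm_snd_le y
  have hRV : ‖θ • R V‖ ≤ A * ‖V‖ := by
    rw [norm_smul, Real.norm_of_nonneg hθ.1]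
    calc θ * ‖R V‖ ≤ 1 * (A * ‖V‖) := by
          gcongr
          · exact hθ.2
          · exact (R.le_opNorm V).trans (by gcongr)
      _ = _ := one_mul _
  have hX : ‖X‖ ≤ M * (‖y‖ + A * ‖V‖) := by
    have h3 : X = flow b (-τ) (flow b τ X) := (flow_neg_flow b τ X).symm
    have h4 : ‖flow b τ X‖ ≤ ‖y‖ + A * ‖V‖ := by
      calc ‖flow b τ X‖ = ‖(flow b τ X + θ • R V) - θ • R V‖ := by rw [add_sub_cancel_right]
        _ ≤ ‖flow b τ X + θ • R V‖ + ‖θ • R V‖ := norm_sub_le _ _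
        _ ≤ _ := by gcongr
    rw [h3]
    refine ((flow b (-τ)).le_opNorm _).trans ?_
    have := (hM (-τ) ⟨by linarith [hτ.2], by linarith [hτ.1]⟩).1
    gcongr
  have ht : ‖t‖ ≤ ‖y‖ + 1 := by
    calc ‖t‖ = ‖(t - τ) + τ‖ := by rw [sub_add_cancel]
      _ ≤ ‖t - τ‖ + ‖τ‖ := norm_add_le _ _
      _ ≤ _ := by
        gcongr
        rw [Real.norm_of_nonneg hτ.1]; exact hτ.2
  have hP : ‖(X, t)‖ ≤ M * (‖y‖ + A * ‖V‖) + (‖y‖ + 1) := by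
    have := norm_nonneg X
    have := norm_nonneg t
    rw [Prod.norm_mk]
    exact max_le (by linarith) (by linarith)
  have hy0 := norm_nonneg y
  have hV0 := norm_nonneg V
  have e1 : 0 ≤ ‖y‖ * ‖V‖ := by positivity
  have e2 : 0 ≤ M * A := by positivity
  have e3 : 0 ≤ M * (‖y‖ * ‖V‖) := by positivity
  have e4 : 0 ≤ M * A * (‖y‖ * ‖V‖) := by positivity
  have e5 : 0 ≤ M * A * ‖y‖ := by positivity
  have e6 : 0 ≤ M * ‖V‖ := by positivity
  nlinarith

/-- The mean value inequality, applied first to the derivative and then to the function. The sharp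
factor `1/2` is lost and not needed. -/
theorem norm_taylor_two_le {D : Type*} [NormedAddCommGroup D] [NormedSpace ℝ D] (u : 𝓢(D, G))
    (x w : D) {c : ℝ} (hc : ∀ θ ∈ Icc (0 : ℝ) 1,
      ‖SchwartzMap.fderivCLM ℝ D (D →L[ℝ] G) (SchwartzMap.fderivCLM ℝ D G u) (x + θ • w)‖ ≤ c) :
    ‖u (x + w) - u x - SchwartzMap.fderivCLM ℝ D G u x w‖ ≤ c * ‖w‖ ^ 2 := by
  set u' := SchwartzMap.fderivCLM ℝ D G u with hu'
  set u'' := SchwartzMap.fderivCLM ℝ D (D →L[ℝ] G) u' with hu''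
  have hc0 : 0 ≤ c := (norm_nonneg _).trans (hc 0 (by simp))
  have hx : x ∈ segment ℝ x (x + w) := left_mem_segment _ _ _
  have hxw : x + w ∈ segment ℝ x (x + w) := right_mem_segment _ _ _
  have hmem : ∀ y ∈ segment ℝ x (x + w), ∃ θ ∈ Icc (0 : ℝ) 1, y = x + θ • w := by
    intro y hy
    rw [segment_eq_image'] at hy
    obtain ⟨θ, hθ, rfl⟩ := hy
    exact ⟨θ, hθ, by simp⟩
  have h1 : ∀ y, HasFDerivAt u (u' y) y := fun y => u.differentiableAt.hasFDerivAt
  have h2 : ∀ y, HasFDerivAt u' (u'' y) y := fun y => u'.differentiableAt.hasFDerivAt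
  have h3 : ∀ y ∈ segment ℝ x (x + w), ‖u' y - u' x‖ ≤ c * ‖w‖ := by
    intro y hy
    refine ((convex_segment x (x + w)).norm_image_sub_le_of_norm_hasFDerivWithin_le
      (fun z _ => (h2 z).hasFDerivWithinAt) (C := c) (fun z hz => ?_) hx hy).trans ?_
    · obtain ⟨θ, hθ, rfl⟩ := hmem z hz
      exact hc θ hθ
    · obtain ⟨θ, hθ, rfl⟩ := hmem y hy
      gcongr
      rw [add_sub_cancel_left, norm_smul, Real.norm_of_nonneg hθ.1]
      exact mul_le_of_le_one_left (norm_nonneg _) hθ.2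
  have h4 := (convex_segment x (x + w)).norm_image_sub_le_of_norm_hasFDerivWithin_le'
    (fun z _ => (h1 z).hasFDerivWithinAt) h3 hx hxw
  rw [add_sub_cancel_left] at h4
  calc _ ≤ _ := h4
    _ = _ := by ring

/-- Mean value inequality along the characteristic `σ ↦ (e^{σb}X, t-σ)`. Its velocity grows linearly
in `X`, hence the decay of order `m + 1` asked of the derivative of `u`. -/
theorem norm_drift_sub_le (b : E →L[ℝ] E) (u : 𝓢(E × ℝ, G)) (m : ℕ) :
    ∃ C : ℝ, 0 ≤ C ∧ ∀ τ ∈ Icc (0 : ℝ) 1, ∀ (X : E) (t : ℝ),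
      ‖u (flow b τ X, t - τ) - u (X, t)‖ * (1 + ‖(X, t)‖) ^ m ≤ C * τ := by
  obtain ⟨M, hM1, hM⟩ := exists_flow_bound b
  obtain ⟨K, hK1, hK⟩ := flow_peetre b 0 le_rfl
  obtain ⟨C, hC0, hC⟩ := schwartz_decay (SchwartzMap.fderivCLM ℝ (E × ℝ) G u) (m + 1)
  refine ⟨C * K ^ (m + 1) * (M * ‖b‖ + 1), by positivity, fun τ hτ X t => ?_⟩
  set P : ℝ := 1 + ‖(X, t)‖ with hP
  have hP1 : 1 ≤ P := by linarith [norm_nonneg (X, t)]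
  have hP0 : 0 < P := by linarith
  have hder : ∀ σ : ℝ, HasDerivAt (fun σ => u (flow b σ X, t - σ))
      (SchwartzMap.fderivCLM ℝ (E × ℝ) G u (flow b σ X, t - σ) (flow b σ (b X), -1)) σ := by
    intro σ
    have h1 : HasDerivAt (fun σ : ℝ => (flow b σ X, t - σ)) (flow b σ (b X), -1) σ :=
      (hasDerivAt_flow_apply b σ X).prodMk (by simpa using (hasDerivAt_id σ).const_sub t)
    exact HasFDerivAt.comp_hasDerivAt σ u.differentiableAt.hasFDerivAt h1
  have hbound : ∀ σ ∈ Ico (0 : ℝ) τ,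
      ‖SchwartzMap.fderivCLM ℝ (E × ℝ) G u (flow b σ X, t - σ) (flow b σ (b X), -1)‖ ≤
        C * K ^ (m + 1) * (M * ‖b‖ + 1) / P ^ m := by
    intro σ hσ
    have hσ1 : σ ∈ Icc (0 : ℝ) 1 := ⟨hσ.1, hσ.2.le.trans hτ.2⟩
    set y := (flow b σ X, t - σ) with hy
    have h1 : P ≤ K * (1 + ‖y‖) := by
      have := hK σ hσ1 0 (by simp) X 0 t 0 (by simp)
      simpa only [zero_smul, add_zero, norm_zero, mul_one] using this
    have h2 : ‖((flow b σ (b X), -1) : E × ℝ)‖ ≤ (M * ‖b‖ + 1) * P := by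
      have h3 : ‖flow b σ (b X)‖ ≤ M * (‖b‖ * ‖X‖) := by
        refine ((flow b σ).le_opNorm _).trans ?_
        have := (hM σ ⟨by linarith [hσ.1], hσ1.2⟩).1
        gcongr
        exact b.le_opNorm X
      have h4 : ‖X‖ ≤ P := by
        have := norm_fst_le (X, t)
        simp only at this
        linarith
      have h5 : M * (‖b‖ * ‖X‖) ≤ M * (‖b‖ * P) := by gcongr
      have h6 : 0 ≤ M * (‖b‖ * P) := by positivity
      rw [Prod.norm_mk]
      refine max_le ?_ ?_
      · nlinarith
      · simp only [norm_neg, norm_one]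
        nlinarith
    have h3 := hC y
    have h4 : ‖SchwartzMap.fderivCLM ℝ (E × ℝ) G u y‖ * P ^ (m + 1) ≤ C * K ^ (m + 1) := by
      calc ‖SchwartzMap.fderivCLM ℝ (E × ℝ) G u y‖ * P ^ (m + 1)
          ≤ ‖SchwartzMap.fderivCLM ℝ (E × ℝ) G u y‖ * (K * (1 + ‖y‖)) ^ (m + 1) := by gcongr
        _ = (‖SchwartzMap.fderivCLM ℝ (E × ℝ) G u y‖ * (1 + ‖y‖) ^ (m + 1)) * K ^ (m + 1) := by
          rw [mul_pow]; ring
        _ ≤ _ := by gcongr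
    rw [le_div_iff₀ (by positivity)]
    calc ‖SchwartzMap.fderivCLM ℝ (E × ℝ) G u y (flow b σ (b X), -1)‖ * P ^ m
        ≤ (‖SchwartzMap.fderivCLM ℝ (E × ℝ) G u y‖ * ((M * ‖b‖ + 1) * P)) * P ^ m := by
          gcongr
          exact (ContinuousLinearMap.le_opNorm _ _).trans (by gcongr)
      _ = (‖SchwartzMap.fderivCLM ℝ (E × ℝ) G u y‖ * P ^ (m + 1)) * (M * ‖b‖ + 1) := by ring
      _ ≤ _ := by gcongr
  have h := norm_image_sub_le_of_norm_deriv_le_segment'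
    (f := fun σ => u (flow b σ X, t - σ)) (fun σ _ => (hder σ).hasDerivWithinAt) hbound τ
    (right_mem_Icc.2 hτ.1)
  simp only [flow_zero, sub_zero, ContinuousLinearMap.id_apply] at h
  calc _ ≤ (C * K ^ (m + 1) * (M * ‖b‖ + 1) / P ^ m * τ) * P ^ m := by gcongr
    _ = _ := by field_simp

variable [MeasurableSpace E] [BorelSpace E]

/-- Generator estimate: for small times a Gaussian average of a Schwartz function, over noise of
variance `O(τ)` around the deterministic flow, differs from the function by `O(τ)`, with rapid
decay in space and time. -/
theorem norm_gauss_average_sub_le [CompleteSpace G] (b : E →L[ℝ] E) (u : 𝓢(E × ℝ, G)) {A : ℝ}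
    (hA : 0 ≤ A) (m : ℕ) :
    ∃ C : ℝ, 0 ≤ C ∧ ∀ τ ∈ Icc (0 : ℝ) 1, ∀ (R : E →L[ℝ] E), ‖R‖ ^ 2 ≤ A * τ → ∀ (X : E) (t : ℝ),
      ‖(∫ V : E, gauss V • u (flow b τ X + R V, t - τ)) - u (X, t)‖ * (1 + ‖(X, t)‖) ^ m
        ≤ C * τ := by
  obtain ⟨C₁, hC₁0, hC₁⟩ := norm_drift_sub_le b u m
  obtain ⟨K, hK1, hK⟩ := flow_peetre b (A + 1) (by linarith)
  obtain ⟨C₂, hC₂0, hC₂⟩ := schwartz_decay (SchwartzMap.fderivCLM ℝ (E × ℝ) (E × ℝ →L[ℝ] G)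
    (SchwartzMap.fderivCLM ℝ (E × ℝ) G u)) m
  obtain ⟨C₀, -, hC₀⟩ := schwartz_decay u 0
  simp only [pow_zero, mul_one] at hC₀
  -- The order of the moment is `m` from the Peetre inequality plus `2` from the squared
  -- displacement.
  set J : ℝ := ∫ V : E, gauss V * (1 + ‖V‖) ^ (m + 2) with hJ
  have hJ0 : 0 ≤ J := integral_nonneg fun V => mul_nonneg (gauss_pos V).le (by positivity)
  refine ⟨C₁ + C₂ * K ^ m * A * J, by positivity, fun τ hτ R hR X t => ?_⟩
  set P : ℝ := 1 + ‖(X, t)‖ with hP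
  have hP0 : 0 < P := by linarith [norm_nonneg (X, t)]
  -- A bound on the noise that does not depend on `τ`: `‖R‖² ≤ A ≤ (A + 1)²`.
  have hRA : ‖R‖ ≤ A + 1 := by
    have h1 : A * τ ≤ A * 1 := by gcongr; exact hτ.2
    nlinarith [norm_nonneg R]
  set y := (flow b τ X, t - τ) with hy
  set u' := SchwartzMap.fderivCLM ℝ (E × ℝ) G u with hu'
  have hpt : ∀ V : E, ‖u (y + (R V, 0)) - u y - u' y (R V, 0)‖ ≤
      C₂ * K ^ m / P ^ m * A * τ * (1 + ‖V‖) ^ (m + 2) := by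
    intro V
    have h1 : ∀ θ ∈ Icc (0 : ℝ) 1, ‖SchwartzMap.fderivCLM ℝ (E × ℝ) (E × ℝ →L[ℝ] G) u'
        (y + θ • ((R V, 0) : E × ℝ))‖ ≤ C₂ * K ^ m / P ^ m * (1 + ‖V‖) ^ m := by
      intro θ hθ
      have hyθ : y + θ • ((R V, 0) : E × ℝ) = (flow b τ X + θ • R V, t - τ) := by
        simp [hy]
      have h2 := hK τ hτ R hRA X V t θ hθ
      have h3 := hC₂ (y + θ • ((R V, 0) : E × ℝ))
      rw [← hyθ] at h2
      generalize y + θ • ((R V, 0) : E × ℝ) = w at h2 h3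
      rw [div_mul_eq_mul_div, le_div_iff₀ (by positivity)]
      calc _ ≤ ‖SchwartzMap.fderivCLM ℝ (E × ℝ) (E × ℝ →L[ℝ] G) u' w‖ *
              (K * (1 + ‖w‖) * (1 + ‖V‖)) ^ m := by gcongr
        _ = (‖SchwartzMap.fderivCLM ℝ (E × ℝ) (E × ℝ →L[ℝ] G) u' w‖ * (1 + ‖w‖) ^ m) *
              K ^ m * (1 + ‖V‖) ^ m := by rw [mul_pow, mul_pow]; ring
        _ ≤ _ := by gcongr
    refine (norm_taylor_two_le u y (R V, 0) h1).trans ?_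
    have h2 : ‖((R V, 0) : E × ℝ)‖ ^ 2 ≤ A * τ * (1 + ‖V‖) ^ 2 := by
      have h3 : ‖((R V, 0) : E × ℝ)‖ = ‖R V‖ := by simp [Prod.norm_mk]
      rw [h3]
      calc ‖R V‖ ^ 2 ≤ (‖R‖ * ‖V‖) ^ 2 := by gcongr; exact R.le_opNorm V
        _ = ‖R‖ ^ 2 * ‖V‖ ^ 2 := by ring
        _ ≤ A * τ * (1 + ‖V‖) ^ 2 := by
          have := norm_nonneg V
          have := hτ.1
          gcongr
          linarith
    calc _ ≤ C₂ * K ^ m / P ^ m * (1 + ‖V‖) ^ m * (A * τ * (1 + ‖V‖) ^ 2) := by gcongr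
      _ = _ := by ring
  have hc : Continuous fun V : E => u (y + (R V, 0)) := by
    have := u.continuous
    fun_prop
  have hi1 : Integrable fun V : E => gauss V • u (y + (R V, 0)) :=
    integrable_gauss_smul hc fun V => hC₀ _
  have hi2 : Integrable fun V : E => gauss V • u y := integrable_gauss.smul_const _
  let L : E →L[ℝ] G := u' y ∘L (ContinuousLinearMap.inl ℝ E ℝ) ∘L R
  have hi3 : Integrable fun V : E => gauss V • L V := integrable_gauss_smul_clm L
  -- The linear Taylor term averages to zero, so the average minus `u y` is an average of
  -- second-order remainders.
  have hsplit : ∫ V : E, gauss V • (u (y + (R V, 0)) - u y - u' y (R V, 0)) =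
      (∫ V : E, gauss V • u (y + (R V, 0))) - u y := by
    have h1 : ∀ V : E, gauss V • (u (y + (R V, 0)) - u y - u' y (R V, 0)) =
        gauss V • u (y + (R V, 0)) - gauss V • u y - gauss V • L V := by
      intro V
      rw [smul_sub, smul_sub]
      rfl
    simp only [h1]
    have hi12 : Integrable fun V : E => gauss V • u (y + (R V, 0)) - gauss V • u y := hi1.sub hi2
    rw [integral_sub hi12 hi3, integral_sub hi1 hi2, integral_smul_const, integral_gauss,
      one_smul, integral_gauss_smul_clm, sub_zero]
  have hrem : ‖(∫ V : E, gauss V • u (y + (R V, 0))) - u y‖ ≤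
      C₂ * K ^ m / P ^ m * A * τ * J := by
    rw [← hsplit, hJ, ← integral_const_mul]
    refine norm_integral_le_of_norm_le ((integrable_gauss_mul_pow (m + 2)).const_mul _)
      (Eventually.of_forall fun V => ?_)
    rw [norm_smul, Real.norm_of_nonneg (gauss_pos V).le]
    calc _ ≤ gauss V * (C₂ * K ^ m / P ^ m * A * τ * (1 + ‖V‖) ^ (m + 2)) :=
          mul_le_mul_of_nonneg_left (hpt V) (gauss_pos V).le
      _ = _ := by ring
  have hy2 : ∀ V : E, (flow b τ X + R V, t - τ) = y + (R V, 0) := fun V => by simp [hy]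
  simp only [hy2]
  have h1 := hC₁ τ hτ X t
  calc ‖(∫ V : E, gauss V • u (y + (R V, 0))) - u (X, t)‖ * P ^ m
      ≤ (‖(∫ V : E, gauss V • u (y + (R V, 0))) - u y‖ + ‖u y - u (X, t)‖) * P ^ m := by
        gcongr
        exact norm_sub_le_norm_sub_add_norm_sub _ _ _
    _ ≤ (C₂ * K ^ m / P ^ m * A * τ * J) * P ^ m + ‖u y - u (X, t)‖ * P ^ m := by
        rw [add_mul]
        gcongr
    _ = C₂ * K ^ m * A * τ * J + ‖u y - u (X, t)‖ * P ^ m := by field_simp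
    _ ≤ C₂ * K ^ m * A * τ * J + C₁ * τ := by gcongr
    _ = _ := by ring

end SmallTime

/-! ### Joint measurability of the kernel and of the semigroup -/

section Measurability

variable {N : ℕ}

theorem continuous_totalCov (Q B : Matrix (Fin N) (Fin N) ℝ) : Continuous (totalCov Q B) := by
  refine continuous_matrix fun i j => ?_
  have hcont : Continuous fun σ : ℝ =>
      (NormedSpace.exp (σ • B) * Q * NormedSpace.exp (σ • Bᵀ)) i j :=
    (((continuous_exp_smul B).matrix_mul continuous_const).matrix_mul
      (continuous_exp_smul Bᵀ)).matrix_elem i j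
  exact intervalIntegral.continuous_primitive (fun a b => hcont.intervalIntegrable a b) 0

/-- Cramer's rule: determinant and adjugate are measurable in `τ` also where the matrix is singular.
-/
theorem measurable_inv_covMatrix (Q B : Matrix (Fin N) (Fin N) ℝ) (i j : Fin N) :
    Measurable fun τ => (covMatrix Q B τ)⁻¹ i j := by
  have h1 : Measurable fun τ => (totalCov Q B τ).det :=
    (continuous_totalCov Q B).matrix_det.measurable
  have h2 : Measurable fun τ => (totalCov Q B τ).adjugate i j :=
    ((continuous_totalCov Q B).matrix_adjugate.matrix_elem i j).measurable
  simp only [Matrix.inv_def, covMatrix_eq, Matrix.smul_apply, Ring.inverse_eq_inv',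
    Matrix.adjugate_smul, Matrix.det_smul, smul_eq_mul]
  fun_prop

theorem measurable_kernel (Q B : Matrix (Fin N) (Fin N) ℝ) :
    Measurable fun q : (Sp N × Sp N) × ℝ => kernel Q B q.1.1 q.1.2 q.2 := by
  have hv : ∀ i, Measurable fun q : (Sp N × Sp N) × ℝ =>
      (q.1.2.ofLp - NormedSpace.exp (q.2 • B) *ᵥ q.1.1.ofLp) i := by
    intro i
    refine Continuous.measurable ?_
    have h1 : Continuous fun q : (Sp N × Sp N) × ℝ => NormedSpace.exp (q.2 • B) *ᵥ q.1.1.ofLp :=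
      ((continuous_exp_smul B).comp continuous_snd).matrix_mulVec (by fun_prop)
    fun_prop
  have hd : Measurable fun q : (Sp N × Sp N) × ℝ => (q.2 • covMatrix Q B q.2).det := by
    have h1 : Measurable fun τ => (totalCov Q B τ).det :=
      (continuous_totalCov Q B).matrix_det.measurable
    simp only [covMatrix_eq, Matrix.det_smul]
    have := h1.comp (measurable_snd : Measurable fun q : (Sp N × Sp N) × ℝ => q.2)
    simp only [Function.comp_def] at this
    fun_prop
  have hq : Measurable fun q : (Sp N × Sp N) × ℝ =>
      ((covMatrix Q B q.2)⁻¹ *ᵥ (q.1.2.ofLp - NormedSpace.exp (q.2 • B) *ᵥ q.1.1.ofLp)) ⬝ᵥ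
        (q.1.2.ofLp - NormedSpace.exp (q.2 • B) *ᵥ q.1.1.ofLp) := by
    simp only [dotProduct, Matrix.mulVec.eq_1 (covMatrix Q B _)⁻¹]
    refine Finset.measurable_fun_sum _ fun i _ => ?_
    refine Measurable.mul ?_ (hv i)
    refine Finset.measurable_fun_sum _ fun j _ => ?_
    exact ((measurable_inv_covMatrix Q B i j).comp measurable_snd).mul (hv j)
  unfold kernel
  simp only
  refine Measurable.mul (measurable_const.mul (hd.pow_const _)) ?_
  fun_prop

variable {𝕜 : Type*} [RCLike 𝕜]

/-- Measurability in `τ` is read off the kernel, since the chosen square root in `noise` comes with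
no regularity in `τ`. -/
theorem measurable_evolSemigroup (Q B : Matrix (Fin N) (Fin N) ℝ) {u : Sp N × ℝ → 𝕜}
    (hu : Continuous u) :
    StronglyMeasurable fun q : (Sp N × ℝ) × ℝ => evolSemigroup Q B q.2 u q.1 := by
  unfold evolSemigroup
  refine StronglyMeasurable.integral_prod_right'
    (f := fun r : ((Sp N × ℝ) × ℝ) × Sp N =>
      kernel Q B r.1.1.1 r.2 r.1.2 • u (r.2, r.1.1.2 - r.1.2)) ?_
  have h1 : Measurable fun r : ((Sp N × ℝ) × ℝ) × Sp N => kernel Q B r.1.1.1 r.2 r.1.2 :=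
    (measurable_kernel Q B).comp (f := fun r : ((Sp N × ℝ) × ℝ) × Sp N =>
      ((r.1.1.1, r.2), r.1.2)) (by fun_prop)
  have h2 : Continuous fun r : ((Sp N × ℝ) × ℝ) × Sp N => u (r.2, r.1.1.2 - r.1.2) := by
    fun_prop
  exact h1.stronglyMeasurable.smul h2.stronglyMeasurable

end Measurability

/-! ### Contraction of the semigroup and its deviation from the identity -/

section Evol

instance isAddHaarMeasure_spaceTime (N : ℕ) : (volume : Measure (Sp N × ℝ)).IsAddHaarMeasure :=
  Measure.prod.instIsAddHaarMeasure volume volume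

variable {N : ℕ} {𝕜 : Type*} [RCLike 𝕜] {Q B : Matrix (Fin N) (Fin N) ℝ}

theorem kernel_nonneg (hK : ∀ t : ℝ, 0 < t → (covMatrix Q B t).PosDef) {τ : ℝ} (hτ : 0 < τ)
    (X Y : Sp N) : 0 ≤ kernel Q B X Y τ := by
  have h : 0 < (τ • covMatrix Q B τ).det := ((hK τ hτ).smul hτ).det_pos
  unfold kernel
  positivity

theorem evolSemigroup_eq (hK : ∀ t : ℝ, 0 < t → (covMatrix Q B t).PosDef) {τ : ℝ} (hτ : 0 < τ)
    (u : Sp N × ℝ → 𝕜) (X : Sp N) (t : ℝ) :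
    evolSemigroup Q B τ u (X, t) =
      ∫ V, gauss V • u (flow (matCLM B) τ X + noise Q B τ V, t - τ) :=
  integral_kernel_smul hK hτ X fun Y => u (Y, t - τ)

theorem exists_norm_noise_sq_le (hK : ∀ t : ℝ, 0 < t → (covMatrix Q B t).PosDef) :
    ∃ A : ℝ, 0 ≤ A ∧ ∀ τ, 0 < τ → τ ≤ 1 → ‖noise Q B τ‖ ^ 2 ≤ A * τ := by
  obtain ⟨M, hM0, hM⟩ := exists_covForm_le (matCLM Q) (matCLM B)
  refine ⟨4 * M, by positivity, fun τ h0 h1 => ?_⟩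
  have h2 : ‖ContinuousLinearMap.adjoint (noise Q B τ)‖ ≤ √(4 * M * τ) := by
    refine ContinuousLinearMap.opNorm_le_bound _ (Real.sqrt_nonneg _) fun ξ => ?_
    refine le_of_sq_le_sq ?_ (by positivity)
    rw [norm_adjoint_noise_sq hK h0, mul_pow, Real.sq_sqrt (by positivity)]
    have := hM τ ⟨h0.le, h1⟩ ξ
    linarith
  rw [LinearIsometryEquiv.norm_map] at h2
  calc ‖noise Q B τ‖ ^ 2 ≤ √(4 * M * τ) ^ 2 := by gcongr
    _ = _ := Real.sq_sqrt (by positivity)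

theorem schwartz_bounded (u : 𝓢(Sp N × ℝ, 𝕜)) : ∃ C : ℝ, 0 ≤ C ∧ ∀ P, ‖u P‖ ≤ C := by
  simpa using schwartz_decay u 0

theorem norm_evolSemigroup_le (hK : ∀ t : ℝ, 0 < t → (covMatrix Q B t).PosDef) {τ : ℝ}
    (hτ : 0 < τ) {u : Sp N × ℝ → 𝕜} {C : ℝ} (hC : ∀ P, ‖u P‖ ≤ C) (P : Sp N × ℝ) :
    ‖evolSemigroup Q B τ u P‖ ≤ C := by
  obtain ⟨X, t⟩ := P
  rw [evolSemigroup_eq hK hτ]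
  exact norm_integral_gauss_smul_le fun _ => hC _

/-- For each value of the noise, `(X,t) ↦ (e^{τB}X + RV, t-τ)` does not shrink volume; Tonelli then
averages over `V` with total mass one. -/
theorem lintegral_evolSemigroup_le (hK : ∀ t : ℝ, 0 < t → (covMatrix Q B t).PosDef)
    (hB : 0 ≤ B.trace) {τ : ℝ} (hτ : 0 < τ) {u : Sp N × ℝ → 𝕜} (hu : Continuous u) :
    ∫⁻ P, ‖evolSemigroup Q B τ u P‖ₑ ≤ ∫⁻ P, ‖u P‖ₑ := by
  have hdet : 1 ≤ (flow (matCLM B) τ).det :=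
    one_le_det_flow (by rw [trace_matCLM]; exact hB) hτ.le
  set T := flow (matCLM B) τ
  set R := noise Q B τ
  have hg : ∀ V : Sp N, ‖gauss V‖ₑ = ENNReal.ofReal (gauss V) := fun V =>
    Real.enorm_of_nonneg (gauss_pos V).le
  have hgc := continuous_gauss (E := Sp N)
  have hmeas : Measurable fun q : (Sp N × ℝ) × Sp N =>
      ‖gauss q.2‖ₑ * ‖u (T q.1.1 + R q.2, q.1.2 - τ)‖ₑ := by
    have h1 : Continuous fun q : (Sp N × ℝ) × Sp N => u (T q.1.1 + R q.2, q.1.2 - τ) := by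
      fun_prop
    exact (hgc.comp continuous_snd).measurable.enorm.mul h1.measurable.enorm
  have hinner : ∀ V : Sp N, ∫⁻ P : Sp N × ℝ, ‖u (T P.1 + R V, P.2 - τ)‖ₑ ≤ ∫⁻ P, ‖u P‖ₑ := by
    intro V
    have h1 : Continuous fun P : Sp N × ℝ => u (T P.1 + R V, P.2 - τ) := by fun_prop
    rw [Measure.volume_eq_prod, lintegral_prod_symm _ h1.measurable.enorm.aemeasurable,
      lintegral_prod_symm _ hu.measurable.enorm.aemeasurable]
    rw [← lintegral_sub_right_eq_self (fun t => ∫⁻ X, ‖u (X, t)‖ₑ) τ]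
    refine lintegral_mono fun t => ?_
    have := lintegral_comp_affine_le volume hdet (R V) fun X => ‖u (X, t - τ)‖ₑ
    simpa only [add_comm] using this
  calc ∫⁻ P, ‖evolSemigroup Q B τ u P‖ₑ
      ≤ ∫⁻ P : Sp N × ℝ, ∫⁻ V : Sp N, ‖gauss V‖ₑ * ‖u (T P.1 + R V, P.2 - τ)‖ₑ := by
        refine lintegral_mono fun P => ?_
        obtain ⟨X, t⟩ := P
        rw [evolSemigroup_eq hK hτ]
        refine (enorm_integral_le_lintegral_enorm _).trans_eq ?_
        simp only [enorm_smul, T, R]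
    _ = ∫⁻ V : Sp N, ∫⁻ P : Sp N × ℝ, ‖gauss V‖ₑ * ‖u (T P.1 + R V, P.2 - τ)‖ₑ :=
        lintegral_lintegral_swap hmeas.aemeasurable
    _ ≤ ∫⁻ V : Sp N, ‖gauss V‖ₑ * ∫⁻ P, ‖u P‖ₑ := by
        refine lintegral_mono fun V => ?_
        rw [lintegral_const_mul' _ _ enorm_ne_top]
        exact mul_le_mul_right (hinner V) _
    _ = ∫⁻ P, ‖u P‖ₑ := by
        rw [lintegral_mul_const _ hgc.measurable.enorm]
        simp only [hg]
        rw [← ofReal_integral_eq_lintegral_ofReal integrable_gauss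
          (Eventually.of_forall fun V => (gauss_pos V).le), integral_gauss]
        simp

/-- The deviation of the semigroup from the identity is at most a multiple of `min 1 τ`, both
uniformly and in `L¹`. -/
theorem exists_evolSemigroup_sub_bound (hK : ∀ t : ℝ, 0 < t → (covMatrix Q B t).PosDef)
    (hB : 0 ≤ B.trace) (u : 𝓢(Sp N × ℝ, 𝕜)) :
    ∃ M : ℝ, 0 ≤ M ∧ ∀ τ, 0 < τ →
      (∀ P, ‖evolSemigroup Q B τ u P - u P‖ ≤ M * min 1 τ) ∧
      ∫⁻ P, ‖evolSemigroup Q B τ u P - u P‖ₑ ≤ ENNReal.ofReal (M * min 1 τ) := by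
  obtain ⟨C₀, hC₀0, hC₀⟩ := schwartz_bounded u
  obtain ⟨A, hA0, hA⟩ := exists_norm_noise_sq_le hK
  -- One power above the dimension of space-time makes `(1 + ‖P‖)^{-m}` integrable.
  set m := Module.finrank ℝ (Sp N × ℝ) + 1 with hm
  obtain ⟨C, hC0, hC⟩ := norm_gauss_average_sub_le (matCLM B) u hA0 m
  have hpt : ∀ τ, 0 < τ → τ ≤ 1 → ∀ P, ‖evolSemigroup Q B τ u P - u P‖ ≤
      C * τ * ((1 + ‖P‖) ^ m)⁻¹ := by
    intro τ h0 h1 P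
    obtain ⟨X, t⟩ := P
    rw [evolSemigroup_eq hK h0, ← div_eq_mul_inv, le_div_iff₀ (by positivity)]
    exact hC τ ⟨h0.le, h1⟩ _ (hA τ h0 h1) X t
  have hint : Integrable fun P : Sp N × ℝ => ((1 + ‖P‖) ^ m)⁻¹ := by
    have := integrable_one_add_norm (E := Sp N × ℝ) (μ := volume) (r := (m : ℝ))
      (by rw [hm]; push_cast; linarith)
    refine this.congr (Eventually.of_forall fun P => ?_)
    simp only
    rw [Real.rpow_neg (by positivity), Real.rpow_natCast]
  set J := ∫ P : Sp N × ℝ, ((1 + ‖P‖) ^ m)⁻¹ with hJ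
  set I := ∫ P, ‖u P‖ with hI
  have hJ0 : 0 ≤ J := integral_nonneg fun P => by positivity
  have hI0 : 0 ≤ I := integral_nonneg fun P => by positivity
  have huint : Integrable u := u.integrable
  -- One summand for each case: `C` and `C J` for the uniform and `L¹` bounds when `τ ≤ 1`, `2 C₀`
  -- and `2 I` for those when `τ ≥ 1`.
  refine ⟨C + 2 * C₀ + C * J + 2 * I, by positivity, fun τ hτ => ?_⟩
  have hCJ : 0 ≤ C * J := by positivity
  rcases le_total τ 1 with h1 | h1
  · rw [min_eq_right h1]
    constructor
    · intro P
      refine (hpt τ hτ h1 P).trans ?_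
      have h2 : ((1 + ‖P‖) ^ m)⁻¹ ≤ 1 := inv_le_one_of_one_le₀ (one_le_pow₀ (by
        linarith [norm_nonneg P]))
      calc C * τ * ((1 + ‖P‖) ^ m)⁻¹ ≤ C * τ * 1 := by gcongr
        _ ≤ _ := by rw [mul_one]; gcongr; linarith
    · calc ∫⁻ P, ‖evolSemigroup Q B τ u P - u P‖ₑ
          ≤ ∫⁻ P : Sp N × ℝ, ENNReal.ofReal (C * τ * ((1 + ‖P‖) ^ m)⁻¹) := by
            refine lintegral_mono fun P => ?_
            rw [← ofReal_norm]
            exact ENNReal.ofReal_le_ofReal (hpt τ hτ h1 P)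
        _ = ENNReal.ofReal (C * τ * J) := by
            rw [← ofReal_integral_eq_lintegral_ofReal (hint.const_mul _)
              (Eventually.of_forall fun P => by positivity), integral_const_mul]
        _ ≤ _ := ENNReal.ofReal_le_ofReal (by nlinarith)
  · rw [min_eq_left h1, mul_one]
    constructor
    · intro P
      calc _ ≤ ‖evolSemigroup Q B τ u P‖ + ‖u P‖ := norm_sub_le _ _
        _ ≤ C₀ + C₀ := add_le_add (norm_evolSemigroup_le hK hτ hC₀ P) (hC₀ P)
        _ ≤ _ := by linarith
    · have h2 : ∫⁻ P, ‖u P‖ₑ = ENNReal.ofReal I := by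
        rw [hI, ofReal_integral_norm_eq_lintegral_enorm huint]
      calc ∫⁻ P, ‖evolSemigroup Q B τ u P - u P‖ₑ
          ≤ ∫⁻ P, (‖evolSemigroup Q B τ u P‖ₑ + ‖u P‖ₑ) :=
            lintegral_mono fun P => enorm_sub_le
        _ = (∫⁻ P, ‖evolSemigroup Q B τ u P‖ₑ) + ∫⁻ P, ‖u P‖ₑ :=
            lintegral_add_right _ u.continuous.measurable.enorm
        _ ≤ ENNReal.ofReal I + ENNReal.ofReal I := by
            rw [← h2]
            exact add_le_add_left (lintegral_evolSemigroup_le hK hB hτ u.continuous) _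
        _ = ENNReal.ofReal (I + I) := (ENNReal.ofReal_add hI0 hI0).symm
        _ ≤ _ := ENNReal.ofReal_le_ofReal (by linarith)

end Evol

/-! ### Weighted superpositions in `L^p` -/

section WeightedIntegrals

/-- Near zero the integrand is `τ^{-s}`, integrable as `s < 1`; at infinity it is `τ^{-1-s}`,
integrable as `s > 0`. -/
theorem integrableOn_rpow_mul_min {s : ℝ} (hs0 : 0 < s) (hs1 : s < 1) :
    IntegrableOn (fun τ : ℝ => τ ^ (-1 - s) * min 1 τ) (Ioi 0) := by
  rw [← Ioc_union_Ioi_eq_Ioi (zero_le_one' ℝ)]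
  refine IntegrableOn.union ?_ ?_
  · have h : IntegrableOn (fun τ : ℝ => τ ^ (-s)) (Ioc 0 1) :=
      (intervalIntegrable_iff_integrableOn_Ioc_of_le zero_le_one).1
        (intervalIntegral.intervalIntegrable_rpow' (by linarith))
    refine h.congr_fun (fun τ hτ => ?_) measurableSet_Ioc
    simp only
    rw [min_eq_right hτ.2, ← Real.rpow_add_one hτ.1.ne']
    ring_nf
  · have h : IntegrableOn (fun τ : ℝ => τ ^ (-1 - s)) (Ioi 1) :=
      integrableOn_Ioi_rpow_of_lt (by linarith) one_pos
    refine h.congr_fun (fun τ hτ => ?_) measurableSet_Ioi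
    simp only
    rw [min_eq_left (le_of_lt hτ), mul_one]

variable {α : Type*} [MeasurableSpace α] {μ : Measure α} {G : Type*}
  [NormedAddCommGroup G]

/-- Interpolation between `L¹` and `L^∞`. -/
theorem eLpNorm_le_of_bound_of_lintegral_le {f : α → G} {c : ℝ≥0∞} (hsup : ∀ x, ‖f x‖ₑ ≤ c)
    (hint : ∫⁻ x, ‖f x‖ₑ ∂μ ≤ c) (hc : c ≠ ⊤) {p : ℝ≥0∞} (hp1 : 1 ≤ p) (hp : p ≠ ⊤) :
    eLpNorm f p μ ≤ c := by
  have hp0 : p ≠ 0 := (one_pos.trans_le hp1).ne'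
  have hr : 1 ≤ p.toReal := by
    rw [← ENNReal.toReal_one]
    exact ENNReal.toReal_mono hp hp1
  rw [eLpNorm_eq_lintegral_rpow_enorm_toReal hp0 hp]
  have h1 : ∫⁻ x, ‖f x‖ₑ ^ p.toReal ∂μ ≤ c ^ p.toReal := by
    have hsplit : ∀ x : ℝ≥0∞, x ^ p.toReal = x ^ (p.toReal - 1) * x := fun x => by
      conv_rhs => rw [← ENNReal.rpow_one x, ← ENNReal.rpow_mul, one_mul]
      rw [← ENNReal.rpow_add_of_nonneg _ _ (by linarith) zero_le_one, sub_add_cancel]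
    calc ∫⁻ x, ‖f x‖ₑ ^ p.toReal ∂μ ≤ ∫⁻ x, c ^ (p.toReal - 1) * ‖f x‖ₑ ∂μ := by
          refine lintegral_mono fun x => ?_
          rw [hsplit]
          exact mul_le_mul_left (ENNReal.rpow_le_rpow (hsup x) (by linarith)) _
      _ = c ^ (p.toReal - 1) * ∫⁻ x, ‖f x‖ₑ ∂μ :=
          lintegral_const_mul' _ _ (ENNReal.rpow_ne_top_of_nonneg (by linarith) hc)
      _ ≤ c ^ (p.toReal - 1) * c := mul_le_mul_right hint _
      _ = _ := (hsplit c).symm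
  calc _ ≤ (c ^ p.toReal) ^ (1 / p.toReal) := ENNReal.rpow_le_rpow h1 (by positivity)
    _ = c := by
      rw [← ENNReal.rpow_mul, mul_one_div_cancel (by linarith), ENNReal.rpow_one]

variable [NormedSpace ℝ G] {h : α × ℝ → G} {M : ℝ} {k : ℝ → ℝ}

theorem integrableOn_weight_smul (hmeas : StronglyMeasurable h)
    (hsup : ∀ τ, 0 < τ → ∀ x, ‖h (x, τ)‖ ≤ M * min 1 τ) (hk : Measurable k)
    (hkint : IntegrableOn (fun τ => k τ * min 1 τ) (Ioi 0)) (x : α) :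
    IntegrableOn (fun τ => k τ • h (x, τ)) (Ioi 0) := by
  refine (hkint.norm.const_mul M).mono' ?_ ?_
  · exact (hk.stronglyMeasurable.smul
      (hmeas.comp_measurable measurable_prodMk_left)).aestronglyMeasurable
  · refine (ae_restrict_iff' measurableSet_Ioi).2 (Eventually.of_forall fun τ hτ => ?_)
    have h0 : 0 ≤ min 1 τ := le_min zero_le_one (le_of_lt hτ)
    rw [norm_smul, norm_mul, Real.norm_of_nonneg h0]
    calc ‖k τ‖ * ‖h (x, τ)‖ ≤ ‖k τ‖ * (M * min 1 τ) := by
          gcongr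
          exact hsup τ hτ x
      _ = _ := by ring

/-- A weighted superposition of functions that are small both uniformly and in `L¹` is small in
every `L^p`. -/
theorem eLpNorm_weight_integral_le [SFinite μ] (hM : 0 ≤ M) (hmeas : StronglyMeasurable h)
    (hsup : ∀ τ, 0 < τ → ∀ x, ‖h (x, τ)‖ ≤ M * min 1 τ)
    (hone : ∀ τ, 0 < τ → ∫⁻ x, ‖h (x, τ)‖ₑ ∂μ ≤ ENNReal.ofReal (M * min 1 τ)) (hk : Measurable k)
    (hkint : IntegrableOn (fun τ => k τ * min 1 τ) (Ioi 0)) {p : ℝ≥0∞} (hp1 : 1 ≤ p)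
    (hp : p ≠ ⊤) :
    MemLp (fun x => ∫ τ in Ioi (0 : ℝ), k τ • h (x, τ)) p μ ∧
    eLpNorm (fun x => ∫ τ in Ioi (0 : ℝ), k τ • h (x, τ)) p μ ≤
      ENNReal.ofReal (M * ∫ τ in Ioi (0 : ℝ), ‖k τ * min 1 τ‖) := by
  have hF : StronglyMeasurable fun x => ∫ τ in Ioi (0 : ℝ), k τ • h (x, τ) :=
    StronglyMeasurable.integral_prod_right' (f := fun q : α × ℝ => k q.2 • h q)
      ((hk.comp measurable_snd).stronglyMeasurable.smul hmeas)
  have hpt : ∀ τ ∈ Ioi (0 : ℝ), ∀ y : G, ‖y‖ ≤ M * min 1 τ →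
      ‖k τ • y‖ ≤ M * ‖k τ * min 1 τ‖ := by
    intro τ hτ y hy
    have h0 : 0 ≤ min 1 τ := le_min zero_le_one (le_of_lt hτ)
    rw [norm_smul, norm_mul, Real.norm_of_nonneg h0]
    calc ‖k τ‖ * ‖y‖ ≤ ‖k τ‖ * (M * min 1 τ) := by gcongr
      _ = _ := by ring
  have hsup' : ∀ x, ‖∫ τ in Ioi (0 : ℝ), k τ • h (x, τ)‖ ≤
      M * ∫ τ in Ioi (0 : ℝ), ‖k τ * min 1 τ‖ := by
    intro x
    rw [← integral_const_mul]
    refine norm_integral_le_of_norm_le (hkint.norm.const_mul M) ?_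
    exact (ae_restrict_iff' measurableSet_Ioi).2
      (Eventually.of_forall fun τ hτ => hpt τ hτ _ (hsup τ hτ x))
  have hone' : ∫⁻ x, ‖∫ τ in Ioi (0 : ℝ), k τ • h (x, τ)‖ₑ ∂μ ≤
      ENNReal.ofReal (M * ∫ τ in Ioi (0 : ℝ), ‖k τ * min 1 τ‖) := by
    calc ∫⁻ x, ‖∫ τ in Ioi (0 : ℝ), k τ • h (x, τ)‖ₑ ∂μ
        ≤ ∫⁻ x, ∫⁻ τ in Ioi (0 : ℝ), ‖k τ • h (x, τ)‖ₑ ∂volume ∂μ :=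
          lintegral_mono fun x => enorm_integral_le_lintegral_enorm _
      _ = ∫⁻ τ in Ioi (0 : ℝ), ∫⁻ x, ‖k τ • h (x, τ)‖ₑ ∂μ := by
          refine lintegral_lintegral_swap ?_
          exact ((hk.comp measurable_snd).stronglyMeasurable.smul hmeas).enorm.aemeasurable
      _ ≤ ∫⁻ τ in Ioi (0 : ℝ), ENNReal.ofReal (M * ‖k τ * min 1 τ‖) := by
          refine setLIntegral_mono' measurableSet_Ioi fun τ hτ => ?_
          have h0 : 0 ≤ min 1 τ := le_min zero_le_one (le_of_lt hτ)
          simp only [enorm_smul]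
          rw [lintegral_const_mul' _ _ enorm_ne_top, norm_mul, Real.norm_of_nonneg h0,
            mul_left_comm, ENNReal.ofReal_mul (norm_nonneg _), ofReal_norm]
          exact mul_le_mul_right (hone τ hτ) _
      _ ≤ ENNReal.ofReal (∫ τ in Ioi (0 : ℝ), M * ‖k τ * min 1 τ‖) := by
          rw [← ofReal_integral_eq_lintegral_ofReal (hkint.norm.const_mul M)
            (Eventually.of_forall fun τ => by positivity)]
      _ = _ := by rw [integral_const_mul]
  have hbound := eLpNorm_le_of_bound_of_lintegral_le (μ := μ)
    (fun x => by rw [← ofReal_norm]; exact ENNReal.ofReal_le_ofReal (hsup' x)) hone'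
    ENNReal.ofReal_ne_top hp1 hp
  exact ⟨⟨hF.aestronglyMeasurable, hbound.trans_lt ENNReal.ofReal_lt_top⟩, hbound⟩

end WeightedIntegrals

/-! ### Inverse Gamma densities -/

section InvGamma

/-- The (unnormalized) inverse Gamma density `τ^{-1-q} e^{-y/τ}`. -/
noncomputable def invGamma (q y τ : ℝ) : ℝ := τ ^ (-1 - q) * Real.exp (-y / τ)

theorem measurable_invGamma (q y : ℝ) : Measurable (invGamma q y) := by
  unfold invGamma
  fun_prop

theorem invGamma_nonneg {τ : ℝ} (hτ : 0 < τ) (q y : ℝ) : 0 ≤ invGamma q y τ := by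
  unfold invGamma
  positivity

/-- The substitution `x = 1/τ` leads to the Gamma integral. -/
theorem invGamma_eq_rpow_smul (q y : ℝ) {τ : ℝ} (hτ : 0 < τ) :
    invGamma q y τ = τ ^ ((-1 : ℝ) - 1) •
      (fun x : ℝ => x ^ (q - 1) * Real.exp (-(y * x))) (τ ^ (-1 : ℝ)) := by
  simp only [invGamma, smul_eq_mul]
  rw [← mul_assoc, ← Real.rpow_mul hτ.le, ← Real.rpow_add hτ, Real.rpow_neg_one]
  ring_nf

theorem integrableOn_invGamma {q y : ℝ} (hq : 0 < q) (hy : 0 < y) :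
    IntegrableOn (invGamma q y) (Ioi 0) := by
  have h1 : IntegrableOn (fun x : ℝ => x ^ (q - 1) * Real.exp (-(y * x))) (Ioi 0) := by
    have := integrableOn_rpow_mul_exp_neg_mul_rpow (p := 1) (s := q - 1) (b := y) (by linarith)
      one_pos hy
    simpa [Real.rpow_one] using this
  exact ((integrableOn_Ioi_comp_rpow_iff' _ (by norm_num : (-1 : ℝ) ≠ 0)).2 h1).congr_fun
    (fun τ hτ => (invGamma_eq_rpow_smul q y hτ).symm) measurableSet_Ioi

theorem integral_invGamma {q y : ℝ} (hq : 0 < q) (hy : 0 < y) :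
    ∫ τ in Ioi (0 : ℝ), invGamma q y τ = (1 / y) ^ q * Real.Gamma q := by
  rw [← Real.integral_rpow_mul_exp_neg_mul_Ioi hq hy,
    ← integral_comp_rpow_Ioi (fun x : ℝ => x ^ (q - 1) * Real.exp (-(y * x)))
      (by norm_num : (-1 : ℝ) ≠ 0)]
  refine setIntegral_congr_fun measurableSet_Ioi fun τ hτ => ?_
  simp only [invGamma_eq_rpow_smul q y hτ, abs_neg, abs_one, one_mul]

theorem hasDerivAt_invGamma (q : ℝ) {τ : ℝ} (hτ : 0 < τ) (y : ℝ) :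
    HasDerivAt (fun y => invGamma q y τ) (-invGamma (q + 1) y τ) y := by
  have h1 : HasDerivAt (fun y : ℝ => -y / τ) (-1 / τ) y := (hasDerivAt_id y).neg.div_const τ
  have h2 := (h1.exp).const_mul (τ ^ (-1 - q))
  unfold invGamma
  refine h2.congr_deriv ?_
  rw [show (-1 - (q + 1)) = (-1 - q) - 1 by ring, Real.rpow_sub_one hτ.ne']
  ring

theorem invGamma_anti (q : ℝ) {τ y y' : ℝ} (hτ : 0 < τ) (h : y ≤ y') :
    invGamma q y' τ ≤ invGamma q y τ := by
  unfold invGamma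
  gcongr

/-- Differentiation of a superposition with inverse Gamma weights. -/
theorem hasDerivAt_integral_invGamma_smul {G : Type*} [NormedAddCommGroup G] [NormedSpace ℝ G]
    {v : ℝ → G} (hv : StronglyMeasurable v) {C : ℝ} (hC : ∀ τ, 0 < τ → ‖v τ‖ ≤ C) {q y : ℝ}
    (hq : 0 < q) (hy : 0 < y) :
    HasDerivAt (fun y => ∫ τ in Ioi (0 : ℝ), invGamma q y τ • v τ)
      (∫ τ in Ioi (0 : ℝ), -invGamma (q + 1) y τ • v τ) y := by
  have hm : ∀ q y, AEStronglyMeasurable (fun τ => invGamma q y τ • v τ)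
      (volume.restrict (Ioi 0)) := fun q y =>
    ((measurable_invGamma q y).stronglyMeasurable.smul hv).aestronglyMeasurable
  -- The density decreases in `y`, so its value at `y/2` dominates on the neighbourhood `(y/2, ∞)`
  -- of `y`.
  refine (hasDerivAt_integral_of_dominated_loc_of_deriv_le (F' := fun y τ =>
    -invGamma (q + 1) y τ • v τ) (bound := fun τ => invGamma (q + 1) (y / 2) τ * C)
    (Ioi_mem_nhds (by linarith : y / 2 < y)) (Eventually.of_forall fun y => hm q y) ?_ ?_ ?_ ?_ ?_).2
  · refine ((integrableOn_invGamma hq hy).mul_const C).mono' (hm q y) ?_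
    refine (ae_restrict_iff' measurableSet_Ioi).2 (Eventually.of_forall fun τ hτ => ?_)
    rw [norm_smul, Real.norm_of_nonneg (invGamma_nonneg hτ q y)]
    exact mul_le_mul_of_nonneg_left (hC τ hτ) (invGamma_nonneg hτ q y)
  · exact ((measurable_invGamma (q + 1) y).neg.stronglyMeasurable.smul hv).aestronglyMeasurable
  · refine (ae_restrict_iff' measurableSet_Ioi).2 (Eventually.of_forall fun τ hτ y' hy' => ?_)
    rw [norm_smul, norm_neg, Real.norm_of_nonneg (invGamma_nonneg hτ _ _)]
    have h1 := invGamma_anti (q + 1) hτ (le_of_lt hy')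
    have h2 := invGamma_nonneg hτ (q + 1) (y / 2)
    exact mul_le_mul h1 (hC τ hτ) (norm_nonneg _) h2
  · exact (integrableOn_invGamma (by linarith) (by linarith)).mul_const C
  · refine (ae_restrict_iff' measurableSet_Ioi).2 (Eventually.of_forall fun τ hτ y' _ => ?_)
    exact (hasDerivAt_invGamma q hτ y').smul_const (v τ)

end InvGamma

/-! ### The subordination weight and its height derivative -/

section PoissonWeight

/-- The weight `(2^{2s} Γ(s))⁻¹ z^{2s} τ^{-1-s} e^{-z²/(4τ)}`, which subordinates the extension to
the semigroup. -/
noncomputable def poissonWeight (s z τ : ℝ) : ℝ :=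
  (2 ^ (2 * s) * Real.Gamma s)⁻¹ * z ^ (2 * s) * invGamma s (z ^ 2 / 4) τ

/-- The derivative of `poissonWeight` in `z`. -/
noncomputable def poissonWeightDeriv (s z τ : ℝ) : ℝ :=
  (2 ^ (2 * s) * Real.Gamma s)⁻¹ * (2 * s * z ^ (2 * s - 1) * invGamma s (z ^ 2 / 4) τ
    - z ^ (2 * s) * (z / 2) * invGamma (s + 1) (z ^ 2 / 4) τ)

theorem measurable_poissonWeight (s z : ℝ) : Measurable (poissonWeight s z) :=
  (measurable_invGamma s (z ^ 2 / 4)).const_mul _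

theorem measurable_poissonWeightDeriv (s z : ℝ) : Measurable (poissonWeightDeriv s z) := by
  have h1 := measurable_invGamma s (z ^ 2 / 4)
  have h2 := measurable_invGamma (s + 1) (z ^ 2 / 4)
  unfold poissonWeightDeriv
  fun_prop

theorem integrableOn_poissonWeight {s z : ℝ} (hs : 0 < s) (hz : 0 < z) :
    IntegrableOn (poissonWeight s z) (Ioi 0) :=
  (integrableOn_invGamma hs (by positivity)).const_mul _

theorem integrableOn_poissonWeightDeriv {s z : ℝ} (hs : 0 < s) (hz : 0 < z) :
    IntegrableOn (poissonWeightDeriv s z) (Ioi 0) :=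
  (((integrableOn_invGamma hs (by positivity)).const_mul _).sub
    ((integrableOn_invGamma (by linarith) (by positivity)).const_mul _)).const_mul _

theorem rpow_two_mul_mul_rpow {s z : ℝ} (hz : 0 < z) :
    z ^ (2 * s) * (1 / (z ^ 2 / 4)) ^ s = 2 ^ (2 * s) := by
  have h : (1 / (z ^ 2 / 4)) = (2 / z) ^ (2 : ℝ) := by
    rw [Real.rpow_two]
    field_simp
    norm_num
  rw [h, ← Real.rpow_mul (by positivity), Real.div_rpow (by norm_num) hz.le,
    mul_div_cancel₀ _ (Real.rpow_pos_of_pos hz _).ne']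

theorem integral_poissonWeight {s z : ℝ} (hs : 0 < s) (hz : 0 < z) :
    ∫ τ in Ioi (0 : ℝ), poissonWeight s z τ = 1 := by
  have hΓ := (Real.Gamma_pos_of_pos hs).ne'
  have h2 : (2 : ℝ) ^ (2 * s) ≠ 0 := (Real.rpow_pos_of_pos (by norm_num) _).ne'
  simp only [poissonWeight]
  rw [integral_const_mul, integral_invGamma hs (by positivity), mul_assoc,
    ← mul_assoc (z ^ (2 * s)), rpow_two_mul_mul_rpow hz]
  field_simp

/-- The derivative of a constant mass, checked directly with `Γ(s+1) = sΓ(s)`. It allows `u` to be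
subtracted under the integral for `∂_z U`. -/
theorem integral_poissonWeightDeriv {s z : ℝ} (hs : 0 < s) (hz : 0 < z) :
    ∫ τ in Ioi (0 : ℝ), poissonWeightDeriv s z τ = 0 := by
  have hy : 0 < z ^ 2 / 4 := by positivity
  simp only [poissonWeightDeriv]
  rw [integral_const_mul, integral_sub ((integrableOn_invGamma hs hy).const_mul _)
    ((integrableOn_invGamma (by linarith) hy).const_mul _), integral_const_mul,
    integral_const_mul, integral_invGamma hs hy, integral_invGamma (by linarith) hy,
    Real.Gamma_add_one hs.ne', Real.rpow_add_one (by positivity), Real.rpow_sub_one hz.ne']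
  have : 2 * s * (z ^ (2 * s) / z) * ((1 / (z ^ 2 / 4)) ^ s * Real.Gamma s) -
      z ^ (2 * s) * (z / 2) * ((1 / (z ^ 2 / 4)) ^ s * (1 / (z ^ 2 / 4)) * (s * Real.Gamma s)) =
      0 := by
    field_simp
    ring
  rw [this, mul_zero]

theorem poissonWeight_nonneg {s z τ : ℝ} (hs : 0 < s) (hz : 0 < z) (hτ : 0 < τ) :
    0 ≤ poissonWeight s z τ := by
  have := Real.Gamma_pos_of_pos hs
  have := invGamma_nonneg hτ s (z ^ 2 / 4)
  unfold poissonWeight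
  positivity

/-- The exponential is dropped; what remains carries the factor `z^{2s}`, which yields the Dirichlet
limit. -/
theorem poissonWeight_le {s z τ : ℝ} (hs : 0 < s) (hz : 0 < z) (hτ : 0 < τ) :
    ‖poissonWeight s z τ‖ ≤ (2 ^ (2 * s) * Real.Gamma s)⁻¹ * z ^ (2 * s) * τ ^ (-1 - s) := by
  have := Real.Gamma_pos_of_pos hs
  rw [Real.norm_of_nonneg (poissonWeight_nonneg hs hz hτ), poissonWeight, invGamma]
  refine mul_le_mul_of_nonneg_left ?_ (by positivity)
  refine mul_le_of_le_one_right (by positivity) ?_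
  rw [Real.exp_le_one_iff]
  exact div_nonpos_of_nonpos_of_nonneg (by nlinarith) hτ.le

/-- The normalized weight of the conormal derivative, in terms of `x = z²/(4τ)`. -/
theorem neumannConst_mul_poissonWeightDeriv {s a z τ : ℝ} (hs : 0 < s) (hs1 : s < 1)
    (ha : a = 1 - 2 * s) (hz : 0 < z) (hτ : 0 < τ) :
    neumannConst a * (z ^ a * poissonWeightDeriv s z τ) =
      s / Real.Gamma (1 - s) * τ ^ (-1 - s) *
        ((1 - z ^ 2 / (4 * τ) / s) * Real.exp (-(z ^ 2 / (4 * τ)))) := by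
  have hΓ := (Real.Gamma_pos_of_pos hs).ne'
  have hΓ' := (Real.Gamma_pos_of_pos (by linarith : 0 < 1 - s)).ne'
  have h2 : (2 : ℝ) ^ (2 * s) ≠ 0 := (Real.rpow_pos_of_pos (by norm_num) _).ne'
  have e1 : (1 - a) / 2 = s := by rw [ha]; ring
  have e2 : (1 + a) / 2 = 1 - s := by rw [ha]; ring
  have e3 : (2 : ℝ) ^ (-a) = 2 ^ (2 * s) / 2 := by
    rw [← Real.rpow_sub_one (by norm_num), ha]
    ring_nf
  have e4 : z ^ a = z * (z ^ (2 * s))⁻¹ := by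
    rw [ha, Real.rpow_sub hz, Real.rpow_one]
    rfl
  have e5 : z ^ (2 * s) ≠ 0 := (Real.rpow_pos_of_pos hz _).ne'
  have e6 : -(z ^ 2 / 4) / τ = -(z ^ 2 / (4 * τ)) := by field_simp
  have e7 : τ ^ (-1 - (s + 1)) = τ ^ (-1 - s) / τ := by
    rw [← Real.rpow_sub_one hτ.ne']
    ring_nf
  rw [neumannConst, poissonWeightDeriv, e1, e2, e3, e4, invGamma, invGamma, e6, e7,
    Real.rpow_sub_one hz.ne']
  field_simp
  ring

end PoissonWeight

/-! ### Subordination of the extension to the semigroup -/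

section Extension

variable {N : ℕ} {𝕜 : Type*} [RCLike 𝕜] {Q B : Matrix (Fin N) (Fin N) ℝ} {s a : ℝ}

theorem poissonKernel_eq (ha : a = 1 - 2 * s) (z : ℝ) (X Y : Sp N) {τ : ℝ} (hτ : 0 < τ) :
    poissonKernel Q B a z X Y τ = poissonWeight s z τ * kernel Q B X Y τ := by
  have e1 : 1 - a = 2 * s := by rw [ha]; ring
  have e2 : (1 - a) / 2 = s := by rw [ha]; ring
  have e3 : (3 - a) / 2 = 1 + s := by rw [ha]; ring
  have e4 : -z ^ 2 / (4 * τ) = -(z ^ 2 / 4) / τ := by field_simp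
  have e5 : τ ^ (-1 - s) = (τ ^ (1 + s))⁻¹ := by
    rw [← Real.rpow_neg hτ.le]
    ring_nf
  rw [poissonKernel, poissonWeight, invGamma, e2, e1, e3, e4, e5]
  ring

theorem extension_eq (ha : a = 1 - 2 * s) (u : Sp N × ℝ → 𝕜) (P : Sp N × ℝ) (z : ℝ) :
    extension Q B a u P z =
      ∫ τ in Ioi (0 : ℝ), poissonWeight s z τ • evolSemigroup Q B τ u P := by
  refine setIntegral_congr_fun measurableSet_Ioi fun τ hτ => ?_
  simp only [evolSemigroup]
  rw [← integral_smul]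
  congr 1
  funext Y
  rw [poissonKernel_eq ha z _ _ hτ, mul_smul]

theorem stronglyMeasurable_evolSemigroup_apply (Q B : Matrix (Fin N) (Fin N) ℝ) {u : Sp N × ℝ → 𝕜}
    (hu : Continuous u) (P : Sp N × ℝ) : StronglyMeasurable fun τ => evolSemigroup Q B τ u P :=
  StronglyMeasurable.comp_measurable (g := fun τ : ℝ => (P, τ)) (measurable_evolSemigroup Q B hu)
    measurable_prodMk_left

theorem integrableOn_smul_evolSemigroup (hK : ∀ t : ℝ, 0 < t → (covMatrix Q B t).PosDef)
    (u : 𝓢(Sp N × ℝ, 𝕜)) {k : ℝ → ℝ} (hk : IntegrableOn k (Ioi 0)) (P : Sp N × ℝ) :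
    IntegrableOn (fun τ => k τ • evolSemigroup Q B τ u P) (Ioi 0) := by
  obtain ⟨C, hC0, hC⟩ := schwartz_bounded u
  refine (hk.norm.mul_const C).mono' (hk.aestronglyMeasurable.smul
    (stronglyMeasurable_evolSemigroup_apply Q B u.continuous P).aestronglyMeasurable) ?_
  refine (ae_restrict_iff' measurableSet_Ioi).2 (Eventually.of_forall fun τ hτ => ?_)
  rw [norm_smul]
  gcongr
  exact norm_evolSemigroup_le hK hτ hC P

theorem hasDerivAt_extension (hK : ∀ t : ℝ, 0 < t → (covMatrix Q B t).PosDef) (hs : 0 < s)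
    (ha : a = 1 - 2 * s) (u : 𝓢(Sp N × ℝ, 𝕜)) (P : Sp N × ℝ) {z : ℝ} (hz : 0 < z) :
    HasDerivAt (extension Q B a u P)
      (∫ τ in Ioi (0 : ℝ), poissonWeightDeriv s z τ • evolSemigroup Q B τ u P) z := by
  obtain ⟨C, hC0, hC⟩ := schwartz_bounded u
  set v : ℝ → 𝕜 := fun τ => evolSemigroup Q B τ u P with hv
  set c : ℝ := (2 ^ (2 * s) * Real.Gamma s)⁻¹ with hc
  have hy : 0 < z ^ 2 / 4 := by positivity
  have hW := hasDerivAt_integral_invGamma_smul (v := v)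
    (stronglyMeasurable_evolSemigroup_apply Q B u.continuous P)
    (fun τ hτ => norm_evolSemigroup_le hK hτ hC P) hs hy
  have hsq : HasDerivAt (fun z : ℝ => z ^ 2 / 4) (z / 2) z := by
    have := (hasDerivAt_pow 2 z).div_const 4
    refine this.congr_deriv ?_
    norm_num
    ring
  have hpow : HasDerivAt (fun z : ℝ => c * z ^ (2 * s)) (c * (2 * s * z ^ (2 * s - 1))) z :=
    (Real.hasDerivAt_rpow_const (Or.inl hz.ne')).const_mul c
  have hcomp := hpow.smul (HasDerivAt.scomp z hW hsq)
  have heq : extension Q B a u P = fun z =>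
      (c * z ^ (2 * s)) • ∫ τ in Ioi (0 : ℝ), invGamma s (z ^ 2 / 4) τ • v τ := by
    funext z
    rw [extension_eq ha, ← integral_smul]
    simp only [poissonWeight, smul_smul, hv, hc]
  rw [heq]
  refine hcomp.congr_deriv ?_
  have i1 : IntegrableOn (fun τ => (c * (2 * s * z ^ (2 * s - 1))) •
      (invGamma s (z ^ 2 / 4) τ • v τ)) (Ioi 0) :=
    Integrable.smul (c * (2 * s * z ^ (2 * s - 1)))
      (integrableOn_smul_evolSemigroup hK u (integrableOn_invGamma hs hy) P)
  have i2 : IntegrableOn (fun τ => (c * (z ^ (2 * s) * (z / 2))) •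
      (invGamma (s + 1) (z ^ 2 / 4) τ • v τ)) (Ioi 0) :=
    Integrable.smul (c * (z ^ (2 * s) * (z / 2))) (integrableOn_smul_evolSemigroup hK u
      (integrableOn_invGamma (by linarith : 0 < s + 1) hy) P)
  have h1 : ∀ τ, poissonWeightDeriv s z τ • v τ =
      (c * (2 * s * z ^ (2 * s - 1))) • (invGamma s (z ^ 2 / 4) τ • v τ) -
        (c * (z ^ (2 * s) * (z / 2))) • (invGamma (s + 1) (z ^ 2 / 4) τ • v τ) := by
    intro τ
    rw [poissonWeightDeriv, ← hc, smul_smul, smul_smul, ← sub_smul]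
    congr 1
    ring
  have h2 : ∫ τ in Ioi (0 : ℝ), poissonWeightDeriv s z τ • evolSemigroup Q B τ u P =
      ∫ τ in Ioi (0 : ℝ), ((c * (2 * s * z ^ (2 * s - 1))) • (invGamma s (z ^ 2 / 4) τ • v τ) -
        (c * (z ^ (2 * s) * (z / 2))) • (invGamma (s + 1) (z ^ 2 / 4) τ • v τ)) :=
    integral_congr_ae (Eventually.of_forall h1)
  rw [h2, integral_sub i1 i2, integral_smul, integral_smul]
  simp only [Function.comp]
  simp only [neg_smul, integral_neg, smul_neg, smul_smul]
  rw [mul_assoc c, neg_add_eq_sub]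

/-- The weight has mass one, so `u` moves under the integral, where the difference is `O(τ)` and
tames the singularity `τ^{-1-s}` uniformly in `z`. -/
theorem extension_sub_eq (hK : ∀ t : ℝ, 0 < t → (covMatrix Q B t).PosDef) (hs : 0 < s)
    (ha : a = 1 - 2 * s) (u : 𝓢(Sp N × ℝ, 𝕜)) (P : Sp N × ℝ) {z : ℝ} (hz : 0 < z) :
    extension Q B a u P z - u P =
      ∫ τ in Ioi (0 : ℝ), poissonWeight s z τ • (evolSemigroup Q B τ u P - u P) := by
  have h1 := integrableOn_poissonWeight hs hz
  simp only [smul_sub]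
  rw [integral_sub (integrableOn_smul_evolSemigroup hK u h1 P) (h1.smul_const _),
    integral_smul_const, integral_poissonWeight hs hz, one_smul, extension_eq ha]

theorem deriv_extension_eq (hK : ∀ t : ℝ, 0 < t → (covMatrix Q B t).PosDef) (hs : 0 < s)
    (ha : a = 1 - 2 * s) (u : 𝓢(Sp N × ℝ, 𝕜)) (P : Sp N × ℝ) {z : ℝ} (hz : 0 < z) :
    deriv (extension Q B a u P) z =
      ∫ τ in Ioi (0 : ℝ), poissonWeightDeriv s z τ • (evolSemigroup Q B τ u P - u P) := by
  have h1 := integrableOn_poissonWeightDeriv hs hz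
  simp only [smul_sub]
  rw [integral_sub (integrableOn_smul_evolSemigroup hK u h1 P) (h1.smul_const _),
    integral_smul_const, integral_poissonWeightDeriv hs hz, zero_smul, sub_zero,
    (hasDerivAt_extension hK hs ha u P hz).deriv]

end Extension

/-! ### Absolute convergence and boundary limits -/

section Convergence

variable {N : ℕ} {𝕜 : Type*} [RCLike 𝕜] {Q B : Matrix (Fin N) (Fin N) ℝ} {s a : ℝ}

theorem integrable_kernel_smul (hK : ∀ t : ℝ, 0 < t → (covMatrix Q B t).PosDef) {τ : ℝ}
    (hτ : 0 < τ) {u : Sp N × ℝ → 𝕜} (hu : Continuous u) {C : ℝ} (hC : ∀ P, ‖u P‖ ≤ C)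
    (X : Sp N) (t : ℝ) : Integrable fun Y => kernel Q B X Y τ • u (Y, t) := by
  rw [integrable_kernel_smul_iff hK hτ X fun Y => u (Y, t)]
  exact integrable_gauss_smul (by fun_prop) fun V => hC _

/-- Tonelli: the kernel is nonnegative, so the absolute inner integral is the weight times `P_τ|u|`,
which is bounded. -/
theorem integrableOn_poissonKernel_smul (hK : ∀ t : ℝ, 0 < t → (covMatrix Q B t).PosDef)
    (hs : 0 < s) (ha : a = 1 - 2 * s) (u : 𝓢(Sp N × ℝ, 𝕜)) (X : Sp N) (t : ℝ) {z : ℝ}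
    (hz : 0 < z) :
    IntegrableOn (fun q : Sp N × ℝ => poissonKernel Q B a z X q.1 q.2 • u (q.1, t - q.2))
      (univ ×ˢ Ioi (0 : ℝ)) := by
  obtain ⟨C, hC0, hC⟩ := schwartz_bounded u
  have hmeas : StronglyMeasurable fun q : Sp N × ℝ =>
      poissonWeight s z q.2 • (kernel Q B X q.1 q.2 • u (q.1, t - q.2)) := by
    have h1 : Measurable fun q : Sp N × ℝ => kernel Q B X q.1 q.2 :=
      (measurable_kernel Q B).comp (f := fun q : Sp N × ℝ => ((X, q.1), q.2)) (by fun_prop)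
    have h2 : Continuous fun q : Sp N × ℝ => u (q.1, t - q.2) := by
      have := u.continuous
      fun_prop
    exact ((measurable_poissonWeight s z).comp measurable_snd).stronglyMeasurable.smul
      (h1.stronglyMeasurable.smul h2.stronglyMeasurable)
  have hmain : IntegrableOn (fun q : Sp N × ℝ =>
      poissonWeight s z q.2 • (kernel Q B X q.1 q.2 • u (q.1, t - q.2)))
      (univ ×ˢ Ioi (0 : ℝ)) := by
    rw [IntegrableOn, Measure.volume_eq_prod, ← Measure.prod_restrict, Measure.restrict_univ,
      integrable_prod_iff' hmeas.aestronglyMeasurable]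
    constructor
    · refine (ae_restrict_iff' measurableSet_Ioi).2 (Eventually.of_forall fun τ hτ => ?_)
      exact Integrable.smul (poissonWeight s z τ)
        (integrable_kernel_smul hK hτ u.continuous hC X (t - τ))
    · have hu' : Continuous fun P => ‖u P‖ := u.continuous.norm
      have h1 : ∀ τ ∈ Ioi (0 : ℝ), ∫ Y, ‖poissonWeight s z τ • (kernel Q B X Y τ • u (Y, t - τ))‖
          = poissonWeight s z τ * evolSemigroup Q B τ (fun P => ‖u P‖) (X, t) := by
        intro τ hτ
        rw [evolSemigroup, ← integral_const_mul]
        congr 1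
        funext Y
        rw [norm_smul, norm_smul, Real.norm_of_nonneg (poissonWeight_nonneg hs hz hτ),
          Real.norm_of_nonneg (kernel_nonneg hK hτ X Y), smul_eq_mul]
      have h2 : IntegrableOn (fun τ => poissonWeight s z τ *
          evolSemigroup Q B τ (fun P => ‖u P‖) (X, t)) (Ioi 0) := by
        refine ((integrableOn_poissonWeight hs hz).norm.mul_const C).mono'
          ((measurable_poissonWeight s z).stronglyMeasurable.mul
            (stronglyMeasurable_evolSemigroup_apply Q B hu' (X, t))).aestronglyMeasurable ?_
        refine (ae_restrict_iff' measurableSet_Ioi).2 (Eventually.of_forall fun τ hτ => ?_)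
        rw [norm_mul]
        gcongr
        exact norm_evolSemigroup_le hK hτ (by simpa using hC) (X, t)
      exact h2.congr_fun (fun τ hτ => (h1 τ hτ).symm) measurableSet_Ioi
  refine hmain.congr_fun (fun q hq => ?_) (MeasurableSet.univ.prod measurableSet_Ioi)
  simp only
  rw [poissonKernel_eq ha z _ _ hq.2, mul_smul]

theorem extension_eq_integral_Iio (u : Sp N × ℝ → 𝕜) (X : Sp N) (t z : ℝ) :
    extension Q B a u (X, t) z =
      ∫ τ in Iio t, ∫ Y : Sp N, poissonKernel Q B a z X Y (t - τ) • u (Y, τ) := by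
  rw [extension, ← integral_indicator measurableSet_Ioi, ← integral_indicator measurableSet_Iio,
    ← integral_sub_left_eq_self _ volume t]
  congr 1
  funext τ
  by_cases h : τ < t
  · rw [indicator_of_mem (show t - τ ∈ Ioi (0 : ℝ) from sub_pos.2 h),
      indicator_of_mem (show τ ∈ Iio t from h)]
    simp
  · rw [indicator_of_notMem (show t - τ ∉ Ioi (0 : ℝ) from fun h' => h (sub_pos.1 h')),
      indicator_of_notMem (show τ ∉ Iio t from h)]

theorem weight_bound {k : ℝ → ℝ} (hs0 : 0 < s) (hs1 : s < 1) (hk : Measurable k) {c : ℝ}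
    (hc : ∀ τ, 0 < τ → ‖k τ‖ ≤ c * τ ^ (-1 - s)) :
    IntegrableOn (fun τ => k τ * min 1 τ) (Ioi 0) ∧
      ∫ τ in Ioi (0 : ℝ), ‖k τ * min 1 τ‖ ≤ c * ∫ τ in Ioi (0 : ℝ), τ ^ (-1 - s) * min 1 τ := by
  have hpt : ∀ τ ∈ Ioi (0 : ℝ), ‖k τ * min 1 τ‖ ≤ c * (τ ^ (-1 - s) * min 1 τ) := by
    intro τ hτ
    have h0 : 0 ≤ min 1 τ := le_min zero_le_one (le_of_lt hτ)
    rw [norm_mul, Real.norm_of_nonneg h0, ← mul_assoc]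
    exact mul_le_mul_of_nonneg_right (hc τ hτ) h0
  have hint := (integrableOn_rpow_mul_min hs0 hs1).const_mul c
  have h1 : IntegrableOn (fun τ => k τ * min 1 τ) (Ioi 0) := by
    refine hint.mono' (by fun_prop) ?_
    exact (ae_restrict_iff' measurableSet_Ioi).2 (Eventually.of_forall hpt)
  refine ⟨h1, ?_⟩
  rw [← integral_const_mul]
  exact setIntegral_mono_on h1.norm hint measurableSet_Ioi hpt

/-- The weight by which the normalized conormal derivative at height `z` differs from the
fractional power. -/
noncomputable def neumannDefect (s z τ : ℝ) : ℝ :=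
  s / Real.Gamma (1 - s) * τ ^ (-1 - s) *
    (1 - (1 - z ^ 2 / (4 * τ) / s) * Real.exp (-(z ^ 2 / (4 * τ))))

theorem measurable_neumannDefect (s z : ℝ) : Measurable (neumannDefect s z) := by
  unfold neumannDefect
  fun_prop

theorem norm_neumannDefect_le (hs0 : 0 < s) (hs1 : s < 1) (z : ℝ) {τ : ℝ} (hτ : 0 < τ) :
    ‖neumannDefect s z τ‖ ≤ s / Real.Gamma (1 - s) * (2 + 1 / s) * τ ^ (-1 - s) := by
  have hΓ := Real.Gamma_pos_of_pos (by linarith : 0 < 1 - s)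
  set x := z ^ 2 / (4 * τ) with hx
  have hx0 : 0 ≤ x := by positivity
  have h1 : Real.exp (-x) ≤ 1 := by simpa using hx0
  have h2 : x * Real.exp (-x) ≤ 1 := by
    have h3 : x ≤ Real.exp x := by linarith [Real.add_one_le_exp x]
    calc x * Real.exp (-x) ≤ Real.exp x * Real.exp (-x) := by gcongr
      _ = 1 := by rw [← Real.exp_add]; simp
  have h3 : ‖1 - (1 - x / s) * Real.exp (-x)‖ ≤ 2 + 1 / s := by
    -- In this form both parts are nonnegative, the first at most `1` and the second at most `1/s`
    -- since `x e^{-x} ≤ 1`.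
    have e : 1 - (1 - x / s) * Real.exp (-x) = 1 - Real.exp (-x) + x * Real.exp (-x) / s := by
      ring
    have h4 : x * Real.exp (-x) / s ≤ 1 / s := by gcongr
    have h5 : 0 ≤ x * Real.exp (-x) / s := by positivity
    rw [e, Real.norm_of_nonneg (by linarith)]
    linarith [Real.exp_pos (-x)]
  rw [neumannDefect, norm_mul, Real.norm_of_nonneg (by positivity), mul_right_comm]
  gcongr

/-- For fixed `τ` the bracket in the defect is continuous in `z` and vanishes at `z = 0`; the bound
independent of `z` gives dominated convergence. -/
theorem tendsto_integral_neumannDefect (hs0 : 0 < s) (hs1 : s < 1) :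
    Tendsto (fun z => ∫ τ in Ioi (0 : ℝ), ‖neumannDefect s z τ * min 1 τ‖) (𝓝[>] 0) (𝓝 0) := by
  have h := tendsto_integral_filter_of_dominated_convergence
    (μ := volume.restrict (Ioi (0 : ℝ))) (l := 𝓝[>] (0 : ℝ))
    (F := fun z τ => ‖neumannDefect s z τ * min 1 τ‖) (f := fun _ => (0 : ℝ))
    (fun τ => s / Real.Gamma (1 - s) * (2 + 1 / s) * (τ ^ (-1 - s) * min 1 τ)) ?_ ?_ ?_ ?_
  · simpa using h
  · refine Eventually.of_forall fun z => ?_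
    have := measurable_neumannDefect s z
    exact Measurable.aestronglyMeasurable (by fun_prop)
  · refine Eventually.of_forall fun z => ?_
    refine (ae_restrict_iff' measurableSet_Ioi).2 (Eventually.of_forall fun τ hτ => ?_)
    have h0 : 0 ≤ min 1 τ := le_min zero_le_one (le_of_lt hτ)
    rw [norm_norm, norm_mul, Real.norm_of_nonneg h0, ← mul_assoc]
    exact mul_le_mul_of_nonneg_right (norm_neumannDefect_le hs0 hs1 z hτ) h0
  · exact (integrableOn_rpow_mul_min hs0 hs1).const_mul _
  · refine (ae_restrict_iff' measurableSet_Ioi).2 (Eventually.of_forall fun τ hτ => ?_)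
    have hc : Continuous fun z => ‖neumannDefect s z τ * min 1 τ‖ := by
      unfold neumannDefect
      fun_prop
    have := (hc.tendsto 0).mono_left (nhdsWithin_le_nhds (s := Ioi (0 : ℝ)))
    simpa [neumannDefect] using this

theorem integrableOn_fracPow (hK : ∀ t : ℝ, 0 < t → (covMatrix Q B t).PosDef)
    (hB : 0 ≤ B.trace) (hs0 : 0 < s) (hs1 : s < 1) (u : 𝓢(Sp N × ℝ, 𝕜)) (P : Sp N × ℝ) :
    IntegrableOn (fun τ : ℝ => τ ^ (-1 - s) • (evolSemigroup Q B τ u P - u P)) (Ioi (0 : ℝ)) := by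
  obtain ⟨M, hM0, hM⟩ := exists_evolSemigroup_sub_bound hK hB u
  exact integrableOn_weight_smul (h := fun q => evolSemigroup Q B q.2 u q.1 - u q.1)
    ((measurable_evolSemigroup Q B u.continuous).sub
      (u.continuous.comp continuous_fst).stronglyMeasurable)
    (fun τ hτ => (hM τ hτ).1) (by fun_prop) (integrableOn_rpow_mul_min hs0 hs1) P

/-- The `L^p` behaviour of the extension and of its conormal derivative at the boundary. -/
theorem extension_memLp_tendsto (hK : ∀ t : ℝ, 0 < t → (covMatrix Q B t).PosDef)
    (hB : 0 ≤ B.trace) (hs0 : 0 < s) (hs1 : s < 1) (ha : a = 1 - 2 * s) (u : 𝓢(Sp N × ℝ, 𝕜))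
    {p : ℝ≥0∞} (hp1 : 1 ≤ p) (hp : p ≠ ⊤) :
    (∀ z : ℝ, 0 < z → MemLp (fun P => extension Q B a u P z) p volume) ∧
    Tendsto (fun z : ℝ => eLpNorm (fun P => extension Q B a u P z - u P) p volume)
      (𝓝[>] 0) (𝓝 0) ∧
    MemLp (fracPow Q B s u) p volume ∧
    (∀ z : ℝ, 0 < z → MemLp (fun P => z ^ a • deriv (extension Q B a u P) z) p volume) ∧
    Tendsto (fun z : ℝ => eLpNorm (fun P =>
        -(neumannConst a • z ^ a • deriv (extension Q B a u P) z) - fracPow Q B s u P) p volume)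
      (𝓝[>] 0) (𝓝 0) := by
  obtain ⟨M, hM0, hM⟩ := exists_evolSemigroup_sub_bound hK hB u
  set h : (Sp N × ℝ) × ℝ → 𝕜 := fun q => evolSemigroup Q B q.2 u q.1 - u q.1 with hh
  have hmeas : StronglyMeasurable h := (measurable_evolSemigroup Q B u.continuous).sub
    (u.continuous.comp continuous_fst).stronglyMeasurable
  have hsup : ∀ τ, 0 < τ → ∀ P, ‖h (P, τ)‖ ≤ M * min 1 τ := fun τ hτ => (hM τ hτ).1
  have hone : ∀ τ, 0 < τ → ∫⁻ P, ‖h (P, τ)‖ₑ ≤ ENNReal.ofReal (M * min 1 τ) :=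
    fun τ hτ => (hM τ hτ).2
  have main : ∀ {k : ℝ → ℝ}, Measurable k → IntegrableOn (fun τ => k τ * min 1 τ) (Ioi 0) →
      MemLp (fun x => ∫ τ in Ioi (0 : ℝ), k τ • h (x, τ)) p volume ∧
      eLpNorm (fun x => ∫ τ in Ioi (0 : ℝ), k τ • h (x, τ)) p volume ≤
        ENNReal.ofReal (M * ∫ τ in Ioi (0 : ℝ), ‖k τ * min 1 τ‖) := fun hk hki =>
    eLpNorm_weight_integral_le hM0 hmeas hsup hone hk hki hp1 hp
  set Cs : ℝ := ∫ τ in Ioi (0 : ℝ), τ ^ (-1 - s) * min 1 τ with hCs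
  set c : ℝ := (2 ^ (2 * s) * Real.Gamma s)⁻¹ with hc
  have hpw : ∀ z : ℝ, 0 < z → _ := fun z hz =>
    weight_bound hs0 hs1 (measurable_poissonWeight s z) (fun τ hτ => poissonWeight_le hs0 hz hτ)
  -- For fixed `z` the weight is itself integrable; uniformity in `z` is only needed for the defect.
  have hpwd : ∀ z, 0 < z → IntegrableOn (fun τ => poissonWeightDeriv s z τ * min 1 τ) (Ioi 0) := by
    intro z hz
    refine (integrableOn_poissonWeightDeriv hs0 hz).norm.mono'
      ((measurable_poissonWeightDeriv s z).mul (by fun_prop)).aestronglyMeasurable ?_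
    refine (ae_restrict_iff' measurableSet_Ioi).2 (Eventually.of_forall fun τ hτ => ?_)
    have h0 : 0 ≤ min 1 τ := le_min zero_le_one (le_of_lt hτ)
    rw [norm_mul, Real.norm_of_nonneg h0]
    exact mul_le_of_le_one_right (norm_nonneg _) (min_le_left _ _)
  have hfrac : fracPow Q B s u = (-(s / Real.Gamma (1 - s))) •
      fun P => ∫ τ in Ioi (0 : ℝ), τ ^ (-1 - s) • h (P, τ) := rfl
  have hfm : Measurable fun τ : ℝ => τ ^ (-1 - s) := by fun_prop
  have hfi : IntegrableOn (fun τ : ℝ => τ ^ (-1 - s) * min 1 τ) (Ioi 0) :=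
    integrableOn_rpow_mul_min hs0 hs1
  refine ⟨fun z hz => ?_, ?_, ?_, fun z hz => ?_, ?_⟩
  · have h1 := (main (measurable_poissonWeight s z) (hpw z hz).1).1
    have h2 : MemLp u p volume := u.memLp p
    refine (h1.add h2).ae_eq (Eventually.of_forall fun P => ?_)
    have := extension_sub_eq hK hs0 ha u P hz
    simp only [Pi.add_apply, hh]
    rw [← this, sub_add_cancel]
  · have hlim : Tendsto (fun z : ℝ => ENNReal.ofReal (M * (c * z ^ (2 * s) * Cs))) (𝓝[>] 0)
        (𝓝 0) := by
      have hcont : Continuous fun z : ℝ => ENNReal.ofReal (M * (c * z ^ (2 * s) * Cs)) := by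
        have : Continuous fun z : ℝ => z ^ (2 * s) := Real.continuous_rpow_const (by positivity)
        exact ENNReal.continuous_ofReal.comp (by fun_prop)
      have := (hcont.tendsto 0).mono_left (nhdsWithin_le_nhds (s := Ioi (0 : ℝ)))
      simpa [Real.zero_rpow (by positivity : 2 * s ≠ 0)] using this
    refine tendsto_of_tendsto_of_tendsto_of_le_of_le' tendsto_const_nhds hlim
      (Eventually.of_forall fun _ => zero_le) ?_
    filter_upwards [self_mem_nhdsWithin] with z hz
    have h1 := (main (measurable_poissonWeight s z) (hpw z hz).1).2
    have h2 : (fun P => extension Q B a u P z - u P) =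
        fun P => ∫ τ in Ioi (0 : ℝ), poissonWeight s z τ • h (P, τ) :=
      funext fun P => extension_sub_eq hK hs0 ha u P hz
    rw [h2]
    refine h1.trans (ENNReal.ofReal_le_ofReal ?_)
    exact mul_le_mul_of_nonneg_left (hpw z hz).2 hM0
  · rw [hfrac]
    exact (main hfm hfi).1.const_smul _
  · have h1 := (main (measurable_poissonWeightDeriv s z) (hpwd z hz)).1.const_smul (z ^ a)
    refine h1.ae_eq (Eventually.of_forall fun P => ?_)
    simp only [Pi.smul_apply]
    rw [deriv_extension_eq hK hs0 ha u P hz]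
  · have hlim : Tendsto (fun z : ℝ => ENNReal.ofReal
        (M * ∫ τ in Ioi (0 : ℝ), ‖neumannDefect s z τ * min 1 τ‖)) (𝓝[>] 0) (𝓝 0) := by
      have := (ENNReal.continuous_ofReal.tendsto _).comp
        ((tendsto_integral_neumannDefect hs0 hs1).const_mul M)
      simpa [Function.comp_def] using this
    refine tendsto_of_tendsto_of_tendsto_of_le_of_le' tendsto_const_nhds hlim
      (Eventually.of_forall fun _ => zero_le) ?_
    filter_upwards [self_mem_nhdsWithin] with z hz
    have hw := (weight_bound hs0 hs1 (measurable_neumannDefect s z)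
      fun τ hτ => norm_neumannDefect_le hs0 hs1 z hτ).1
    -- The leading minus sign of `fracPow` makes this the integral of `s/Γ(1-s) τ^{-1-s}` minus the
    -- normalized conormal weight, and that difference is the defect.
    have h2 : (fun P => -(neumannConst a • z ^ a • deriv (extension Q B a u P) z)
        - fracPow Q B s u P) = fun P => ∫ τ in Ioi (0 : ℝ), neumannDefect s z τ • h (P, τ) := by
      funext P
      have i1 : IntegrableOn (fun τ => (s / Real.Gamma (1 - s)) • (τ ^ (-1 - s) • h (P, τ)))
          (Ioi 0) := Integrable.smul (s / Real.Gamma (1 - s))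
        (integrableOn_weight_smul hmeas hsup hfm hfi P)
      have i2 : IntegrableOn (fun τ => (neumannConst a * z ^ a) •
          (poissonWeightDeriv s z τ • h (P, τ))) (Ioi 0) :=
        Integrable.smul (neumannConst a * z ^ a)
          (integrableOn_weight_smul hmeas hsup (measurable_poissonWeightDeriv s z) (hpwd z hz) P)
      have h3 : ∫ τ in Ioi (0 : ℝ), neumannDefect s z τ • h (P, τ) =
          ∫ τ in Ioi (0 : ℝ), ((s / Real.Gamma (1 - s)) • (τ ^ (-1 - s) • h (P, τ)) -
            (neumannConst a * z ^ a) • (poissonWeightDeriv s z τ • h (P, τ))) := by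
        refine setIntegral_congr_fun measurableSet_Ioi fun τ hτ => ?_
        rw [smul_smul, smul_smul, ← sub_smul, mul_assoc (neumannConst a),
          neumannConst_mul_poissonWeightDeriv hs0 hs1 ha hz hτ, neumannDefect]
        congr 1
        ring
      rw [h3, integral_sub i1 i2, integral_smul, integral_smul,
        deriv_extension_eq hK hs0 ha u P hz, hfrac, Pi.smul_apply, neg_smul, smul_smul]
      rw [sub_neg_eq_add, neg_add_eq_sub]
    rw [h2]
    exact (main (measurable_neumannDefect s z) hw).2

end Convergence

/-! ### Differentiating superpositions of exponentials -/

section ExponentialIntegral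

variable {α : Type*} [MeasurableSpace α] {E : Type*} [NormedAddCommGroup E] [NormedSpace ℝ E]

/-- Superposition `∫ A(q) e^{L_q(x)} dμ(q)` of exponentials of linear forms. -/
noncomputable def expIntegral (μ : Measure α) (L : α → E →L[ℝ] ℂ) (A : α → ℂ) (x : E) : ℂ :=
  ∫ q, A q * Complex.exp (L q x) ∂μ

/-- The amplitude `A` has finite moments of all orders against `e^b`. -/
structure HasMoments (μ : Measure α) (L : α → E →L[ℝ] ℂ) (b : α → ℝ) (A : α → ℂ) : Prop where
  meas : AEStronglyMeasurable A μ
  integrable : ∀ k : ℕ, Integrable (fun q => ‖L q‖ ^ k * ‖A q‖ * Real.exp (b q)) μ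

variable {μ : Measure α} {L : α → E →L[ℝ] ℂ} {b : α → ℝ} {A : α → ℂ} {s : Set E}

/-- A derivative in direction `v` multiplies the amplitude by `L_q(v)`. Asking for moments of all
orders makes the class stable under this operation. -/
theorem HasMoments.mul_apply (hL : AEStronglyMeasurable L μ) (hb : AEStronglyMeasurable b μ)
    (hA : HasMoments μ L b A) (v : E) : HasMoments μ L b fun q => A q * L q v := by
  have hLv : AEStronglyMeasurable (fun q => L q v) μ :=
    (ContinuousLinearMap.apply ℝ ℂ v).continuous.comp_aestronglyMeasurable hL
  refine ⟨hA.meas.mul hLv, fun k => ?_⟩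
  refine ((hA.integrable (k + 1)).const_mul ‖v‖).mono' ?_ (Eventually.of_forall fun q => ?_)
  · exact ((hL.norm.pow k).mul (hA.meas.mul hLv).norm).mul
      (Real.continuous_exp.comp_aestronglyMeasurable hb)
  · rw [Real.norm_of_nonneg (by positivity), norm_mul]
    calc ‖L q‖ ^ k * (‖A q‖ * ‖L q v‖) * Real.exp (b q)
        ≤ ‖L q‖ ^ k * (‖A q‖ * (‖L q‖ * ‖v‖)) * Real.exp (b q) := by
          gcongr
          exact (L q).le_opNorm v
      _ = _ := by ring

theorem HasMoments.integrable_exp (hL : AEStronglyMeasurable L μ) (hA : HasMoments μ L b A)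
    (hre : ∀ᵐ q ∂μ, ∀ x ∈ s, (L q x).re ≤ b q) {x : E} (hx : x ∈ s) :
    Integrable (fun q => A q * Complex.exp (L q x)) μ := by
  have hLv : AEStronglyMeasurable (fun q => L q x) μ :=
    (ContinuousLinearMap.apply ℝ ℂ x).continuous.comp_aestronglyMeasurable hL
  refine (hA.integrable 0).mono'
    (hA.meas.mul (Complex.continuous_exp.comp_aestronglyMeasurable hLv)) ?_
  filter_upwards [hre] with q hq
  rw [norm_mul, Complex.norm_exp, pow_zero, one_mul]
  gcongr
  exact hq x hx

theorem HasMoments.hasFDerivAt (hL : AEStronglyMeasurable L μ) (hA : HasMoments μ L b A)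
    (hre : ∀ᵐ q ∂μ, ∀ x ∈ s, (L q x).re ≤ b q) (hs : IsOpen s) {x : E} (hx : x ∈ s) :
    Integrable (fun q => (A q * Complex.exp (L q x)) • L q) μ ∧
    HasFDerivAt (expIntegral μ L A) (∫ q, (A q * Complex.exp (L q x)) • L q ∂μ) x := by
  have hexp : ∀ x : E, AEStronglyMeasurable (fun q => A q * Complex.exp (L q x)) μ := fun x =>
    hA.meas.mul (Complex.continuous_exp.comp_aestronglyMeasurable
      ((ContinuousLinearMap.apply ℝ ℂ x).continuous.comp_aestronglyMeasurable hL))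
  have hbound : ∀ᵐ q ∂μ, ∀ x ∈ s,
      ‖(A q * Complex.exp (L q x)) • L q‖ ≤ ‖L q‖ ^ 1 * ‖A q‖ * Real.exp (b q) := by
    filter_upwards [hre] with q hq x hx
    rw [norm_smul, norm_mul, Complex.norm_exp]
    calc ‖A q‖ * Real.exp (L q x).re * ‖L q‖ ≤ ‖A q‖ * Real.exp (b q) * ‖L q‖ := by
          gcongr
          exact hq x hx
      _ = _ := by ring
  have hm : AEStronglyMeasurable (fun q => (A q * Complex.exp (L q x)) • L q) μ :=
    (hexp x).smul hL
  refine ⟨(hA.integrable 1).mono' hm (hbound.mono fun q hq => hq x hx), ?_⟩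
  refine hasFDerivAt_integral_of_dominated_of_fderiv_le (hs.mem_nhds hx)
    (Eventually.of_forall hexp) (hA.integrable_exp hL hre hx) hm hbound (hA.integrable 1)
    (Eventually.of_forall fun q y _ => ?_)
  have h1 : HasFDerivAt (fun y => Complex.exp (L q y)) (Complex.exp (L q y) • L q) y :=
    (L q).hasFDerivAt.cexp
  have h2 := h1.const_mul (A q)
  rw [smul_smul] at h2
  exact h2

theorem HasMoments.fderiv_apply (hL : AEStronglyMeasurable L μ) (hA : HasMoments μ L b A)
    (hre : ∀ᵐ q ∂μ, ∀ x ∈ s, (L q x).re ≤ b q) (hs : IsOpen s) {x : E} (hx : x ∈ s) (v : E) :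
    fderiv ℝ (expIntegral μ L A) x v = expIntegral μ L (fun q => A q * L q v) x := by
  obtain ⟨h1, h2⟩ := hA.hasFDerivAt hL hre hs hx
  rw [h2.fderiv, ContinuousLinearMap.integral_apply h1, expIntegral]
  congr 1
  funext q
  simp only [_root_.smul_apply, smul_eq_mul]
  ring

/-- Each directional derivative is again a superposition of the same kind, so induction over all
amplitudes with moments gives every order. -/
theorem HasMoments.contDiffOn [FiniteDimensional ℝ E] (hL : AEStronglyMeasurable L μ)
    (hb : AEStronglyMeasurable b μ) (hre : ∀ᵐ q ∂μ, ∀ x ∈ s, (L q x).re ≤ b q) (hs : IsOpen s)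
    (hA : HasMoments μ L b A) : ContDiffOn ℝ ∞ (expIntegral μ L A) s := by
  refine contDiffOn_infty.2 fun n => ?_
  induction n generalizing A with
  | zero =>
    refine contDiffOn_zero.2 fun x hx => ?_
    exact (hA.hasFDerivAt hL hre hs hx).2.continuousAt.continuousWithinAt
  | succ n ih =>
    have : ((n + 1 : ℕ) : WithTop ℕ∞) = (n : WithTop ℕ∞) + 1 := by norm_cast
    rw [this, contDiffOn_succ_iff_fderiv_of_isOpen hs]
    refine ⟨fun x hx =>
      (hA.hasFDerivAt hL hre hs hx).2.differentiableAt.differentiableWithinAt, by simp, ?_⟩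
    rw [contDiffOn_clm_apply]
    intro v
    refine (ih (hA.mul_apply hL hb v)).congr fun x hx => ?_
    exact hA.fderiv_apply hL hre hs hx v

end ExponentialIntegral

/-! ### Plane-wave representation of Schwartz functions -/

section Fourier

/-- The product `E × ℝ` carries the maximum norm and no inner product. Fourier inversion is applied
on a Euclidean space of the same dimension, and adjoints of the identification recover the
frequencies dual to `X` and `t`. -/
theorem exists_fourier_representation {E : Type*} [NormedAddCommGroup E] [InnerProductSpace ℝ E]
    [FiniteDimensional ℝ E] (u : 𝓢(E × ℝ, ℂ)) :
    ∃ (n : ℕ) (φ : 𝓢(EuclideanSpace ℝ (Fin n), ℂ)) (ξ : EuclideanSpace ℝ (Fin n) →L[ℝ] E)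
      (η : EuclideanSpace ℝ (Fin n) →L[ℝ] ℝ), ∀ (X : E) (t : ℝ),
      u (X, t) = ∫ w, φ w *
        Complex.exp (Complex.I * (2 * Real.pi * (inner ℝ (ξ w) X + η w * t) : ℝ)) := by
  set n := Module.finrank ℝ (E × ℝ)
  set W := EuclideanSpace ℝ (Fin n)
  let e : W ≃L[ℝ] E × ℝ := ContinuousLinearEquiv.ofFinrankEq (by simp [n, W])
  let v : 𝓢(W, ℂ) := SchwartzMap.compCLMOfContinuousLinearEquiv ℂ e u
  let i₁ : E →L[ℝ] W := (e.symm : E × ℝ →L[ℝ] W) ∘L ContinuousLinearMap.inl ℝ E ℝ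
  let i₂ : W := e.symm (0, 1)
  refine ⟨n, FourierTransform.fourier v, ContinuousLinearMap.adjoint i₁, innerSL ℝ i₂,
    fun X t => ?_⟩
  have h1 : u (X, t) = v (e.symm (X, t)) := by
    simp [v]
  have h2 : e.symm (X, t) = i₁ X + t • i₂ := by
    have : (X, t) = ((X, 0) : E × ℝ) + t • ((0, 1) : E × ℝ) := by simp
    rw [this, map_add, map_smul]
    rfl
  have h3 : v = FourierTransformInv.fourierInv (FourierTransform.fourier v) :=
    (FourierTransform.fourierInv_fourier_eq v).symm
  rw [h1]
  conv_lhs => rw [h3]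
  rw [SchwartzMap.fourierInv_coe, Real.fourierInv_eq]
  congr 1
  funext w
  rw [Circle.smul_def, Real.fourierChar_apply, smul_eq_mul, mul_comm, h2, inner_add_right,
    inner_smul_right, ← ContinuousLinearMap.adjoint_inner_left, innerSL_apply_apply,
    real_inner_comm i₂ w]
  congr 2
  push_cast
  ring

variable {E : Type*} [NormedAddCommGroup E] [InnerProductSpace ℝ E] [FiniteDimensional ℝ E]
  [MeasurableSpace E] [BorelSpace E] {W : Type*} [NormedAddCommGroup W] [InnerProductSpace ℝ W]
  [FiniteDimensional ℝ W] [MeasurableSpace W] [BorelSpace W]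

/-- The Gaussian average of a superposition of plane waves. -/
theorem integral_gauss_smul_fourier (φ : 𝓢(W, ℂ)) (ξ : W →L[ℝ] E) (η : W →L[ℝ] ℝ) (x : E)
    (t : ℝ) (R : E →L[ℝ] E) :
    ∫ V : E, gauss V • ∫ w, φ w *
        Complex.exp (Complex.I * (2 * Real.pi * (inner ℝ (ξ w) (x + R V) + η w * t) : ℝ)) =
      ∫ w, φ w * (Complex.exp (Complex.I * (2 * Real.pi * (inner ℝ (ξ w) x + η w * t) : ℝ)) *
        Complex.exp (-(Real.pi ^ 2 * ‖ContinuousLinearMap.adjoint R (ξ w)‖ ^ 2 : ℝ))) := by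
  have hφ : Integrable φ := φ.integrable
  -- The phases have modulus one, so Fubini needs only the integrability of `gauss` and of `φ`.
  have hint : Integrable (Function.uncurry fun (V : E) (w : W) => gauss V • (φ w *
      Complex.exp (Complex.I * (2 * Real.pi * (inner ℝ (ξ w) (x + R V) + η w * t) : ℝ))))
      (volume.prod volume) := by
    have h1 : Integrable (fun q : E × W => gauss q.1 • φ q.2) (volume.prod volume) :=
      integrable_gauss.smul_prod hφ
    refine h1.mono ?_ (Eventually.of_forall fun q => ?_)
    · have := continuous_gauss (E := E)
      have := φ.continuous
      refine Continuous.aestronglyMeasurable ?_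
      simp only [Function.uncurry_def]
      fun_prop
    · simp only [Function.uncurry_def, norm_smul, norm_mul]
      rw [mul_comm Complex.I, Complex.norm_exp_ofReal_mul_I, mul_one]
  simp only [← integral_smul]
  rw [integral_integral_swap hint]
  congr 1
  funext w
  have h1 := integral_gauss_mul_cexp ((2 * Real.pi) • ContinuousLinearMap.adjoint R (ξ w))
  have h2 : ∀ V : E, gauss V • (φ w *
      Complex.exp (Complex.I * (2 * Real.pi * (inner ℝ (ξ w) (x + R V) + η w * t) : ℝ))) =
      (φ w * Complex.exp (Complex.I * (2 * Real.pi * (inner ℝ (ξ w) x + η w * t) : ℝ))) *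
        ((gauss V : ℂ) * Complex.exp (Complex.I *
          (inner ℝ ((2 * Real.pi) • ContinuousLinearMap.adjoint R (ξ w)) V : ℝ))) := by
    intro V
    rw [inner_smul_left, ContinuousLinearMap.adjoint_inner_left, inner_add_right,
      Complex.real_smul]
    have : Complex.I * (2 * Real.pi * (inner ℝ (ξ w) x + inner ℝ (ξ w) (R V) + η w * t) : ℝ) =
        Complex.I * (2 * Real.pi * (inner ℝ (ξ w) x + η w * t) : ℝ) +
          Complex.I * ((2 * Real.pi) * inner ℝ (ξ w) (R V) : ℝ) := by
      push_cast
      ring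
    rw [this, Complex.exp_add]
    simp only [conj_trivial]
    ring
  simp only [h2]
  rw [integral_const_mul, h1, mul_assoc]
  congr 3
  rw [norm_smul, Real.norm_of_nonneg (by positivity)]
  push_cast
  ring

end Fourier

theorem stronglyMeasurable_opNorm {α F : Type*} [MeasurableSpace α] [NormedAddCommGroup F]
    [NormedSpace ℝ F] {L : α → F →L[ℝ] ℂ} (hL : StronglyMeasurable L) :
    StronglyMeasurable fun q => ‖L q‖ :=
  hL.norm

/-! ### Plane waves transported by the semigroup, and their moments -/

section PlaneWaves

variable {E : Type*} [NormedAddCommGroup E] [InnerProductSpace ℝ E] [FiniteDimensional ℝ E]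
  {W : Type*} [NormedAddCommGroup W] [InnerProductSpace ℝ W]

/-- The linear form `((X,t),y) ↦ 2πi(⟨ξ, e^{τb}X⟩ + νt) - y/τ`. -/
noncomputable def phase (b : E →L[ℝ] E) (ξ : W →L[ℝ] E) (ν : W →L[ℝ] ℝ) (r : ℝ × W) :
    (E × ℝ) × ℝ →L[ℝ] ℂ :=
  (2 * Real.pi * Complex.I) • (Complex.ofRealCLM ∘L
    (innerSL ℝ (coflow b r.1 (ξ r.2)) ∘L ContinuousLinearMap.fst ℝ E ℝ ∘L
      ContinuousLinearMap.fst ℝ (E × ℝ) ℝ +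
    ν r.2 • (ContinuousLinearMap.snd ℝ E ℝ ∘L ContinuousLinearMap.fst ℝ (E × ℝ) ℝ))) -
  r.1⁻¹ • (Complex.ofRealCLM ∘L ContinuousLinearMap.snd ℝ (E × ℝ) ℝ)

theorem phase_apply (b : E →L[ℝ] E) (ξ : W →L[ℝ] E) (ν : W →L[ℝ] ℝ) (τ : ℝ) (w : W) (X : E)
    (t y : ℝ) : phase b ξ ν (τ, w) ((X, t), y) =
      2 * Real.pi * Complex.I * ((inner ℝ (coflow b τ (ξ w)) X : ℝ) + (ν w * t : ℝ)) -
        (τ⁻¹ : ℝ) * y := by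
  simp [phase]
  ring

/-- The three terms have three different remedies: the Gaussian damping for the transported
frequency, the decay of `φ` for `w`, and `e^{-y/τ}` for `τ⁻¹`. -/
theorem norm_phase_le (b : E →L[ℝ] E) (ξ : W →L[ℝ] E) (ν : W →L[ℝ] ℝ) {τ : ℝ} (hτ : 0 < τ)
    (w : W) : ‖phase b ξ ν (τ, w)‖ ≤
      2 * Real.pi * ‖coflow b τ (ξ w)‖ + 2 * Real.pi * (‖ν‖ * ‖w‖) + τ⁻¹ := by
  refine ContinuousLinearMap.opNorm_le_bound _ (by positivity) fun x => ?_
  obtain ⟨⟨X, t⟩, y⟩ := x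
  have hX : ‖X‖ ≤ ‖((X, t), y)‖ := (norm_fst_le (X, t)).trans (norm_fst_le ((X, t), y))
  have ht : ‖t‖ ≤ ‖((X, t), y)‖ := (norm_snd_le (X, t)).trans (norm_fst_le ((X, t), y))
  have hy : ‖y‖ ≤ ‖((X, t), y)‖ := norm_snd_le ((X, t), y)
  generalize ‖((X, t), y)‖ = n at hX ht hy
  rw [phase_apply]
  have h2π : ‖(2 * Real.pi * Complex.I : ℂ)‖ = 2 * Real.pi := by
    simp [abs_of_pos Real.pi_pos]
  have h1 : ‖((inner ℝ (coflow b τ (ξ w)) X : ℝ) : ℂ)‖ ≤ ‖coflow b τ (ξ w)‖ * n := by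
    rw [Complex.norm_real]
    exact (norm_inner_le_norm _ _).trans (by gcongr)
  have h2 : ‖((ν w * t : ℝ) : ℂ)‖ ≤ ‖ν‖ * ‖w‖ * n := by
    rw [Complex.norm_real, norm_mul]
    gcongr
    exact ν.le_opNorm w
  have h3 : ‖((τ⁻¹ : ℝ) : ℂ) * y‖ ≤ τ⁻¹ * n := by
    rw [norm_mul, Complex.norm_real, Complex.norm_real, Real.norm_of_nonneg (by positivity)]
    gcongr
  calc _ ≤ ‖(2 * Real.pi * Complex.I : ℂ) * ((inner ℝ (coflow b τ (ξ w)) X : ℝ) +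
          (ν w * t : ℝ))‖ + ‖((τ⁻¹ : ℝ) : ℂ) * y‖ := norm_sub_le _ _
    _ ≤ 2 * Real.pi * (‖coflow b τ (ξ w)‖ * n + ‖ν‖ * ‖w‖ * n) + τ⁻¹ * n := by
        rw [norm_mul, h2π]
        gcongr
        exact (norm_add_le _ _).trans (add_le_add h1 h2)
    _ = _ := by ring

/-- The amplitude `φ(w) τ^{-1-s} e^{-4π²⟨C(τ)ξ, ξ⟩} e^{-2πiντ}`. -/
noncomputable def amplitude (q b : E →L[ℝ] E) (s : ℝ) (φ : 𝓢(W, ℂ)) (ξ : W →L[ℝ] E)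
    (ν : W →L[ℝ] ℝ) (r : ℝ × W) : ℂ :=
  φ r.2 * ((r.1 ^ (-1 - s) * Real.exp (-(4 * Real.pi ^ 2) * covForm q b r.1 (ξ r.2)) : ℝ) : ℂ) *
    Complex.exp (-(2 * Real.pi * (ν r.2 * r.1) : ℝ) * Complex.I)

theorem norm_amplitude (q b : E →L[ℝ] E) (s : ℝ) (φ : 𝓢(W, ℂ)) (ξ : W →L[ℝ] E)
    (ν : W →L[ℝ] ℝ) {τ : ℝ} (hτ : 0 < τ) (w : W) :
    ‖amplitude q b s φ ξ ν (τ, w)‖ =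
      ‖φ w‖ * (τ ^ (-1 - s) * Real.exp (-(4 * Real.pi ^ 2) * covForm q b τ (ξ w))) := by
  simp only [amplitude]
  rw [norm_mul, norm_mul, ← Complex.ofReal_neg, Complex.norm_exp_ofReal_mul_I, mul_one,
    Complex.norm_real, Real.norm_of_nonneg (by positivity)]

theorem add_add_pow_le {x y z : ℝ} (hx : 0 ≤ x) (hy : 0 ≤ y) (hz : 0 ≤ z) (k : ℕ) :
    (x + y + z) ^ k ≤ 3 ^ k * (x ^ k + y ^ k + z ^ k) := by
  have h1 : x + y + z ≤ 3 * max x (max y z) := by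
    have := le_max_left x (max y z)
    have := (le_max_left y z).trans (le_max_right x (max y z))
    have := (le_max_right y z).trans (le_max_right x (max y z))
    linarith
  have h2 : (max x (max y z)) ^ k ≤ x ^ k + y ^ k + z ^ k := by
    have := pow_nonneg hx k
    have := pow_nonneg hy k
    have := pow_nonneg hz k
    rcases max_choice x (max y z) with h | h
    · rw [h]; linarith
    · rw [h]
      rcases max_choice y z with h' | h' <;> rw [h'] <;> linarith
  calc (x + y + z) ^ k ≤ (3 * max x (max y z)) ^ k := by gcongr
    _ = 3 ^ k * (max x (max y z)) ^ k := mul_pow _ _ _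
    _ ≤ _ := by gcongr

theorem continuous_coflow_apply (b : E →L[ℝ] E) (ξ : W →L[ℝ] E) :
    Continuous fun r : ℝ × W => coflow b r.1 (ξ r.2) :=
  ((continuous_coflow b).comp continuous_fst).clm_apply (ξ.continuous.comp continuous_snd)

variable [FiniteDimensional ℝ W] [MeasurableSpace W] [BorelSpace W]

theorem stronglyMeasurable_phase (b : E →L[ℝ] E) (ξ : W →L[ℝ] E) (ν : W →L[ℝ] ℝ) :
    StronglyMeasurable (phase b ξ ν) := by
  have h := continuous_coflow_apply b ξ
  have h1 : Continuous fun r : ℝ × W => (2 * Real.pi * Complex.I) • (Complex.ofRealCLM ∘L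
      (innerSL ℝ (coflow b r.1 (ξ r.2)) ∘L ContinuousLinearMap.fst ℝ E ℝ ∘L
        ContinuousLinearMap.fst ℝ (E × ℝ) ℝ +
      ν r.2 • (ContinuousLinearMap.snd ℝ E ℝ ∘L ContinuousLinearMap.fst ℝ (E × ℝ) ℝ))) := by
    have h3 : Continuous fun r : ℝ × W => innerSL ℝ (coflow b r.1 (ξ r.2)) ∘L
        ContinuousLinearMap.fst ℝ E ℝ ∘L ContinuousLinearMap.fst ℝ (E × ℝ) ℝ :=
      ((innerSL ℝ (E := E)).continuous.comp h).clm_comp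
        (continuous_const (y := ContinuousLinearMap.fst ℝ E ℝ ∘L
          ContinuousLinearMap.fst ℝ (E × ℝ) ℝ))
    have h4 : Continuous fun r : ℝ × W => ν r.2 • (ContinuousLinearMap.snd ℝ E ℝ ∘L
        ContinuousLinearMap.fst ℝ (E × ℝ) ℝ) :=
      (ν.continuous.comp continuous_snd).smul continuous_const
    have h5 := (continuous_const (y := Complex.ofRealCLM)).clm_comp (h3.add h4)
    exact h5.const_smul (2 * Real.pi * Complex.I)
  have h2 : StronglyMeasurable fun r : ℝ × W => r.1⁻¹ •
      (Complex.ofRealCLM ∘L ContinuousLinearMap.snd ℝ (E × ℝ) ℝ) :=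
    (measurable_fst.inv.stronglyMeasurable).smul_const _
  exact h1.stronglyMeasurable.sub h2

theorem stronglyMeasurable_amplitude (q b : E →L[ℝ] E) (s : ℝ) (φ : 𝓢(W, ℂ)) (ξ : W →L[ℝ] E)
    (ν : W →L[ℝ] ℝ) : StronglyMeasurable (amplitude q b s φ ξ ν) := by
  have hc : Continuous fun r : ℝ × W => covForm q b r.1 (ξ r.2) :=
    (continuous_covForm q b).comp
      (continuous_fst.prodMk (ξ.continuous.comp continuous_snd))
  have hφ : Measurable fun r : ℝ × W => φ r.2 := (φ.continuous.comp continuous_snd).measurable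
  have h3 : Measurable fun r : ℝ × W =>
      Complex.exp (-(2 * Real.pi * (ν r.2 * r.1) : ℝ) * Complex.I) :=
    Continuous.measurable (by fun_prop)
  have h4 : Measurable fun r : ℝ × W =>
      ((r.1 ^ (-1 - s) * Real.exp (-(4 * Real.pi ^ 2) * covForm q b r.1 (ξ r.2)) : ℝ) : ℂ) := by
    refine Complex.measurable_ofReal.comp ?_
    have := hc.measurable
    fun_prop
  exact ((hφ.mul h4).mul h3).stronglyMeasurable

theorem integrable_one_add_norm_pow_mul (φ : 𝓢(W, ℂ)) (k : ℕ) :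
    Integrable fun w => (1 + ‖w‖) ^ k * ‖φ w‖ := by
  have h0 := SchwartzMap.integrable_pow_mul volume φ 0
  have hk := SchwartzMap.integrable_pow_mul volume φ k
  refine ((h0.add hk).const_mul (3 ^ k)).mono' ?_ (Eventually.of_forall fun w => ?_)
  · have := φ.continuous
    exact Continuous.aestronglyMeasurable (by fun_prop)
  · rw [Real.norm_of_nonneg (by positivity)]
    have h := add_add_pow_le zero_le_one (norm_nonneg w) le_rfl k
    simp only [Pi.add_apply, pow_zero, one_mul]
    rcases Nat.eq_zero_or_pos k with rfl | hk0
    · simp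
    · rw [add_zero, zero_pow hk0.ne', one_pow, add_zero] at h
      calc (1 + ‖w‖) ^ k * ‖φ w‖ ≤ 3 ^ k * (1 + ‖w‖ ^ k) * ‖φ w‖ := by gcongr
        _ = _ := by ring

/-- A power of the phase costs at most `(1 + τ^{-k})(1 + ‖w‖)^k` once the damping has absorbed the
adjoint flow. The bound then factors into inverse Gamma densities in `τ` and a Schwartz moment in
`w`. -/
theorem hasMoments_amplitude {q : E →L[ℝ] E} (hq : ∀ x, 0 ≤ inner ℝ x (q x)) (b : E →L[ℝ] E)
    (hpos : ∀ ξ, ξ ≠ 0 → 0 < covForm q b 1 ξ) {s : ℝ} (hs : 0 < s) (φ : 𝓢(W, ℂ))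
    (ξ : W →L[ℝ] E) (ν : W →L[ℝ] ℝ) {y₀ : ℝ} (hy : 0 < y₀) :
    HasMoments ((volume.restrict (Ioi (0 : ℝ))).prod volume) (phase b ξ ν)
      (fun r => -y₀ / r.1) (amplitude q b s φ ξ ν) := by
  refine ⟨(stronglyMeasurable_amplitude q b s φ ξ ν).aestronglyMeasurable, fun k => ?_⟩
  obtain ⟨M, hM0, hM⟩ := exists_coflow_pow_mul_exp_le hq b hpos
    (by positivity : 0 < 4 * Real.pi ^ 2) k
  -- One summand per term of `norm_phase_le`; the factor `3^k` comes from the power of a sum of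
  -- three.
  set K : ℝ := 3 ^ k * ((2 * Real.pi) ^ k * M * (1 + ‖ξ‖) ^ k + (2 * Real.pi * ‖ν‖) ^ k + 1)
    with hK
  have hg : Integrable (fun r : ℝ × W => (invGamma s y₀ r.1 + invGamma (s + k) y₀ r.1) *
      ((1 + ‖r.2‖) ^ k * ‖φ r.2‖)) ((volume.restrict (Ioi (0 : ℝ))).prod volume) :=
    ((integrableOn_invGamma hs hy).add (integrableOn_invGamma (by positivity) hy)).mul_prod
      (integrable_one_add_norm_pow_mul φ k)
  refine (hg.const_mul K).mono' ?_ ?_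
  · have h1 : StronglyMeasurable fun r => ‖phase b ξ ν r‖ :=
      stronglyMeasurable_opNorm (stronglyMeasurable_phase b ξ ν)
    have h2 := (stronglyMeasurable_amplitude q b s φ ξ ν).norm
    have h3 : Measurable fun r : ℝ × W => Real.exp (-y₀ / r.1) := by fun_prop
    exact (((h1.pow k).mul h2).mul h3.stronglyMeasurable).aestronglyMeasurable
  · have hae : ∀ᵐ r ∂((volume.restrict (Ioi (0 : ℝ))).prod (volume : Measure W)), 0 < r.1 := by
      have : ∀ᵐ τ ∂(volume.restrict (Ioi (0 : ℝ))), 0 < τ := ae_restrict_mem measurableSet_Ioi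
      exact Measure.quasiMeasurePreserving_fst.ae this
    filter_upwards [hae] with r hr
    obtain ⟨τ, w⟩ := r
    simp only at hr
    rw [Real.norm_of_nonneg (by positivity), norm_amplitude q b s φ ξ ν hr]
    set e := Real.exp (-(4 * Real.pi ^ 2) * covForm q b τ (ξ w)) with he
    have he0 : 0 < e := Real.exp_pos _
    have he1 : e ≤ 1 := by
      rw [he, Real.exp_le_one_iff]
      have := covForm_nonneg hq b hr.le (ξ w)
      have : 0 ≤ 4 * Real.pi ^ 2 * covForm q b τ (ξ w) := by positivity
      linarith
    have h1 := norm_phase_le b ξ ν hr w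
    have hw1 : (1 : ℝ) ≤ (1 + ‖w‖) ^ k := one_le_pow₀ (by linarith [norm_nonneg w])
    have hwk : ‖w‖ ^ k ≤ (1 + ‖w‖) ^ k := by gcongr; linarith
    have hξ : (1 + ‖ξ w‖) ^ k ≤ (1 + ‖ξ‖) ^ k * (1 + ‖w‖) ^ k := by
      rw [← mul_pow]
      gcongr
      have := ξ.le_opNorm w
      nlinarith [norm_nonneg ξ, norm_nonneg w]
    have h2 : ‖phase b ξ ν (τ, w)‖ ^ k * e ≤ K * ((1 + τ⁻¹ ^ k) * (1 + ‖w‖) ^ k) := by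
      calc ‖phase b ξ ν (τ, w)‖ ^ k * e
          ≤ (2 * Real.pi * ‖coflow b τ (ξ w)‖ + 2 * Real.pi * (‖ν‖ * ‖w‖) + τ⁻¹) ^ k * e := by
            gcongr
        _ ≤ 3 ^ k * ((2 * Real.pi * ‖coflow b τ (ξ w)‖) ^ k +
              (2 * Real.pi * (‖ν‖ * ‖w‖)) ^ k + τ⁻¹ ^ k) * e := by
            gcongr
            exact add_add_pow_le (by positivity) (by positivity) (by positivity) k
        _ = 3 ^ k * ((2 * Real.pi) ^ k * (‖coflow b τ (ξ w)‖ ^ k * e) +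
              (2 * Real.pi * ‖ν‖) ^ k * ‖w‖ ^ k * e + τ⁻¹ ^ k * e) := by
            rw [mul_pow _ ‖coflow b τ (ξ w)‖, ← mul_assoc (2 * Real.pi) ‖ν‖, mul_pow _ ‖w‖]
            ring
        _ ≤ 3 ^ k * ((2 * Real.pi) ^ k * (M * ((1 + ‖ξ‖) ^ k * (1 + ‖w‖) ^ k)) +
              (2 * Real.pi * ‖ν‖) ^ k * (1 + ‖w‖) ^ k * 1 + τ⁻¹ ^ k * 1) := by
            have h3 : ‖coflow b τ (ξ w)‖ ^ k * e ≤
                M * ((1 + ‖ξ‖) ^ k * (1 + ‖w‖) ^ k) :=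
              (hM τ hr.le (ξ w)).trans (by gcongr)
            generalize ‖coflow b τ (ξ w)‖ ^ k * e = c at h3
            gcongr
        _ ≤ 3 ^ k * (((2 * Real.pi) ^ k * M * (1 + ‖ξ‖) ^ k) * (1 + τ⁻¹ ^ k) * (1 + ‖w‖) ^ k +
              (2 * Real.pi * ‖ν‖) ^ k * (1 + τ⁻¹ ^ k) * (1 + ‖w‖) ^ k +
              (1 + τ⁻¹ ^ k) * (1 + ‖w‖) ^ k) := by
            have hτk : 0 ≤ τ⁻¹ ^ k := by positivity
            have a1 : 0 ≤ (2 * Real.pi) ^ k * M * (1 + ‖ξ‖) ^ k * (1 + ‖w‖) ^ k * τ⁻¹ ^ k := by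
              positivity
            have a2 : 0 ≤ (2 * Real.pi * ‖ν‖) ^ k * (1 + ‖w‖) ^ k * τ⁻¹ ^ k := by positivity
            have a3 : τ⁻¹ ^ k ≤ τ⁻¹ ^ k * (1 + ‖w‖) ^ k := le_mul_of_one_le_right hτk hw1
            gcongr ?_ * ?_
            nlinarith
        _ = _ := by rw [hK]; ring
    -- Powers of `τ⁻¹` only raise the order of the inverse Gamma density from `s` to `s + k`.
    have h3 : τ⁻¹ ^ k * τ ^ (-1 - s) = τ ^ (-1 - (s + k)) := by
      rw [← Real.rpow_natCast, Real.inv_rpow hr.le, ← Real.rpow_neg hr.le, ← Real.rpow_add hr]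
      ring_nf
    calc ‖phase b ξ ν (τ, w)‖ ^ k * (‖φ w‖ * (τ ^ (-1 - s) * e)) * Real.exp (-y₀ / τ)
        = (‖phase b ξ ν (τ, w)‖ ^ k * e) * (‖φ w‖ * (τ ^ (-1 - s) * Real.exp (-y₀ / τ))) := by
          ring
      _ ≤ (K * ((1 + τ⁻¹ ^ k) * (1 + ‖w‖) ^ k)) *
            (‖φ w‖ * (τ ^ (-1 - s) * Real.exp (-y₀ / τ))) := by gcongr
      _ = K * ((τ ^ (-1 - s) * Real.exp (-y₀ / τ) +
            τ⁻¹ ^ k * τ ^ (-1 - s) * Real.exp (-y₀ / τ)) * ((1 + ‖w‖) ^ k * ‖φ w‖)) := by ring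
      _ = _ := by rw [h3]; rfl

theorem re_phase_le (b : E →L[ℝ] E) (ξ : W →L[ℝ] E) (ν : W →L[ℝ] ℝ) (y₀ : ℝ) :
    ∀ᵐ r ∂((volume.restrict (Ioi (0 : ℝ))).prod (volume : Measure W)),
      ∀ x ∈ {x : (E × ℝ) × ℝ | y₀ < x.2}, (phase b ξ ν r x).re ≤ -y₀ / r.1 := by
  have hae : ∀ᵐ r ∂((volume.restrict (Ioi (0 : ℝ))).prod (volume : Measure W)), 0 < r.1 := by
    have : ∀ᵐ τ ∂(volume.restrict (Ioi (0 : ℝ))), 0 < τ := ae_restrict_mem measurableSet_Ioi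
    exact Measure.quasiMeasurePreserving_fst.ae this
  filter_upwards [hae] with r hr x hx
  obtain ⟨τ, w⟩ := r
  obtain ⟨⟨X, t⟩, y⟩ := x
  have hre : (phase b ξ ν (τ, w) ((X, t), y)).re = -(τ⁻¹ * y) := by
    rw [phase_apply]
    simp
  rw [hre, neg_div, neg_le_neg_iff, div_eq_mul_inv, mul_comm]
  have : y₀ < y := hx
  have : 0 < τ := hr
  gcongr

end PlaneWaves

/-! ### End values of the inverse Gamma density -/

theorem invGamma_zero_right {s : ℝ} (hs : 0 < s) (y : ℝ) : invGamma s y 0 = 0 := by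
  rw [invGamma, Real.zero_rpow (by linarith), zero_mul]

theorem tendsto_invGamma_atTop {s y : ℝ} (hs : 0 < s) (hy : 0 < y) :
    Tendsto (invGamma s y) atTop (𝓝 0) := by
  have h := tendsto_rpow_neg_atTop (by linarith : 0 < 1 + s)
  refine squeeze_zero' ?_ ?_ h
  · filter_upwards [eventually_gt_atTop 0] with τ hτ using invGamma_nonneg hτ s y
  · filter_upwards [eventually_gt_atTop 0] with τ hτ
    rw [invGamma, neg_add']
    refine mul_le_of_le_one_right (by positivity) ?_
    rw [Real.exp_le_one_iff, neg_div]
    have : 0 < y / τ := by positivity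
    linarith

theorem tendsto_invGamma_nhdsGT_zero {s y : ℝ} (hy : 0 < y) :
    Tendsto (invGamma s y) (𝓝[>] 0) (𝓝 0) := by
  have h := (tendsto_rpow_mul_exp_neg_mul_atTop_nhds_zero (1 + s) y hy).comp
    tendsto_inv_nhdsGT_zero
  refine h.congr' ?_
  filter_upwards [self_mem_nhdsWithin] with τ hτ
  have hτ : 0 < τ := hτ
  simp only [Function.comp_apply, invGamma]
  rw [Real.inv_rpow hτ.le, ← Real.rpow_neg hτ.le, neg_add', div_eq_mul_inv]

/-! ### The symbol as a logarithmic derivative in `τ` -/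

section PlaneWaves

variable {E : Type*} [NormedAddCommGroup E] [InnerProductSpace ℝ E] [FiniteDimensional ℝ E]
  {W : Type*} [NormedAddCommGroup W] [InnerProductSpace ℝ W]

/-- The symbol of the operator `tr(q∇²) + ⟨bX, ∇⟩ - ∂_t + (1+s)∂_y + y∂_y²`. -/
noncomputable def symbol (q b : E →L[ℝ] E) (s : ℝ) (ξ : W →L[ℝ] E) (ν : W →L[ℝ] ℝ) (X : E)
    (y : ℝ) (r : ℝ × W) : ℂ :=
  -(4 * Real.pi ^ 2 * inner ℝ (coflow b r.1 (ξ r.2)) (q (coflow b r.1 (ξ r.2))) : ℝ) +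
    phase b ξ ν r ((b X, 0), 0) - phase b ξ ν r ((0, 1), 0) +
    (1 + s) * phase b ξ ν r ((0, 0), 1) +
    y * (phase b ξ ν r ((0, 0), 1) * phase b ξ ν r ((0, 0), 1))

/-- Two evolution laws combine: a transported damped wave satisfies `∂_τ = 𝒜 - ∂_t`, and the density
`τ^{-1-s} e^{-y/τ}` satisfies `∂_τ = (1+s)∂_y + y∂_y²`. Hence the logarithmic derivative in `τ` is
the symbol. -/
theorem hasDerivAt_wave (q b : E →L[ℝ] E) (s : ℝ) (φ : 𝓢(W, ℂ)) (ξ : W →L[ℝ] E)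
    (ν : W →L[ℝ] ℝ) (X : E) (t y : ℝ) (w : W) {τ : ℝ} (hτ : 0 < τ) :
    HasDerivAt (fun τ => amplitude q b s φ ξ ν (τ, w) *
        Complex.exp (phase b ξ ν (τ, w) ((X, t), y)))
      (amplitude q b s φ ξ ν (τ, w) * Complex.exp (phase b ξ ν (τ, w) ((X, t), y)) *
        symbol q b s ξ ν X y (τ, w)) τ := by
  have hcov := hasDerivAt_covForm q b τ (ξ w)
  have hpow := Real.hasDerivAt_rpow_const (p := -1 - s) (Or.inl hτ.ne')
  have hreal := (hpow.mul (hcov.const_mul (-(4 * Real.pi ^ 2))).exp).ofReal_comp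
  have hosc : HasDerivAt (fun τ : ℝ =>
      Complex.exp (-(2 * Real.pi * (ν w * τ) : ℝ) * Complex.I))
      (Complex.exp (-(2 * Real.pi * (ν w * τ) : ℝ) * Complex.I) *
        (-(2 * Real.pi * ν w : ℝ) * Complex.I)) τ := by
    have h1 : HasDerivAt (fun τ : ℝ => 2 * Real.pi * (ν w * τ)) (2 * Real.pi * ν w) τ := by
      simpa using ((hasDerivAt_id τ).const_mul (ν w)).const_mul (2 * Real.pi)
    exact (h1.ofReal_comp.neg.mul_const Complex.I).cexp
  have hflow : HasDerivAt (fun τ => inner ℝ (coflow b τ (ξ w)) X)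
      (inner ℝ (coflow b τ (ξ w)) (b X)) τ := by
    simp only [inner_coflow]
    simpa using (hasDerivAt_const τ (ξ w)).inner ℝ (hasDerivAt_flow_apply b τ X)
  have hphase : HasDerivAt (fun τ => phase b ξ ν (τ, w) ((X, t), y))
      (2 * Real.pi * Complex.I * (inner ℝ (coflow b τ (ξ w)) (b X) : ℝ) -
        ((-(τ ^ 2)⁻¹ : ℝ) : ℂ) * y) τ := by
    simp only [phase_apply]
    exact ((hflow.ofReal_comp.add_const _).const_mul _).sub
      ((hasDerivAt_inv hτ.ne').ofReal_comp.mul_const _)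
  have hall := (((hreal.const_mul (φ w)).mul hosc)).mul hphase.cexp
  refine hall.congr_deriv ?_
  have hτs : τ ^ (-1 - s - 1) = τ ^ (-1 - s) * τ⁻¹ := by
    rw [Real.rpow_sub_one hτ.ne', div_eq_mul_inv]
  have hτ0 : (τ : ℂ) ≠ 0 := by exact_mod_cast hτ.ne'
  simp only [symbol, amplitude, phase_apply, hτs, inner_zero_right, Pi.mul_apply]
  push_cast
  field_simp
  ring_nf

theorem norm_wave_le {q : E →L[ℝ] E} (hq : ∀ x, 0 ≤ inner ℝ x (q x)) (b : E →L[ℝ] E) (s : ℝ)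
    (φ : 𝓢(W, ℂ)) (ξ : W →L[ℝ] E) (ν : W →L[ℝ] ℝ) (X : E) (t y : ℝ) (w : W) {τ : ℝ}
    (hτ : 0 < τ) : ‖amplitude q b s φ ξ ν (τ, w) * Complex.exp (phase b ξ ν (τ, w) ((X, t), y))‖ ≤
      ‖φ w‖ * invGamma s y τ := by
  have hre : (phase b ξ ν (τ, w) ((X, t), y)).re = -y / τ := by
    rw [phase_apply, div_eq_mul_inv]
    simp [mul_comm]
  rw [norm_mul, norm_amplitude q b s φ ξ ν hτ, Complex.norm_exp, hre, invGamma]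
  have he : Real.exp (-(4 * Real.pi ^ 2) * covForm q b τ (ξ w)) ≤ 1 := by
    rw [Real.exp_le_one_iff]
    have := covForm_nonneg hq b hτ.le (ξ w)
    have : 0 ≤ 4 * Real.pi ^ 2 * covForm q b τ (ξ w) := by positivity
    linarith
  calc _ ≤ ‖φ w‖ * (τ ^ (-1 - s) * 1) * Real.exp (-y / τ) := by gcongr
    _ = _ := by ring

/-- The integrand is an exact derivative in `τ`, and the wave vanishes at both ends because it is
dominated by the inverse Gamma density. -/
theorem integral_wave_mul_symbol {q : E →L[ℝ] E} (hq : ∀ x, 0 ≤ inner ℝ x (q x))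
    (b : E →L[ℝ] E) {s : ℝ} (hs : 0 < s) (φ : 𝓢(W, ℂ)) (ξ : W →L[ℝ] E) (ν : W →L[ℝ] ℝ) (X : E)
    (t : ℝ) {y : ℝ} (hy : 0 < y) (w : W) :
    ∫ τ in Ioi (0 : ℝ), amplitude q b s φ ξ ν (τ, w) *
      Complex.exp (phase b ξ ν (τ, w) ((X, t), y)) * symbol q b s ξ ν X y (τ, w) = 0 := by
  -- Without integrability the integral is zero by convention, so no hypothesis is needed here.
  by_cases hint : IntegrableOn (fun τ => amplitude q b s φ ξ ν (τ, w) *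
      Complex.exp (phase b ξ ν (τ, w) ((X, t), y)) * symbol q b s ξ ν X y (τ, w)) (Ioi 0)
  swap
  · exact integral_undef hint
  -- The conventional value of `0` raised to the nonzero power `-1-s` is `0`, which agrees with the
  -- limit from the right.
  have h0 : amplitude q b s φ ξ ν (0, w) * Complex.exp (phase b ξ ν (0, w) ((X, t), y)) = 0 := by
    simp [amplitude, Real.zero_rpow (by linarith : -1 - s ≠ 0)]
  have h1 : ∀ τ ∈ Ici (0 : ℝ), ‖amplitude q b s φ ξ ν (τ, w) *
      Complex.exp (phase b ξ ν (τ, w) ((X, t), y))‖ ≤ ‖φ w‖ * invGamma s y τ := by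
    intro τ hτ
    rcases eq_or_lt_of_le (mem_Ici.1 hτ) with rfl | hτ
    · rw [h0, invGamma_zero_right hs]
      simp
    · exact norm_wave_le hq b s φ ξ ν X t y w hτ
  have hcont : ContinuousWithinAt (fun τ => amplitude q b s φ ξ ν (τ, w) *
      Complex.exp (phase b ξ ν (τ, w) ((X, t), y))) (Ici 0) 0 := by
    rw [← continuousWithinAt_Ioi_iff_Ici, ContinuousWithinAt, h0]
    have h2 := (tendsto_invGamma_nhdsGT_zero (s := s) hy).const_mul ‖φ w‖
    rw [mul_zero] at h2
    refine squeeze_zero_norm' ?_ h2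
    filter_upwards [self_mem_nhdsWithin] with τ hτ using h1 τ (mem_Ioi.1 hτ).le
  have htop : Tendsto (fun τ => amplitude q b s φ ξ ν (τ, w) *
      Complex.exp (phase b ξ ν (τ, w) ((X, t), y))) atTop (𝓝 0) := by
    have h2 := (tendsto_invGamma_atTop hs hy).const_mul ‖φ w‖
    rw [mul_zero] at h2
    refine squeeze_zero_norm' ?_ h2
    filter_upwards [eventually_ge_atTop 0] with τ hτ using h1 τ hτ
  rw [integral_Ioi_of_hasDerivAt_of_tendsto hcont
    (fun τ hτ => hasDerivAt_wave q b s φ ξ ν X t y w hτ) hint htop, h0, sub_zero]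

variable [FiniteDimensional ℝ W] [MeasurableSpace W] [BorelSpace W]

theorem expIntegral_amplitude_mul_symbol {q : E →L[ℝ] E} (hq : ∀ x, 0 ≤ inner ℝ x (q x))
    (b : E →L[ℝ] E) {s : ℝ} (hs : 0 < s) (φ : 𝓢(W, ℂ)) (ξ : W →L[ℝ] E) (ν : W →L[ℝ] ℝ) (X : E)
    (t : ℝ) {y : ℝ} (hy : 0 < y)
    (hint : Integrable (fun r : ℝ × W => amplitude q b s φ ξ ν r *
      Complex.exp (phase b ξ ν r ((X, t), y)) * symbol q b s ξ ν X y r)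
      ((volume.restrict (Ioi (0 : ℝ))).prod volume)) :
    ∫ r, amplitude q b s φ ξ ν r * Complex.exp (phase b ξ ν r ((X, t), y)) *
      symbol q b s ξ ν X y r ∂((volume.restrict (Ioi (0 : ℝ))).prod volume) = 0 := by
  rw [integral_prod_symm _ hint]
  simp only [integral_wave_mul_symbol hq b hs φ ξ ν X t hy, integral_zero]

end PlaneWaves

/-! ### Reduction of real or complex data to complex data -/

section ScalarField

variable {𝕜 : Type*} [RCLike 𝕜] {N : ℕ}

theorem map_map_complex (x : 𝕜) : RCLike.map ℂ 𝕜 (RCLike.map 𝕜 ℂ x) = x := by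
  simp only [RCLike.map_apply]
  simp

/-- A Lipschitz left inverse makes the embedding antilipschitz, so it commutes with the integral
even of non-integrable functions. -/
theorem integral_map_complex {α : Type*} [MeasurableSpace α] (μ : Measure α) (f : α → 𝕜) :
    ∫ x, RCLike.map 𝕜 ℂ (f x) ∂μ = RCLike.map 𝕜 ℂ (∫ x, f x ∂μ) :=
  (RCLike.map 𝕜 ℂ).integral_comp_comm'
    ((RCLike.map ℂ 𝕜).lipschitz.to_rightInverse map_map_complex) f

theorem map_extension (Q B : Matrix (Fin N) (Fin N) ℝ) (a : ℝ) (u : Sp N × ℝ → 𝕜)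
    (P : Sp N × ℝ) (z : ℝ) :
    RCLike.map 𝕜 ℂ (extension Q B a u P z) =
      extension Q B a (fun P => RCLike.map 𝕜 ℂ (u P)) P z := by
  simp only [extension, ← integral_map_complex, map_smul]

end ScalarField

theorem isOpen_lt_snd {F : Type*} [TopologicalSpace F] (y : ℝ) : IsOpen {x : F × ℝ | y < x.2} :=
  isOpen_lt continuous_const continuous_snd

/-! ### Calculus of wave integrals on the half-space -/

section PlaneWaves

variable {E : Type*} [NormedAddCommGroup E] [InnerProductSpace ℝ E] [FiniteDimensional ℝ E]
  {W : Type*} [NormedAddCommGroup W] [InnerProductSpace ℝ W] [FiniteDimensional ℝ W]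
  [MeasurableSpace W] [BorelSpace W] {b : E →L[ℝ] E} {ξ : W →L[ℝ] E} {ν : W →L[ℝ] ℝ}

/-- Superposition of the plane waves `e^{phase}` with amplitude `A`. -/
noncomputable def waveIntegral (b : E →L[ℝ] E) (ξ : W →L[ℝ] E) (ν : W →L[ℝ] ℝ)
    (A : ℝ × W → ℂ) : (E × ℝ) × ℝ → ℂ :=
  expIntegral ((volume.restrict (Ioi (0 : ℝ))).prod volume) (phase b ξ ν) A

/-- Amplitudes with finite moments against `e^{-y/τ}` for every `y > 0`. -/
def IsAmplitude (b : E →L[ℝ] E) (ξ : W →L[ℝ] E) (ν : W →L[ℝ] ℝ) (A : ℝ × W → ℂ) : Prop :=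
  ∀ y : ℝ, 0 < y → HasMoments ((volume.restrict (Ioi (0 : ℝ))).prod volume) (phase b ξ ν)
    (fun r => -y / r.1) A

theorem aestronglyMeasurable_neg_div_fst (y : ℝ) :
    AEStronglyMeasurable (fun r : ℝ × W => -y / r.1)
      ((volume.restrict (Ioi (0 : ℝ))).prod volume) :=
  (measurable_const.div measurable_fst).aestronglyMeasurable

theorem IsAmplitude.mul_phase {A : ℝ × W → ℂ} (hA : IsAmplitude b ξ ν A) (v : (E × ℝ) × ℝ) :
    IsAmplitude b ξ ν fun r => A r * phase b ξ ν r v := fun y hy =>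
  (hA y hy).mul_apply (stronglyMeasurable_phase b ξ ν).aestronglyMeasurable
    (aestronglyMeasurable_neg_div_fst y) v

theorem IsAmplitude.integrable {A : ℝ × W → ℂ} (hA : IsAmplitude b ξ ν A) {x : (E × ℝ) × ℝ}
    (hx : 0 < x.2) : Integrable (fun r => A r * Complex.exp (phase b ξ ν r x))
      ((volume.restrict (Ioi (0 : ℝ))).prod volume) :=
  (hA (x.2 / 2) (half_pos hx)).integrable_exp
    (stronglyMeasurable_phase b ξ ν).aestronglyMeasurable (re_phase_le b ξ ν _)
    (show x.2 / 2 < x.2 from half_lt_self hx)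

/-- Smoothness is local: around a point of height `y`, the exponent `-(y/2)/τ` dominates the real
part of the phase on the half-space above `y/2`. -/
theorem IsAmplitude.contDiffOn {A : ℝ × W → ℂ} (hA : IsAmplitude b ξ ν A) :
    ContDiffOn ℝ ∞ (waveIntegral b ξ ν A) {x | 0 < x.2} := by
  intro x hx
  have hx : 0 < x.2 := hx
  refine ContDiffAt.contDiffWithinAt ?_
  exact (HasMoments.contDiffOn (stronglyMeasurable_phase b ξ ν).aestronglyMeasurable
    (aestronglyMeasurable_neg_div_fst _) (re_phase_le b ξ ν (x.2 / 2)) (isOpen_lt_snd _)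
    (hA (x.2 / 2) (half_pos hx))).contDiffAt
    ((isOpen_lt_snd _).mem_nhds (show x.2 / 2 < x.2 from half_lt_self hx))

theorem IsAmplitude.differentiableAt {A : ℝ × W → ℂ} (hA : IsAmplitude b ξ ν A)
    {x : (E × ℝ) × ℝ} (hx : 0 < x.2) : DifferentiableAt ℝ (waveIntegral b ξ ν A) x :=
  (hA.contDiffOn.contDiffAt ((isOpen_lt_snd 0).mem_nhds hx)).differentiableAt (by simp)

theorem IsAmplitude.fderiv_apply {A : ℝ × W → ℂ} (hA : IsAmplitude b ξ ν A)
    {x : (E × ℝ) × ℝ} (hx : 0 < x.2) (v : (E × ℝ) × ℝ) :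
    fderiv ℝ (waveIntegral b ξ ν A) x v =
      waveIntegral b ξ ν (fun r => A r * phase b ξ ν r v) x :=
  (hA (x.2 / 2) (half_pos hx)).fderiv_apply
    (stronglyMeasurable_phase b ξ ν).aestronglyMeasurable (re_phase_le b ξ ν _)
    (isOpen_lt_snd _) (show x.2 / 2 < x.2 from half_lt_self hx) v

theorem isAmplitude_amplitude {q : E →L[ℝ] E} (hq : ∀ x, 0 ≤ inner ℝ x (q x)) (b : E →L[ℝ] E)
    (hpos : ∀ ξ, ξ ≠ 0 → 0 < covForm q b 1 ξ) {s : ℝ} (hs : 0 < s) (φ : 𝓢(W, ℂ))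
    (ξ : W →L[ℝ] E) (ν : W →L[ℝ] ℝ) : IsAmplitude b ξ ν (amplitude q b s φ ξ ν) := fun _ hy =>
  hasMoments_amplitude hq b hpos hs φ ξ ν hy

variable {𝕜 : Type*} [RCLike 𝕜] (ρ : ℂ →L[ℝ] 𝕜)

theorem IsAmplitude.fderiv_space {A : ℝ × W → ℂ} (hA : IsAmplitude b ξ ν A) (c : ℝ) (X : E)
    (t : ℝ) {y : ℝ} (hy : 0 < y) (v : E) :
    fderiv ℝ (fun X => c • ρ (waveIntegral b ξ ν A ((X, t), y))) X v =
      c • ρ (waveIntegral b ξ ν (fun r => A r * phase b ξ ν r ((v, 0), 0)) ((X, t), y)) := by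
  have h1 : HasFDerivAt (fun X : E => ((X, t), y))
      (ContinuousLinearMap.inl ℝ (E × ℝ) ℝ ∘L ContinuousLinearMap.inl ℝ E ℝ) X := by
    exact (HasFDerivAt.prodMk (𝕜 := ℝ) (hasFDerivAt_id X) (hasFDerivAt_const t X)).prodMk
      (hasFDerivAt_const y X)
  have h2 := (hA.differentiableAt (x := ((X, t), y)) hy).hasFDerivAt
  have h3 := ((ρ.hasFDerivAt.comp X (h2.comp X h1)).const_smul c)
  have h4 := h3.fderiv
  have h5 := congrArg (fun T => T v) h4
  refine Eq.trans h5 ?_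
  rw [← hA.fderiv_apply (x := ((X, t), y)) hy]
  rfl

theorem IsAmplitude.deriv_time {A : ℝ × W → ℂ} (hA : IsAmplitude b ξ ν A) (c : ℝ) (X : E)
    (t : ℝ) {y : ℝ} (hy : 0 < y) :
    deriv (fun t => c • ρ (waveIntegral b ξ ν A ((X, t), y))) t =
      c • ρ (waveIntegral b ξ ν (fun r => A r * phase b ξ ν r ((0, 1), 0)) ((X, t), y)) := by
  have h1 : HasDerivAt (fun t : ℝ => ((X, t), y)) ((0, 1), 0) t :=
    ((hasDerivAt_const t X).prodMk (hasDerivAt_id t)).prodMk (hasDerivAt_const t y)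
  have h2 := (hA.differentiableAt (x := ((X, t), y)) hy).hasFDerivAt
  have h3 := (ρ.hasFDerivAt.comp_hasDerivAt t (h2.comp_hasDerivAt t h1)).const_smul c
  rw [hA.fderiv_apply (x := ((X, t), y)) hy] at h3
  exact h3.deriv

theorem IsAmplitude.hasDerivAt_height {A : ℝ × W → ℂ} (hA : IsAmplitude b ξ ν A) (P : E × ℝ)
    {y : ℝ} (hy : 0 < y) :
    HasDerivAt (fun y => ρ (waveIntegral b ξ ν A (P, y)))
      (ρ (waveIntegral b ξ ν (fun r => A r * phase b ξ ν r ((0, 0), 1)) (P, y))) y := by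
  have h1 : HasDerivAt (fun y : ℝ => (P, y)) ((0, 0), 1) y :=
    (hasDerivAt_const y P).prodMk (hasDerivAt_id y)
  have h2 := (hA.differentiableAt (x := (P, y)) hy).hasFDerivAt
  have h3 := ρ.hasFDerivAt.comp_hasDerivAt y (h2.comp_hasDerivAt y h1)
  rw [hA.fderiv_apply (x := (P, y)) hy] at h3
  exact h3

/-- The Bessel operator `∂_z² + (1-2s)/z ∂_z` in the variable `y = z²/4`. -/
theorem bessel_rpow_smul {G : Type*} [NormedAddCommGroup G] [NormedSpace ℝ G] {V V' V'' : ℝ → G}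
    (hV : ∀ y, 0 < y → HasDerivAt V (V' y) y) (hV' : ∀ y, 0 < y → HasDerivAt V' (V'' y) y)
    (c s : ℝ) {z : ℝ} (hz : 0 < z) :
    deriv (deriv fun z => (c * z ^ (2 * s)) • V (z ^ 2 / 4)) z +
        ((1 - 2 * s) / z) • deriv (fun z => (c * z ^ (2 * s)) • V (z ^ 2 / 4)) z =
      (c * z ^ (2 * s)) • ((1 + s) • V' (z ^ 2 / 4) + (z ^ 2 / 4) • V'' (z ^ 2 / 4)) := by
  have hsq : ∀ z : ℝ, HasDerivAt (fun z : ℝ => z ^ 2 / 4) (z / 2) z := fun z =>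
    ((hasDerivAt_pow 2 z).div_const 4).congr_deriv (by push_cast; ring)
  have hcomp : ∀ {f f' : ℝ → G}, (∀ y, 0 < y → HasDerivAt f (f' y) y) → ∀ z : ℝ, 0 < z →
      HasDerivAt (fun z => f (z ^ 2 / 4)) ((z / 2) • f' (z ^ 2 / 4)) z := fun hf z hz =>
    HasDerivAt.scomp z (hf _ (by positivity)) (hsq z)
  have hpow : ∀ p z : ℝ, 0 < z → HasDerivAt (fun z : ℝ => z ^ p) (p * z ^ (p - 1)) z :=
    fun p z hz => Real.hasDerivAt_rpow_const (Or.inl hz.ne')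
  have h1 : ∀ z : ℝ, 0 < z → HasDerivAt (fun z => (c * z ^ (2 * s)) • V (z ^ 2 / 4))
      ((c * (2 * s) * z ^ (2 * s - 1)) • V (z ^ 2 / 4) +
        (c / 2 * z ^ (2 * s + 1)) • V' (z ^ 2 / 4)) z := by
    intro z hz
    refine (((hpow (2 * s) z hz).const_mul c).smul (hcomp hV z hz)).congr_deriv ?_
    rw [smul_smul, Real.rpow_add_one hz.ne', add_comm]
    congr 2 <;> ring
  have h2 : deriv (fun z => (c * z ^ (2 * s)) • V (z ^ 2 / 4)) =ᶠ[𝓝 z] fun z =>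
      (c * (2 * s) * z ^ (2 * s - 1)) • V (z ^ 2 / 4) +
        (c / 2 * z ^ (2 * s + 1)) • V' (z ^ 2 / 4) := by
    filter_upwards [lt_mem_nhds hz] with x hx using (h1 x hx).deriv
  rw [h2.deriv_eq, (h1 z hz).deriv]
  have h3 := (((hpow (2 * s - 1) z hz).const_mul (c * (2 * s))).smul (hcomp hV z hz)).add
    (((hpow (2 * s + 1) z hz).const_mul (c / 2)).smul (hcomp hV' z hz))
  have h4 := h3.deriv
  refine (congrArg₂ (· + ·) h4 rfl).trans ?_
  have e1 : z ^ (2 * s + 1) = z ^ (2 * s) * z := Real.rpow_add_one hz.ne' _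
  have e2 : z ^ (2 * s - 1) = z ^ (2 * s) / z := Real.rpow_sub_one hz.ne' _
  have e3 : z ^ (2 * s - 1 - 1) = z ^ (2 * s) / z / z := by
    rw [Real.rpow_sub_one hz.ne', e2]
  have e4 : 2 * s + 1 - 1 = 2 * s := by ring
  rw [e4, e3, e2, e1]
  match_scalars <;> field_simp <;> ring

end PlaneWaves

/-! ### The extension as a wave integral and the equation it satisfies -/

section Extension

variable {N n : ℕ} {Q B : Matrix (Fin N) (Fin N) ℝ} {s a : ℝ}

theorem inner_matCLM_self_nonneg (hQ : Q.PosSemidef) (x : Sp N) :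
    0 ≤ inner ℝ x (matCLM Q x) := by
  rw [inner_matCLM]
  simpa using hQ.dotProduct_mulVec_nonneg x.ofLp

/-- The Gaussian average replaces the frequency `ξ` by `e^{τB^⋆}ξ` and damps by the characteristic
function of the noise; the density supplies `τ^{-1-s}` and the real part `-y/τ` of the phase. -/
theorem evolSemigroup_fourier (hK : ∀ t : ℝ, 0 < t → (covMatrix Q B t).PosDef) {τ : ℝ}
    (hτ : 0 < τ) {u : Sp N × ℝ → ℂ} {φ : 𝓢(Sp n, ℂ)} {ξ : Sp n →L[ℝ] Sp N} {ν : Sp n →L[ℝ] ℝ}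
    (hu : ∀ (X : Sp N) (t : ℝ), u (X, t) = ∫ w, φ w *
      Complex.exp (Complex.I * (2 * Real.pi * (inner ℝ (ξ w) X + ν w * t) : ℝ)))
    (X : Sp N) (t y : ℝ) :
    invGamma s y τ • evolSemigroup Q B τ u (X, t) =
      ∫ w, amplitude (matCLM Q) (matCLM B) s φ ξ ν (τ, w) *
        Complex.exp (phase (matCLM B) ξ ν (τ, w) ((X, t), y)) := by
  rw [evolSemigroup_eq hK hτ]
  simp only [hu]
  rw [integral_gauss_smul_fourier, ← integral_smul]
  congr 1
  funext w
  have e1 : Complex.exp ((-(2 * Real.pi * (ν w * τ)) : ℝ) * Complex.I) *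
      Complex.exp (phase (matCLM B) ξ ν (τ, w) ((X, t), y)) =
      Complex.exp (Complex.I *
        (2 * Real.pi * (inner ℝ (ξ w) (flow (matCLM B) τ X) + ν w * (t - τ)) : ℝ)) *
      Complex.exp ((-y / τ : ℝ) : ℂ) := by
    rw [← Complex.exp_add, ← Complex.exp_add, phase_apply, inner_coflow, div_eq_mul_inv]
    congr 1
    push_cast
    ring
  rw [norm_adjoint_noise_sq hK hτ]
  simp only [amplitude, invGamma]
  rw [mul_assoc (φ w * _), ← Complex.ofReal_neg (2 * Real.pi * (ν w * τ)), e1,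
    Complex.real_smul]
  have e2 : Real.pi ^ 2 * (4 * covForm (matCLM Q) (matCLM B) τ (ξ w)) =
      4 * Real.pi ^ 2 * covForm (matCLM Q) (matCLM B) τ (ξ w) := by ring
  rw [e2, ← Complex.ofReal_neg, ← neg_mul]
  push_cast
  ring

theorem extension_eq_waveIntegral (hQ : Q.PosSemidef)
    (hK : ∀ t : ℝ, 0 < t → (covMatrix Q B t).PosDef) (hs : 0 < s) (ha : a = 1 - 2 * s)
    {u : Sp N × ℝ → ℂ} {φ : 𝓢(Sp n, ℂ)} {ξ : Sp n →L[ℝ] Sp N} {ν : Sp n →L[ℝ] ℝ}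
    (hu : ∀ (X : Sp N) (t : ℝ), u (X, t) = ∫ w, φ w *
      Complex.exp (Complex.I * (2 * Real.pi * (inner ℝ (ξ w) X + ν w * t) : ℝ)))
    (P : Sp N × ℝ) {z : ℝ} (hz : 0 < z) :
    extension Q B a u P z = ((2 ^ (2 * s) * Real.Gamma s)⁻¹ * z ^ (2 * s)) •
      waveIntegral (matCLM B) ξ ν (amplitude (matCLM Q) (matCLM B) s φ ξ ν) (P, z ^ 2 / 4) := by
  have hA := isAmplitude_amplitude (inner_matCLM_self_nonneg hQ) (matCLM B)
    (fun _ => covForm_pos hK one_pos) hs φ ξ ν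
  rw [extension_eq ha, waveIntegral, expIntegral,
    integral_prod _ (hA.integrable (x := (P, z ^ 2 / 4)) (by positivity)), ← integral_smul]
  refine setIntegral_congr_fun measurableSet_Ioi fun τ hτ => ?_
  obtain ⟨X, t⟩ := P
  simp only [poissonWeight]
  rw [mul_smul, evolSemigroup_fourier hK hτ hu]

theorem exists_extension_eq_waveIntegral {𝕜 : Type*} [RCLike 𝕜] (hQ : Q.PosSemidef)
    (hK : ∀ t : ℝ, 0 < t → (covMatrix Q B t).PosDef) (hs : 0 < s) (ha : a = 1 - 2 * s)
    (u : 𝓢(Sp N × ℝ, 𝕜)) :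
    ∃ (n : ℕ) (φ : 𝓢(Sp n, ℂ)) (ξ : Sp n →L[ℝ] Sp N) (ν : Sp n →L[ℝ] ℝ),
      ∀ (P : Sp N × ℝ) (z : ℝ), 0 < z → extension Q B a u P z =
        ((2 ^ (2 * s) * Real.Gamma s)⁻¹ * z ^ (2 * s)) • RCLike.map ℂ 𝕜
          (waveIntegral (matCLM B) ξ ν (amplitude (matCLM Q) (matCLM B) s φ ξ ν)
            (P, z ^ 2 / 4)) := by
  obtain ⟨n, φ, ξ, ν, hu⟩ :=
    exists_fourier_representation (SchwartzMap.postcompCLM (RCLike.map 𝕜 ℂ) u)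
  refine ⟨n, φ, ξ, ν, fun P z hz => ?_⟩
  rw [← map_map_complex (extension Q B a u P z), map_extension]
  exact (congrArg _ (extension_eq_waveIntegral hQ hK hs ha hu P hz)).trans (map_smul _ _ _)

/-- In coordinates every term is a product of values of the phase at basis vectors, that is, the
result of iterated differentiation; the minus sign of the quadratic part is `I²`. -/
theorem symbol_eq_sum (ξ : Sp n →L[ℝ] Sp N) (ν : Sp n →L[ℝ] ℝ) (X : Sp N) (y : ℝ)
    (r : ℝ × Sp n) :
    symbol (matCLM Q) (matCLM B) s ξ ν X y r =
      (∑ i, ∑ j, (Q i j : ℂ) * (phase (matCLM B) ξ ν r ((EuclideanSpace.single i 1, 0), 0) *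
          phase (matCLM B) ξ ν r ((EuclideanSpace.single j 1, 0), 0))) +
        (∑ i, ((B *ᵥ X.ofLp) i : ℂ) *
          phase (matCLM B) ξ ν r ((EuclideanSpace.single i 1, 0), 0)) -
        phase (matCLM B) ξ ν r ((0, 1), 0) + (1 + s) * phase (matCLM B) ξ ν r ((0, 0), 1) +
        y * (phase (matCLM B) ξ ν r ((0, 0), 1) * phase (matCLM B) ξ ν r ((0, 0), 1)) := by
  obtain ⟨τ, w⟩ := r
  have hsingle : ∀ i, phase (matCLM B) ξ ν (τ, w) ((EuclideanSpace.single i 1, 0), 0) =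
      2 * Real.pi * Complex.I * ((coflow (matCLM B) τ (ξ w)).ofLp i : ℝ) := by
    intro i
    rw [phase_apply, EuclideanSpace.inner_single_right]
    simp
  have h1 : -((4 * Real.pi ^ 2 * inner ℝ (coflow (matCLM B) τ (ξ w))
      (matCLM Q (coflow (matCLM B) τ (ξ w))) : ℝ) : ℂ) =
      ∑ i, ∑ j, (Q i j : ℂ) * (phase (matCLM B) ξ ν (τ, w) ((EuclideanSpace.single i 1, 0), 0) *
          phase (matCLM B) ξ ν (τ, w) ((EuclideanSpace.single j 1, 0), 0)) := by
    simp only [hsingle, inner_matCLM, dotProduct, Matrix.mulVec]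
    push_cast
    simp only [Finset.mul_sum, ← Finset.sum_neg_distrib]
    refine Finset.sum_congr rfl fun i _ => Finset.sum_congr rfl fun j _ => ?_
    linear_combination (4 * Real.pi ^ 2 * (Q i j : ℂ) *
      ((coflow (matCLM B) τ (ξ w)).ofLp i : ℝ) *
      ((coflow (matCLM B) τ (ξ w)).ofLp j : ℝ)) * (-Complex.I_sq)
  have h2 : phase (matCLM B) ξ ν (τ, w) ((matCLM B X, 0), 0) = ∑ i, ((B *ᵥ X.ofLp) i : ℂ) *
      phase (matCLM B) ξ ν (τ, w) ((EuclideanSpace.single i 1, 0), 0) := by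
    simp only [hsingle, phase_apply, inner_eq_dotProduct, ofLp_matCLM, dotProduct]
    push_cast
    simp only [mul_zero, add_zero, sub_zero, Finset.mul_sum]
    exact Finset.sum_congr rfl fun i _ => by ring
  simp only [symbol]
  rw [h1, h2]

theorem integral_linear_combination {α ι : Type*} [MeasurableSpace α] {μ : Measure α} [Fintype ι]
    (c : ι → ι → ℝ) (d : ι → ℝ) (k l : ℝ) {F : ι → ι → α → ℂ} {G : ι → α → ℂ} {f g h : α → ℂ}
    (hF : ∀ i j, Integrable (F i j) μ) (hG : ∀ i, Integrable (G i) μ) (hf : Integrable f μ)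
    (hg : Integrable g μ) (hh : Integrable h μ) :
    Integrable (fun r => (∑ i, ∑ j, c i j • F i j r) + (∑ i, d i • G i r) - f r + k • g r +
      l • h r) μ ∧
    ∫ r, (∑ i, ∑ j, c i j • F i j r) + (∑ i, d i • G i r) - f r + k • g r + l • h r ∂μ =
      (∑ i, ∑ j, c i j • ∫ r, F i j r ∂μ) + (∑ i, d i • ∫ r, G i r ∂μ) - ∫ r, f r ∂μ +
        k • ∫ r, g r ∂μ + l • ∫ r, h r ∂μ := by
  have hF' : ∀ i j, Integrable (fun r => c i j • F i j r) μ := fun i j => (hF i j).smul (c i j)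
  have hG' : ∀ i, Integrable (fun r => d i • G i r) μ := fun i => (hG i).smul (d i)
  have j0 : ∀ i, Integrable (fun r => ∑ j, c i j • F i j r) μ := fun i =>
    integrable_finsetSum _ fun j _ => hF' i j
  have j1 : Integrable (fun r => ∑ i, ∑ j, c i j • F i j r) μ :=
    integrable_finsetSum _ fun i _ => j0 i
  have j2 : Integrable (fun r => ∑ i, d i • G i r) μ := integrable_finsetSum _ fun i _ => hG' i
  have j3 : Integrable (fun r => k • g r) μ := hg.smul k
  have j4 : Integrable (fun r => l • h r) μ := hh.smul l
  have k1 : Integrable (fun r => (∑ i, ∑ j, c i j • F i j r) + ∑ i, d i • G i r) μ := j1.add j2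
  have k2 : Integrable (fun r => (∑ i, ∑ j, c i j • F i j r) + (∑ i, d i • G i r) - f r) μ :=
    k1.sub hf
  have k3 : Integrable (fun r => (∑ i, ∑ j, c i j • F i j r) + (∑ i, d i • G i r) - f r +
    k • g r) μ := k2.add j3
  refine ⟨k3.add j4, ?_⟩
  rw [integral_add k3 j4, integral_add k2 j3, integral_sub k1 hf, integral_add j1 j2, integral_smul, integral_smul,
    integral_finsetSum _ fun i _ => j0 i, integral_finsetSum _ fun i _ => hG' i]
  simp only [integral_finsetSum _ fun j _ => hF' _ j, integral_smul]

/-- Each summand is a derivative of the wave integral, and by linearity their sum is the integral of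
wave times symbol, which vanishes by integrating in `τ` first. -/
theorem waveIntegral_equation (hQ : Q.PosSemidef)
    (hK : ∀ t : ℝ, 0 < t → (covMatrix Q B t).PosDef) (hs : 0 < s) (φ : 𝓢(Sp n, ℂ))
    (ξ : Sp n →L[ℝ] Sp N) (ν : Sp n →L[ℝ] ℝ) {A : ℝ × Sp n → ℂ}
    (hAdef : A = amplitude (matCLM Q) (matCLM B) s φ ξ ν) {L : ℝ × Sp n → (Sp N × ℝ) × ℝ →L[ℝ] ℂ}
    (hL : L = phase (matCLM B) ξ ν) (X : Sp N) (t : ℝ) {y : ℝ} (hy : 0 < y) :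
    (∑ i, ∑ j, Q i j • waveIntegral (matCLM B) ξ ν
        (fun r => A r * L r ((EuclideanSpace.single i 1, 0), 0) *
          L r ((EuclideanSpace.single j 1, 0), 0)) ((X, t), y)) +
      (∑ i, (B *ᵥ X.ofLp) i • waveIntegral (matCLM B) ξ ν
        (fun r => A r * L r ((EuclideanSpace.single i 1, 0), 0)) ((X, t), y)) -
      waveIntegral (matCLM B) ξ ν (fun r => A r * L r ((0, 1), 0)) ((X, t), y) +
      (1 + s) • waveIntegral (matCLM B) ξ ν (fun r => A r * L r ((0, 0), 1)) ((X, t), y) +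
      y • waveIntegral (matCLM B) ξ ν
        (fun r => A r * L r ((0, 0), 1) * L r ((0, 0), 1)) ((X, t), y) = 0 := by
  have hA : IsAmplitude (matCLM B) ξ ν A := hAdef ▸
    isAmplitude_amplitude (inner_matCLM_self_nonneg hQ) (matCLM B)
      (fun _ => covForm_pos hK one_pos) hs φ ξ ν
  have i1 : ∀ v, Integrable (fun r => A r * L r v * Complex.exp (L r ((X, t), y)))
      ((volume.restrict (Ioi (0 : ℝ))).prod volume) := fun v => by
    subst hL
    exact (hA.mul_phase v).integrable (x := ((X, t), y)) hy
  have i2 : ∀ v v', Integrable (fun r => A r * L r v * L r v' * Complex.exp (L r ((X, t), y)))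
      ((volume.restrict (Ioi (0 : ℝ))).prod volume) := fun v v' => by
    subst hL
    exact ((hA.mul_phase v).mul_phase v').integrable (x := ((X, t), y)) hy
  have hpt : ∀ r, A r * Complex.exp (L r ((X, t), y)) *
      symbol (matCLM Q) (matCLM B) s ξ ν X y r =
      (∑ i, ∑ j, Q i j • (A r * L r ((EuclideanSpace.single i 1, 0), 0) *
          L r ((EuclideanSpace.single j 1, 0), 0) * Complex.exp (L r ((X, t), y)))) +
      (∑ i, (B *ᵥ X.ofLp) i • (A r * L r ((EuclideanSpace.single i 1, 0), 0) *
        Complex.exp (L r ((X, t), y)))) -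
      A r * L r ((0, 1), 0) * Complex.exp (L r ((X, t), y)) +
      (1 + s) • (A r * L r ((0, 0), 1) * Complex.exp (L r ((X, t), y))) +
      y • (A r * L r ((0, 0), 1) * L r ((0, 0), 1) * Complex.exp (L r ((X, t), y))) := by
    intro r
    rw [symbol_eq_sum, ← hL]
    simp only [mul_add, mul_sub, Finset.mul_sum, Complex.real_smul]
    congr 1
    · congr 1
      · congr 1
        · congr 1
          · exact Finset.sum_congr rfl fun i _ => Finset.sum_congr rfl fun j _ => by ring
          · exact Finset.sum_congr rfl fun i _ => by ring
        · ring
      · push_cast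
        ring
    · ring
  obtain ⟨hint, heq⟩ := integral_linear_combination Q (B *ᵥ X.ofLp) (1 + s) y
    (fun i j => i2 ((EuclideanSpace.single i 1, 0), 0) ((EuclideanSpace.single j 1, 0), 0))
    (fun i => i1 ((EuclideanSpace.single i 1, 0), 0)) (i1 ((0, 1), 0)) (i1 ((0, 0), 1))
    (i2 ((0, 0), 1) ((0, 0), 1))
  simp only [← hpt] at hint heq
  have hzero := expIntegral_amplitude_mul_symbol (inner_matCLM_self_nonneg hQ) (matCLM B) hs φ ξ
    ν X t hy (by rwa [← hAdef, ← hL])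
  rw [← hAdef, ← hL, heq] at hzero
  subst hL
  exact hzero

end Extension

/-! ### Smoothness of the extension and the degenerate equation -/

section Extension

variable {N : ℕ} {𝕜 : Type*} [RCLike 𝕜] {Q B : Matrix (Fin N) (Fin N) ℝ} {s a : ℝ}

theorem contDiffOn_extension (hQ : Q.PosSemidef)
    (hK : ∀ t : ℝ, 0 < t → (covMatrix Q B t).PosDef) (hs : 0 < s) (ha : a = 1 - 2 * s)
    (u : 𝓢(Sp N × ℝ, 𝕜)) :
    ContDiffOn ℝ ∞ (fun q : (Sp N × ℝ) × ℝ => extension Q B a u q.1 q.2)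
      (univ ×ˢ Ioi (0 : ℝ)) := by
  obtain ⟨n, φ, ξ, ν, hu⟩ := exists_extension_eq_waveIntegral hQ hK hs ha u
  have hA := isAmplitude_amplitude (inner_matCLM_self_nonneg hQ) (matCLM B)
    (fun _ => covForm_pos hK one_pos) hs φ ξ ν
  have h1 : ContDiffOn ℝ ∞ (fun q : (Sp N × ℝ) × ℝ => (q.1, q.2 ^ 2 / 4))
      (univ ×ˢ Ioi (0 : ℝ)) :=
    (contDiff_fst.prodMk ((contDiff_snd.pow 2).div_const 4)).contDiffOn
  have hpos : ∀ q ∈ (univ ×ˢ Ioi (0 : ℝ) : Set ((Sp N × ℝ) × ℝ)), 0 < q.2 := fun q hq => hq.2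
  have h2 := hA.contDiffOn.comp h1 (fun q hq => by
    have := hpos q hq
    show 0 < q.2 ^ 2 / 4
    positivity)
  have h3 := (RCLike.map ℂ 𝕜).contDiff.comp_contDiffOn h2
  have h4 : ContDiffOn ℝ ∞ (fun q : (Sp N × ℝ) × ℝ =>
      (2 ^ (2 * s) * Real.Gamma s)⁻¹ * q.2 ^ (2 * s)) (univ ×ˢ Ioi (0 : ℝ)) :=
    contDiffOn_const.mul (contDiffOn_snd.rpow_const_of_ne fun q hq => (hpos q hq).ne')
  exact (h4.smul h3).congr fun q hq => hu q.1 q.2 (hpos q hq)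

/-- Factoring out `c z^{2s}` and passing to `y = z²/4` turns the Bessel operator into `(1+s)∂_y +
y∂_y²`, so the equation becomes the one for the wave integral. -/
theorem opKa_extension (hQ : Q.PosSemidef)
    (hK : ∀ t : ℝ, 0 < t → (covMatrix Q B t).PosDef) (hs : 0 < s) (ha : a = 1 - 2 * s)
    (u : 𝓢(Sp N × ℝ, 𝕜)) (P : Sp N × ℝ) {z : ℝ} (hz : 0 < z) :
    opKa Q B a (extension Q B a u) P z = 0 := by
  obtain ⟨n, φ, ξ, ν, hu⟩ := exists_extension_eq_waveIntegral hQ hK hs ha u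
  obtain ⟨X, t⟩ := P
  have hA := isAmplitude_amplitude (inner_matCLM_self_nonneg hQ) (matCLM B)
    (fun _ => covForm_pos hK one_pos) hs φ ξ ν
  have hy : 0 < z ^ 2 / 4 := by positivity
  have hpde := waveIntegral_equation hQ hK hs φ ξ ν rfl rfl X t hy
  set A := amplitude (matCLM Q) (matCLM B) s φ ξ ν
  set ρ := RCLike.map ℂ 𝕜
  set c := (2 ^ (2 * s) * Real.Gamma s)⁻¹
  have hspace : ∀ i, partialX i (fun X => extension Q B a u (X, t) z) = fun X =>
      (c * z ^ (2 * s)) • ρ (waveIntegral (matCLM B) ξ ν (fun r => A r *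
        phase (matCLM B) ξ ν r ((EuclideanSpace.single i 1, 0), 0)) ((X, t), z ^ 2 / 4)) := by
    intro i
    funext X
    simp only [partialX, hu _ z hz]
    exact hA.fderiv_space ρ _ X t hy _
  have hspace2 : ∀ i j, partialX j (partialX i (fun X => extension Q B a u (X, t) z)) X =
      (c * z ^ (2 * s)) • ρ (waveIntegral (matCLM B) ξ ν (fun r => A r *
        phase (matCLM B) ξ ν r ((EuclideanSpace.single i 1, 0), 0) *
        phase (matCLM B) ξ ν r ((EuclideanSpace.single j 1, 0), 0)) ((X, t), z ^ 2 / 4)) := by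
    intro i j
    rw [hspace i]
    exact (hA.mul_phase _).fderiv_space ρ _ X t hy _
  have htime : deriv (fun t => extension Q B a u (X, t) z) t = (c * z ^ (2 * s)) •
      ρ (waveIntegral (matCLM B) ξ ν (fun r => A r * phase (matCLM B) ξ ν r ((0, 1), 0))
        ((X, t), z ^ 2 / 4)) := by
    simp only [hu _ z hz]
    exact hA.deriv_time ρ _ X t hy
  -- The wave representation holds only for positive heights, so derivatives in `z` are compared
  -- through equality near `z`.
  have hloc : extension Q B a u (X, t) =ᶠ[𝓝 z] fun z =>
      (c * z ^ (2 * s)) • ρ (waveIntegral (matCLM B) ξ ν A ((X, t), z ^ 2 / 4)) := by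
    filter_upwards [lt_mem_nhds hz] with x hx using hu _ x hx
  have hbessel : deriv (deriv (extension Q B a u (X, t))) z +
      (a / z) • deriv (extension Q B a u (X, t)) z = (c * z ^ (2 * s)) •
        ((1 + s) • ρ (waveIntegral (matCLM B) ξ ν (fun r => A r *
          phase (matCLM B) ξ ν r ((0, 0), 1)) ((X, t), z ^ 2 / 4)) +
        (z ^ 2 / 4) • ρ (waveIntegral (matCLM B) ξ ν (fun r => A r *
          phase (matCLM B) ξ ν r ((0, 0), 1) * phase (matCLM B) ξ ν r ((0, 0), 1))
          ((X, t), z ^ 2 / 4))) := by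
    rw [hloc.deriv.deriv_eq, hloc.deriv_eq, ha]
    exact bessel_rpow_smul (fun y hy => hA.hasDerivAt_height ρ (X, t) hy)
      (fun y hy => (hA.mul_phase _).hasDerivAt_height ρ (X, t) hy) c s hz
  rw [opKa, opA]
  simp only [hspace2]
  simp only [hspace]
  rw [add_assoc (_ + _), hbessel, htime]
  have hρ := congrArg (fun x => z ^ a • (c * z ^ (2 * s)) • ρ x) hpde
  simp only [map_add, map_sub, map_sum, map_smul, map_zero, smul_zero] at hρ
  rw [← hρ]
  congr 1
  simp only [smul_add, smul_sub, Finset.smul_sum, smul_comm _ (c * z ^ (2 * s))]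
  abel

end Extension

end Hormander

theorem theorem4p2 {𝕜 : Type*} [RCLike 𝕜] {N : ℕ} (Q B : Matrix (Fin N) (Fin N) ℝ)
    (hQ : Q.PosSemidef)
    (hK : ∀ t : ℝ, 0 < t → (Hormander.covMatrix Q B t).PosDef)
    (hB : 0 ≤ B.trace)
    (s a : ℝ) (hs0 : 0 < s) (hs1 : s < 1) (ha : a = 1 - 2 * s)
    (u : 𝓢(Hormander.Sp N × ℝ, 𝕜)) :
    -- the integrals defining `U` and `(-𝒦)^s u` converge absolutely, and the two formulas for `U`
    -- agree
    (∀ (X : Hormander.Sp N) (t z : ℝ), 0 < z →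
      IntegrableOn (fun q : Hormander.Sp N × ℝ =>
        Hormander.poissonKernel Q B a z X q.1 q.2 • u (q.1, t - q.2)) (univ ×ˢ Ioi (0 : ℝ)) ∧
      Hormander.extension Q B a u (X, t) z =
        ∫ τ in Iio t, ∫ Y : Hormander.Sp N,
          Hormander.poissonKernel Q B a z X Y (t - τ) • u (Y, τ)) ∧
    (∀ P : Hormander.Sp N × ℝ,
      IntegrableOn (fun τ : ℝ => τ ^ (-1 - s) • (Hormander.evolSemigroup Q B τ u P - u P))
        (Ioi (0 : ℝ))) ∧
    -- `U` is smooth and solves the equation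
    ContDiffOn ℝ ∞ (fun q : (Hormander.Sp N × ℝ) × ℝ => Hormander.extension Q B a u q.1 q.2)
      (univ ×ˢ Ioi (0 : ℝ)) ∧
    (∀ (P : Hormander.Sp N × ℝ) (z : ℝ), 0 < z →
      Hormander.opKa Q B a (Hormander.extension Q B a u) P z = 0) ∧
    ∀ p : ℝ≥0∞, 1 ≤ p → p ≠ ⊤ →
      -- Dirichlet datum in `L^p`
      (∀ z : ℝ, 0 < z → MemLp (fun P => Hormander.extension Q B a u P z) p volume) ∧
      Tendsto (fun z : ℝ => eLpNorm (fun P => Hormander.extension Q B a u P z - u P) p volume)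
        (𝓝[>] 0) (𝓝 0) ∧
      -- weighted Neumann datum in `L^p`
      MemLp (Hormander.fracPow Q B s u) p volume ∧
      (∀ z : ℝ, 0 < z →
        MemLp (fun P => z ^ a • deriv (Hormander.extension Q B a u P) z) p volume) ∧
      Tendsto (fun z : ℝ => eLpNorm (fun P =>
          -(Hormander.neumannConst a • z ^ a • deriv (Hormander.extension Q B a u P) z)
            - Hormander.fracPow Q B s u P) p volume)
        (𝓝[>] 0) (𝓝 0) :=
  ⟨fun X t _ hz => ⟨Hormander.integrableOn_poissonKernel_smul hK hs0 ha u X t hz,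
      Hormander.extension_eq_integral_Iio u X t _⟩,
    Hormander.integrableOn_fracPow hK hB hs0 hs1 u,
    Hormander.contDiffOn_extension hQ hK hs0 ha u,
    fun P _ hz => Hormander.opKa_extension hQ hK hs0 ha u P hz,
    fun _ hp1 hp => Hormander.extension_memLp_tendsto hK hB hs0 hs1 ha u hp1 hp⟩
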